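/- **Setting.** Let $N\in\mathbb N$, $0<s<1$, $0<d\le N$ with $N-d<2s<N$, put $\alpha=s-\frac{N-d}{2}$, and let $T>0$, $\eta\in(\frac12,1]$. Let $\Omega\subset\mathbb R^N$ be a bounded $(\varepsilon,\delta)$ domain in the sense of Jones whose boundary is a $d$-set with $d$-measure $\mu$ (that is, $\operatorname{supp}\mu=\partial\Omega$ and $c_1r^d\le\mu(B(x,r)\cap\partial\Omega)\le c_2r^d$ for $x\in\partial\Omega$, $0<r\le1$, with constants $c_1,c_2>0$). Let $m=\mathcal L_N|_\Omega+\mu$ and consider the complex Hilbert space $L^2(\Omega,m)$. Let $H^s(\Omega)$ be the space of $u\in L^2(\Omega)$ with $\iint_{\Omega\times\Omega}\frac{|u(x)-u(y)|^2}{|x-y|^{N+2s}}\,dx\,dy<\infty$. It is regarded as a subspace of $L^2(\Omega,m)$ by identifying $u$ with $(u,u|_{\partial\Omega})$, where $u|_{\partial\Omega}(x)=\lim_{r\to0}\frac1{|B(x,r)\cap\Omega|}\int_{B(x,r)\cap\Omega}u\,dy$ for $\mu$-a.e. $x\in\partial\Omega$ is the trace. Let $K:[0,T]\times\Omega\times\Omega\to\mathbb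 R$ and $\zeta:[0,T]\times\partial\Omega\times\partial\Omega\to\mathbb R$ be measurable, symmetric in $(x,y)$, with $k_1\le K\le k_2$ and $\zeta_1\le\zeta\le\zeta_2$ a.e. for constants $0<k_1<k_2$, $0<\zeta_1<\zeta_2$, and, for all $t,\tau\in[0,T]$, $|K(t,x,y)-K(\tau,x,y)|\le C|t-\tau|^\eta$ for a.e. $x,y\in\Omega$ and $|\zeta(t,x,y)-\zeta(\tau,x,y)|\le C|t-\tau|^\eta$ for $\mu$-a.e. $x,y\in\partial\Omega$. Let $b\in L^\infty([0,T]\times\partial\Omega)$ be real-valued with $b(t,P)>b_0>0$ and $|b(t,P)-b(\tau,P)|\le c|t-\tau|^\eta$ for all $t,\tau\in[0,T]$, $P\in\partial\Omega$. With $C_{N,s}=\frac{s2^{2s}\Gamma(\frac{N+2s}{2})}{\pi^{N/2}\Gamma(1-s)}$ put, for $u,v\in H^s(\Omega)$, $$E(t,u,v)=\frac{C_{N,s}}2\iint_{\Omega\times\Omega}K(t,x,y)\frac{(u(x)-u(y))\overline{(v(x)-v(y))}}{|x-y|^{N+2s}}\,dx\,dy+\int_{\partial\Omega}b(t,P)\,u\,\overline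 v\,d\mu+\iint_{\partial\Omega\times\partial\Omega}\zeta(t,x,y)\frac{(u(x)-u(y))\overline{(v(x)-v(y))}}{|x-y|^{d+2\alpha}}\,d\mu(x)\,d\mu(y).$$ Let $A(t)$ be the associated non-positive operator on $L^2(\Omega,m)$: $u\in D(A(t))$ and $A(t)u=f$ if and only if $u\in H^s(\Omega)$, $f\in L^2(\Omega,m)$ and $E(t,u,v)=(-f,v)_{L^2(\Omega,m)}$ for all $v\in H^s(\Omega)$. Fractional powers $(-A(t))^{\nu}$ are defined by $(-A(t))^{-\nu}=((-A(t))^{-1})^{\nu}$ (functional calculus). **Proposition.** 1. There are $\omega\in(0,\frac\pi2)$, $M\ge1$ and $M_1$, independent of $t$, such that for every $t\in[0,T]$: $\sigma(-A(t))\subset\Sigma_\omega:=\{z\in\mathbb C\setminus\{0\}:|\operatorname{Arg}z|<\omega\}$; $\|(z+A(t))^{-1}\|_{\mathcal L(L^2(\Omega,m))}\le M/|z|$ for all $z\notin\Sigma_\omega\cup\{0\}$; and $A(t)$ is invertible with $\|A(t)^{-1}\|_{\mathcal L(L^2(\Omega,m))}\le M_1$. 2. For all $t,\tau\in[0,T]$,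 $D(A(t))\subset D((-A(\tau))^{1/2})=H^s(\Omega)$, and $D(A(t))\subset D((-A(\tau))^{\nu})$ for every $0<\nu\le\frac12$. Here every $u\in H^s(\Omega)$ has a trace $\mu$-a.e. on $\partial\Omega$, which is in $L^2(\partial\Omega,\mu)$. 3. There is $C>0$ such that for all $t,\tau\in[0,T]$ the operator $(-A(t))^{1/2}\big(A(t)^{-1}-A(\tau)^{-1}\big)$ is everywhere defined and bounded on $L^2(\Omega,m)$, with $$\big\|(-A(t))^{1/2}\big(A(t)^{-1}-A(\tau)^{-1}\big)\big\|_{\mathcal L(L^2(\Omega,m))}\le C|t-\tau|^\eta .$$ -/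

import Mathlib

open MeasureTheory Filter Topology Set
open scoped ENNReal ComplexConjugate

noncomputable section

/-! ## Domains and sets in Euclidean space -/

/-- `(ε, δ)` domains in the sense of Jones. The path is parametrised by `[0,1]`, its length is its
total variation. The distance to the complement is taken in `[0, ∞]`, so that it is `∞` if the
complement is empty. -/
structure IsEpsDeltaDomain {N : ℕ} (ε δ : ℝ) (F : Set (EuclideanSpace ℝ (Fin N))) : Prop where
  isOpen : IsOpen F
  isConnected : IsConnected F
  exists_path : ∀ x ∈ F, ∀ y ∈ F, dist x y < δ →
    ∃ γ : Path x y, (∀ r, γ r ∈ F) ∧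
      eVariationOn γ Set.univ ≤ ENNReal.ofReal (1 / ε * dist x y) ∧
      ∀ r, ENNReal.ofReal (ε * dist x (γ r) * dist y (γ r) / dist x y) ≤
        Metric.infEDist (γ r) Fᶜ

/-- `μ` is a `d`-measure on the closed nonempty set `S` (so that `S` is a `d`-set). The two-sided
bound is required for radii `0 < r ≤ 1`, as usual. -/
structure IsDMeasure {N : ℕ} (d : ℝ) (S : Set (EuclideanSpace ℝ (Fin N)))
    (μ : Measure (EuclideanSpace ℝ (Fin N))) : Prop where
  isClosed : IsClosed S
  nonempty : S.Nonempty
  support_eq : μ.support = S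
  bounds : ∃ c₁ c₂ : ℝ, 0 < c₁ ∧ 0 < c₂ ∧ ∀ x ∈ S, ∀ r : ℝ, 0 < r → r ≤ 1 →
    ENNReal.ofReal (c₁ * r ^ d) ≤ μ (Metric.ball x r ∩ S) ∧
      μ (Metric.ball x r ∩ S) ≤ ENNReal.ofReal (c₂ * r ^ d)

/-- The measure `dm = dx + dμ` on `Ω ∪ ∂Ω`. -/
def bulkBoundaryMeasure {N : ℕ} (Ω : Set (EuclideanSpace ℝ (Fin N)))
    (μ : Measure (EuclideanSpace ℝ (Fin N))) : Measure (EuclideanSpace ℝ (Fin N)) :=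
  volume.restrict Ω + μ

/-- The complex Hilbert space `L²(Ω, m)`, `m = dx + dμ`. -/
abbrev BulkBoundaryL2 {N : ℕ} (Ω : Set (EuclideanSpace ℝ (Fin N)))
    (μ : Measure (EuclideanSpace ℝ (Fin N))) : Type :=
  Lp ℂ 2 (bulkBoundaryMeasure Ω μ)

/-! ## The fractional Sobolev space and traces -/

/-- `u ∈ H^s(Ω)`: `u` is in `L²(Ω)`, and the difference quotient
`(u(x) - u(y)) / |x - y|^((N + 2s)/2)` is in `L²(Ω × Ω)`, that is, the Gagliardo seminorm
`∬ |u(x) - u(y)|² / |x - y|^(N + 2s) dx dy` is finite. -/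
def MemHs {N : ℕ} (s : ℝ) (Ω : Set (EuclideanSpace ℝ (Fin N)))
    (u : EuclideanSpace ℝ (Fin N) → ℂ) : Prop :=
  MemLp u 2 (volume.restrict Ω) ∧
  MemLp (fun p : EuclideanSpace ℝ (Fin N) × EuclideanSpace ℝ (Fin N) =>
      (u p.1 - u p.2) / ((dist p.1 p.2 ^ (((N : ℝ) + 2 * s) / 2) : ℝ) : ℂ)) 2
    ((volume.restrict Ω).prod (volume.restrict Ω))

/-- The trace of `u` at `x` exists and equals `z`: the averages of `u` over `B(x, r) ∩ Ω` tend
to `z` as `r → 0+`. -/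
def HasTraceAt {N : ℕ} (Ω : Set (EuclideanSpace ℝ (Fin N)))
    (u : EuclideanSpace ℝ (Fin N) → ℂ) (x : EuclideanSpace ℝ (Fin N)) (z : ℂ) : Prop :=
  Tendsto (fun r : ℝ => ⨍ y in Metric.ball x r ∩ Ω, u y) (𝓝[>] 0) (𝓝 z)

theorem restrict_le_bulkBoundary {N : ℕ} (Ω : Set (EuclideanSpace ℝ (Fin N)))
    (μ : Measure (EuclideanSpace ℝ (Fin N))) :
    volume.restrict Ω ≤ bulkBoundaryMeasure Ω μ := Measure.le_add_right le_rfl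

theorem le_bulkBoundary {N : ℕ} (Ω : Set (EuclideanSpace ℝ (Fin N)))
    (μ : Measure (EuclideanSpace ℝ (Fin N))) :
    μ ≤ bulkBoundaryMeasure Ω μ := Measure.le_add_left le_rfl

theorem MemHs.congr {N : ℕ} {s : ℝ} {Ω : Set (EuclideanSpace ℝ (Fin N))}
    {u v : EuclideanSpace ℝ (Fin N) → ℂ} (hu : MemHs s Ω u)
    (h : u =ᵐ[volume.restrict Ω] v) : MemHs s Ω v := by
  refine ⟨hu.1.ae_eq h, hu.2.ae_eq ?_⟩
  have h1 := Measure.quasiMeasurePreserving_fst (μ := volume.restrict Ω)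
    (ν := volume.restrict Ω) |>.ae h
  have h2 := Measure.quasiMeasurePreserving_snd (μ := volume.restrict Ω)
    (ν := volume.restrict Ω) |>.ae h
  filter_upwards [h1, h2] with p hp1 hp2
  rw [hp1, hp2]

theorem MemHs.add {N : ℕ} {s : ℝ} {Ω : Set (EuclideanSpace ℝ (Fin N))}
    {u v : EuclideanSpace ℝ (Fin N) → ℂ} (hu : MemHs s Ω u) (hv : MemHs s Ω v) :
    MemHs s Ω (u + v) := by
  refine ⟨hu.1.add hv.1, (hu.2.add hv.2).ae_eq (Eventually.of_forall fun p => ?_)⟩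
  simp only [Pi.add_apply]
  ring

theorem MemHs.const_smul {N : ℕ} {s : ℝ} {Ω : Set (EuclideanSpace ℝ (Fin N))}
    {u : EuclideanSpace ℝ (Fin N) → ℂ} (c : ℂ) (hu : MemHs s Ω u) :
    MemHs s Ω (c • u) := by
  refine ⟨hu.1.const_smul c, (hu.2.const_smul c).ae_eq (Eventually.of_forall fun p => ?_)⟩
  simp only [Pi.smul_apply, smul_eq_mul]
  ring

theorem HasTraceAt.congr {N : ℕ} {Ω : Set (EuclideanSpace ℝ (Fin N))}
    {u v : EuclideanSpace ℝ (Fin N) → ℂ} {x : EuclideanSpace ℝ (Fin N)} {z : ℂ}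
    (hu : HasTraceAt Ω u x z) (h : u =ᵐ[volume.restrict Ω] v) : HasTraceAt Ω v x z := by
  refine Tendsto.congr (fun r => ?_) hu
  refine average_congr ?_
  exact ae_restrict_of_ae_restrict_of_subset inter_subset_right h

theorem memLp_integrableOn_ball {N : ℕ} {Ω : Set (EuclideanSpace ℝ (Fin N))}
    {u : EuclideanSpace ℝ (Fin N) → ℂ} (hu : MemLp u 2 (volume.restrict Ω))
    (x : EuclideanSpace ℝ (Fin N)) (r : ℝ) : IntegrableOn u (Metric.ball x r ∩ Ω) := by
  have h1 : MemLp u 2 (volume.restrict (Metric.ball x r ∩ Ω)) :=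
    hu.mono_measure (Measure.restrict_mono inter_subset_right le_rfl)
  have : IsFiniteMeasure (volume.restrict (Metric.ball x r ∩ Ω)) :=
    ⟨by
      rw [Measure.restrict_apply_univ]
      exact (measure_mono inter_subset_left).trans_lt measure_ball_lt_top⟩
  exact h1.integrable (by norm_num)

theorem HasTraceAt.add {N : ℕ} {Ω : Set (EuclideanSpace ℝ (Fin N))}
    {u v : EuclideanSpace ℝ (Fin N) → ℂ} {x : EuclideanSpace ℝ (Fin N)} {z w : ℂ}
    (hu2 : MemLp u 2 (volume.restrict Ω)) (hv2 : MemLp v 2 (volume.restrict Ω))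
    (hu : HasTraceAt Ω u x z) (hv : HasTraceAt Ω v x w) : HasTraceAt Ω (u + v) x (z + w) := by
  refine (Tendsto.add hu hv).congr fun r => ?_
  simp only [setAverage_eq, Pi.add_apply]
  rw [integral_add (memLp_integrableOn_ball hu2 x r) (memLp_integrableOn_ball hv2 x r), smul_add]

theorem HasTraceAt.const_smul {N : ℕ} {Ω : Set (EuclideanSpace ℝ (Fin N))}
    {u : EuclideanSpace ℝ (Fin N) → ℂ} {x : EuclideanSpace ℝ (Fin N)} {z : ℂ} (c : ℂ)
    (hu : HasTraceAt Ω u x z) : HasTraceAt Ω (c • u) x (c • z) := by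
  refine (Tendsto.const_smul hu c).congr fun r => ?_
  simp only [setAverage_eq, Pi.smul_apply]
  rw [integral_smul, smul_comm]

/-- `H^s(Ω)` as a subspace of `L²(Ω, m)`: the function `u ∈ H^s(Ω)` is identified with the pair
`(u, u|∂Ω)`, where `u|∂Ω` is the trace of `u`. -/
def hsSubspace {N : ℕ} (s : ℝ) (Ω : Set (EuclideanSpace ℝ (Fin N)))
    (μ : Measure (EuclideanSpace ℝ (Fin N))) : Submodule ℂ (BulkBoundaryL2 Ω μ) where
  carrier := {U | MemHs s Ω U ∧ ∀ᵐ x ∂μ, HasTraceAt Ω U x (U x)}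
  zero_mem' := by
    have h0 := Lp.coeFn_zero ℂ 2 (bulkBoundaryMeasure Ω μ)
    have hΩ := ae_mono (restrict_le_bulkBoundary Ω μ) h0
    have hμ := ae_mono (le_bulkBoundary Ω μ) h0
    have hz : MemHs s Ω (0 : EuclideanSpace ℝ (Fin N) → ℂ) := by
      refine ⟨MemLp.zero, ?_⟩
      simp
    refine ⟨hz.congr (EventuallyEq.symm hΩ), ?_⟩
    filter_upwards [hμ] with x hx
    rw [hx]
    refine HasTraceAt.congr (u := 0) ?_ (EventuallyEq.symm hΩ)
    simp [HasTraceAt]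
  add_mem' := by
    rintro U V ⟨hU, hU'⟩ ⟨hV, hV'⟩
    have h0 := Lp.coeFn_add U V
    have hΩ := ae_mono (restrict_le_bulkBoundary Ω μ) h0
    have hμ := ae_mono (le_bulkBoundary Ω μ) h0
    refine ⟨(hU.add hV).congr (EventuallyEq.symm hΩ), ?_⟩
    filter_upwards [hμ, hU', hV'] with x hx hxU hxV
    rw [hx]
    exact (HasTraceAt.add hU.1 hV.1 hxU hxV).congr (EventuallyEq.symm hΩ)
  smul_mem' := by
    rintro c U ⟨hU, hU'⟩
    have h0 := Lp.coeFn_smul c U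
    have hΩ := ae_mono (restrict_le_bulkBoundary Ω μ) h0
    have hμ := ae_mono (le_bulkBoundary Ω μ) h0
    refine ⟨(hU.const_smul c).congr (EventuallyEq.symm hΩ), ?_⟩
    filter_upwards [hμ, hU'] with x hx hxU
    rw [hx]
    exact (hxU.const_smul c).congr (EventuallyEq.symm hΩ)

/-! ## The coefficients and the energy form -/

/-- The assumptions on the kernels `K` (with `ν` the Lebesgue measure on `S = Ω`) and `ζ` (with
`ν = μ` and `S = ∂Ω`): measurable, symmetric in `(x, y)`, bounded above and bounded away from zero
a.e., and Hölder continuous in time with exponent `η`. -/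
structure IsAdmissibleKernel {N : ℕ} (T η : ℝ) (S : Set (EuclideanSpace ℝ (Fin N)))
    (ν : Measure (EuclideanSpace ℝ (Fin N)))
    (κ : ℝ → EuclideanSpace ℝ (Fin N) → EuclideanSpace ℝ (Fin N) → ℝ) : Prop where
  aemeasurable : AEMeasurable
    (fun p : ℝ × EuclideanSpace ℝ (Fin N) × EuclideanSpace ℝ (Fin N) => κ p.1 p.2.1 p.2.2)
    ((volume.restrict (Icc 0 T)).prod (ν.prod ν))
  symm : ∀ t ∈ Icc 0 T, ∀ x ∈ S, ∀ y ∈ S, κ t x y = κ t y x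
  bounds : ∃ k₁ k₂ : ℝ, 0 < k₁ ∧ k₁ < k₂ ∧
    ∀ᵐ p : ℝ × EuclideanSpace ℝ (Fin N) × EuclideanSpace ℝ (Fin N)
      ∂((volume.restrict (Icc 0 T)).prod (ν.prod ν)),
      k₁ ≤ κ p.1 p.2.1 p.2.2 ∧ κ p.1 p.2.1 p.2.2 ≤ k₂
  holder : ∃ C : ℝ, ∀ t ∈ Icc 0 T, ∀ τ ∈ Icc 0 T,
    ∀ᵐ q : EuclideanSpace ℝ (Fin N) × EuclideanSpace ℝ (Fin N) ∂(ν.prod ν),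
      |κ t q.1 q.2 - κ τ q.1 q.2| ≤ C * |t - τ| ^ η

/-- The assumptions on the boundary coefficient `b`. -/
structure IsAdmissiblePotential {N : ℕ} (T η : ℝ) (S : Set (EuclideanSpace ℝ (Fin N)))
    (μ : Measure (EuclideanSpace ℝ (Fin N)))
    (b : ℝ → EuclideanSpace ℝ (Fin N) → ℝ) : Prop where
  memLp_top : MemLp (fun p : ℝ × EuclideanSpace ℝ (Fin N) => b p.1 p.2) ∞
    ((volume.restrict (Icc 0 T)).prod μ)
  lower : ∃ b₀ : ℝ, 0 < b₀ ∧ ∀ t ∈ Icc 0 T, ∀ P ∈ S, b₀ < b t P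
  holder : ∃ c : ℝ, ∀ t ∈ Icc 0 T, ∀ τ ∈ Icc 0 T, ∀ P ∈ S, |b t P - b τ P| ≤ c * |t - τ| ^ η

/-- The constant `C_{N,s}` of the (regional) fractional Laplacian. -/
def fracLaplaceConst (N : ℕ) (s : ℝ) : ℝ :=
  s * 2 ^ (2 * s) * Real.Gamma (((N : ℝ) + 2 * s) / 2) /
    (Real.pi ^ ((N : ℝ) / 2) * Real.Gamma (1 - s))

/-- The integrand `κ(x,y) (u(x) - u(y)) conj(v(x) - v(y)) / |x - y|^a`. -/
def nonlocalIntegrand {N : ℕ} (a : ℝ)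
    (κ : EuclideanSpace ℝ (Fin N) → EuclideanSpace ℝ (Fin N) → ℝ)
    (u v : EuclideanSpace ℝ (Fin N) → ℂ)
    (p : EuclideanSpace ℝ (Fin N) × EuclideanSpace ℝ (Fin N)) : ℂ :=
  (κ p.1 p.2 : ℂ) * ((u p.1 - u p.2) * conj (v p.1 - v p.2)) / ((dist p.1 p.2 ^ a : ℝ) : ℂ)

/-- The integrand `b(P) u(P) conj(v(P))`. -/
def potentialIntegrand {N : ℕ} (b : EuclideanSpace ℝ (Fin N) → ℝ)
    (u v : EuclideanSpace ℝ (Fin N) → ℂ) (P : EuclideanSpace ℝ (Fin N)) : ℂ :=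
  (b P : ℂ) * (u P * conj (v P))

/-- The exponent `α = s - (N - d)/2`. -/
def besovExponent (N : ℕ) (s d : ℝ) : ℝ := s - ((N : ℝ) - d) / 2

/-- The energy form at a fixed time, with kernels `K = K(t,·,·)`, `ζ = ζ(t,·,·)` and `b = b(t,·)`,
as a sesquilinear form (linear in `u`, conjugate linear in `v`). On `∂Ω`, elements of `hsSubspace`
coincide with the trace of their restriction to `Ω`. -/
def energyForm {N : ℕ} (s d : ℝ) (Ω : Set (EuclideanSpace ℝ (Fin N)))
    (μ : Measure (EuclideanSpace ℝ (Fin N)))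
    (K ζ : EuclideanSpace ℝ (Fin N) → EuclideanSpace ℝ (Fin N) → ℝ)
    (b : EuclideanSpace ℝ (Fin N) → ℝ) (u v : EuclideanSpace ℝ (Fin N) → ℂ) : ℂ :=
  ((fracLaplaceConst N s / 2 : ℝ) : ℂ) *
      ∫ p, nonlocalIntegrand ((N : ℝ) + 2 * s) K u v p
        ∂((volume.restrict Ω).prod (volume.restrict Ω)) +
    ∫ P, potentialIntegrand b u v P ∂μ +
    ∫ p, nonlocalIntegrand (d + 2 * besovExponent N s d) ζ u v p ∂(μ.prod μ)

/-- The three integrals in `energyForm` converge absolutely. -/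
def EnergyConverges {N : ℕ} (s d : ℝ) (Ω : Set (EuclideanSpace ℝ (Fin N)))
    (μ : Measure (EuclideanSpace ℝ (Fin N)))
    (K ζ : EuclideanSpace ℝ (Fin N) → EuclideanSpace ℝ (Fin N) → ℝ)
    (b : EuclideanSpace ℝ (Fin N) → ℝ) (u v : EuclideanSpace ℝ (Fin N) → ℂ) : Prop :=
  Integrable (nonlocalIntegrand ((N : ℝ) + 2 * s) K u v)
      ((volume.restrict Ω).prod (volume.restrict Ω)) ∧
    Integrable (potentialIntegrand b u v) μ ∧
    Integrable (nonlocalIntegrand (d + 2 * besovExponent N s d) ζ u v) (μ.prod μ)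

section lemmas

variable {N : ℕ} {a s d : ℝ} {Ω : Set (EuclideanSpace ℝ (Fin N))}
  {μ ν : Measure (EuclideanSpace ℝ (Fin N))}
  {K ζ κ : EuclideanSpace ℝ (Fin N) → EuclideanSpace ℝ (Fin N) → ℝ}
  {b : EuclideanSpace ℝ (Fin N) → ℝ} {u u' v : EuclideanSpace ℝ (Fin N) → ℂ}

theorem nonlocalIntegrand_ae_congr (h : u =ᵐ[ν] u') :
    nonlocalIntegrand a κ u v =ᵐ[ν.prod ν] nonlocalIntegrand a κ u' v := by
  have h1 := Measure.quasiMeasurePreserving_fst (μ := ν) (ν := ν) |>.ae h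
  have h2 := Measure.quasiMeasurePreserving_snd (μ := ν) (ν := ν) |>.ae h
  filter_upwards [h1, h2] with p hp1 hp2
  simp only [nonlocalIntegrand, hp1, hp2]

theorem potentialIntegrand_ae_congr (h : u =ᵐ[ν] u') :
    potentialIntegrand b u v =ᵐ[ν] potentialIntegrand b u' v := by
  filter_upwards [h] with p hp
  simp only [potentialIntegrand, hp]

theorem nonlocalIntegrand_add : nonlocalIntegrand a κ (u + u') v =
    nonlocalIntegrand a κ u v + nonlocalIntegrand a κ u' v := by
  funext p
  simp only [nonlocalIntegrand, Pi.add_apply]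
  ring

theorem nonlocalIntegrand_smul (c : ℂ) : nonlocalIntegrand a κ (c • u) v =
    c • nonlocalIntegrand a κ u v := by
  funext p
  simp only [nonlocalIntegrand, Pi.smul_apply, smul_eq_mul]
  ring

theorem potentialIntegrand_add : potentialIntegrand b (u + u') v =
    potentialIntegrand b u v + potentialIntegrand b u' v := by
  funext p
  simp only [potentialIntegrand, Pi.add_apply]
  ring

theorem potentialIntegrand_smul (c : ℂ) : potentialIntegrand b (c • u) v =
    c • potentialIntegrand b u v := by
  funext p
  simp only [potentialIntegrand, Pi.smul_apply, smul_eq_mul]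
  ring

theorem EnergyConverges.congr (h : EnergyConverges s d Ω μ K ζ b u v)
    (hu : u =ᵐ[bulkBoundaryMeasure Ω μ] u') : EnergyConverges s d Ω μ K ζ b u' v :=
  have hΩ := ae_mono (restrict_le_bulkBoundary Ω μ) hu
  have hμ := ae_mono (le_bulkBoundary Ω μ) hu
  ⟨h.1.congr (nonlocalIntegrand_ae_congr hΩ), h.2.1.congr (potentialIntegrand_ae_congr hμ),
    h.2.2.congr (nonlocalIntegrand_ae_congr hμ)⟩

theorem energyForm_congr (hu : u =ᵐ[bulkBoundaryMeasure Ω μ] u') :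
    energyForm s d Ω μ K ζ b u v = energyForm s d Ω μ K ζ b u' v := by
  have hΩ := ae_mono (restrict_le_bulkBoundary Ω μ) hu
  have hμ := ae_mono (le_bulkBoundary Ω μ) hu
  unfold energyForm
  rw [integral_congr_ae (nonlocalIntegrand_ae_congr hΩ),
    integral_congr_ae (potentialIntegrand_ae_congr hμ),
    integral_congr_ae (nonlocalIntegrand_ae_congr hμ)]

theorem EnergyConverges.add (h : EnergyConverges s d Ω μ K ζ b u v)
    (h' : EnergyConverges s d Ω μ K ζ b u' v) : EnergyConverges s d Ω μ K ζ b (u + u') v := by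
  unfold EnergyConverges
  rw [nonlocalIntegrand_add, nonlocalIntegrand_add, potentialIntegrand_add]
  exact ⟨h.1.add h'.1, h.2.1.add h'.2.1, h.2.2.add h'.2.2⟩

theorem energyForm_add (h : EnergyConverges s d Ω μ K ζ b u v)
    (h' : EnergyConverges s d Ω μ K ζ b u' v) : energyForm s d Ω μ K ζ b (u + u') v =
      energyForm s d Ω μ K ζ b u v + energyForm s d Ω μ K ζ b u' v := by
  unfold energyForm
  rw [nonlocalIntegrand_add, nonlocalIntegrand_add, potentialIntegrand_add,
    integral_add' h.1 h'.1, integral_add' h.2.1 h'.2.1, integral_add' h.2.2 h'.2.2]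
  ring

theorem EnergyConverges.smul (c : ℂ) (h : EnergyConverges s d Ω μ K ζ b u v) :
    EnergyConverges s d Ω μ K ζ b (c • u) v := by
  unfold EnergyConverges
  rw [nonlocalIntegrand_smul, nonlocalIntegrand_smul, potentialIntegrand_smul]
  exact ⟨h.1.smul c, h.2.1.smul c, h.2.2.smul c⟩

theorem energyForm_smul (c : ℂ) : energyForm s d Ω μ K ζ b (c • u) v =
      c * energyForm s d Ω μ K ζ b u v := by
  unfold energyForm
  rw [nonlocalIntegrand_smul, nonlocalIntegrand_smul, potentialIntegrand_smul]
  simp only [Pi.smul_apply, integral_const_mul, smul_eq_mul]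
  ring

end lemmas

/-- The graph of the operator associated with the energy form at a fixed time: all pairs `(u, f)`
with `u ∈ H^s(Ω)`, `f ∈ L²(Ω, m)` and `E(u, v) = (-f, v)` for all `v ∈ H^s(Ω)` (where
`(f, v) = ∫ f conj(v) dm`). -/
def energyOperatorGraph {N : ℕ} (s d : ℝ) (Ω : Set (EuclideanSpace ℝ (Fin N)))
    (μ : Measure (EuclideanSpace ℝ (Fin N)))
    (K ζ : EuclideanSpace ℝ (Fin N) → EuclideanSpace ℝ (Fin N) → ℝ)
    (b : EuclideanSpace ℝ (Fin N) → ℝ) :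
    Submodule ℂ (BulkBoundaryL2 Ω μ × BulkBoundaryL2 Ω μ) where
  carrier := {q | q.1 ∈ hsSubspace s Ω μ ∧ ∀ v ∈ hsSubspace s Ω μ,
    EnergyConverges s d Ω μ K ζ b q.1 v ∧
      energyForm s d Ω μ K ζ b q.1 v = inner ℂ v (-q.2)}
  zero_mem' := by
    refine ⟨Submodule.zero_mem _, fun v _ => ?_⟩
    have h0 := Lp.coeFn_zero ℂ 2 (bulkBoundaryMeasure Ω μ)
    have e1 : ∀ a κ, nonlocalIntegrand a κ (0 : EuclideanSpace ℝ (Fin N) → ℂ) v = 0 := by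
      intro a κ; funext p; simp [nonlocalIntegrand]
    have e2 : potentialIntegrand b (0 : EuclideanSpace ℝ (Fin N) → ℂ) v = 0 := by
      funext p; simp [potentialIntegrand]
    constructor
    · refine EnergyConverges.congr (u := 0) ?_ (EventuallyEq.symm h0)
      unfold EnergyConverges
      rw [e1, e1, e2]
      exact ⟨integrable_zero _ _ _, integrable_zero _ _ _, integrable_zero _ _ _⟩
    · refine (energyForm_congr h0).trans ?_
      unfold energyForm
      rw [e1, e1, e2]
      simp
  add_mem' := by
    rintro q q' ⟨hq, hq'⟩ ⟨hr, hr'⟩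
    refine ⟨Submodule.add_mem _ hq hr, fun v hv => ?_⟩
    have h0 := Lp.coeFn_add q.1 q'.1
    obtain ⟨a1, a2⟩ := hq' v hv
    obtain ⟨b1, b2⟩ := hr' v hv
    refine ⟨(a1.add b1).congr (EventuallyEq.symm h0), ?_⟩
    refine (energyForm_congr h0).trans ?_
    rw [energyForm_add a1 b1, a2, b2, Prod.snd_add, neg_add, inner_add_right]
  smul_mem' := by
    rintro c q ⟨hq, hq'⟩
    refine ⟨Submodule.smul_mem _ c hq, fun v hv => ?_⟩
    have h0 := Lp.coeFn_smul c q.1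
    obtain ⟨a1, a2⟩ := hq' v hv
    refine ⟨(a1.smul c).congr (EventuallyEq.symm h0), ?_⟩
    refine (energyForm_congr h0).trans ?_
    rw [energyForm_smul, a2, Prod.smul_snd, ← smul_neg, inner_smul_right]

/-- The (non-positive) operator `A` associated with the energy form at a fixed time,
`E(u, v) = (-A u, v)` for `u ∈ D(A)` and `v ∈ H^s(Ω)`. -/
def energyOperator {N : ℕ} (s d : ℝ) (Ω : Set (EuclideanSpace ℝ (Fin N)))
    (μ : Measure (EuclideanSpace ℝ (Fin N)))
    (K ζ : EuclideanSpace ℝ (Fin N) → EuclideanSpace ℝ (Fin N) → ℝ)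
    (b : EuclideanSpace ℝ (Fin N) → ℝ) :
    BulkBoundaryL2 Ω μ →ₗ.[ℂ] BulkBoundaryL2 Ω μ :=
  (energyOperatorGraph s d Ω μ K ζ b).toLinearPMap

/-! ## Unbounded operators: inverse, spectrum, fractional powers -/

section operators

variable {H : Type*} [NormedAddCommGroup H] [InnerProductSpace ℂ H]

/-- `R` is the bounded inverse of the unbounded operator `L`. -/
def IsBoundedInverse (L : H →ₗ.[ℂ] H) (R : H →L[ℂ] H) : Prop :=
  (∀ f : H, ∃ u : L.domain, (u : H) = R f ∧ L u = f) ∧ ∀ u : L.domain, R (L u) = u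

/-- The unbounded operator `L` has a bounded, everywhere defined inverse. -/
def HasBoundedInverse (L : H →ₗ.[ℂ] H) : Prop := ∃ R : H →L[ℂ] H, IsBoundedInverse L R

open scoped Classical in
/-- The bounded inverse `L⁻¹` (zero if there is none). -/
def boundedInverse (L : H →ₗ.[ℂ] H) : H →L[ℂ] H :=
  if h : HasBoundedInverse L then h.choose else 0

/-- The operator `z - L` on `D(L)`. -/
def shiftSub (z : ℂ) (L : H →ₗ.[ℂ] H) : H →ₗ.[ℂ] H :=
  ⟨L.domain, z • L.domain.subtype - L.toFun⟩

/-- The spectrum of an unbounded operator. -/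
def opSpectrum (L : H →ₗ.[ℂ] H) : Set ℂ := {z | ¬ HasBoundedInverse (shiftSub z L)}

/-- The open sector `{z ≠ 0 : |Arg z| < ω}`. -/
def openSector (ω : ℝ) : Set ℂ := {z | z ≠ 0 ∧ |Complex.arg z| < ω}

/-- The fractional power `L^ν`, `ν > 0`, of a positive selfadjoint operator `L` with bounded
inverse: `L^(-ν) = (L⁻¹)^ν` is given by the functional calculus of the bounded nonnegative
selfadjoint operator `L⁻¹`, and `L^ν` is the inverse of `L^(-ν)`, with domain the range of
`L^(-ν)`. -/
def fracPower [CompleteSpace H] (L : H →ₗ.[ℂ] H) (ν : ℝ) : H →ₗ.[ℂ] H :=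
  (((boundedInverse L ^ ν : H →L[ℂ] H) : H →ₗ[ℂ] H).toPMap ⊤).inverse

end operators

end

/-!
The three assertions are consequences of the form method once `H^s(Ω)`, with its trace, is known to
be a Hilbert space on which the energy forms are bounded and coercive uniformly in time.

*Operators.* Let `J : V → H` be injective with dense range and let `T` be the Riesz operator of a
bounded symmetric coercive form on `V` (`IsCoerciveRiesz`). The associated operator `-A` has the
bounded nonnegative inverse `R = J T⁻¹ J*` (`formInverse`, `IsFormOperator`). Since `⟪R x, x⟫ ≥ 0`,
the operator `1 - z R` is coercive for `z` off the sector of half-angle `π / 4`, which gives the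
resolvent bound (`exists_resolvent`). The norms of `R^(1/2) f` and of `J* f` are equivalent, so by
Douglas' factorisation lemma `R^(1/2)` and `J` have the same range
(`IsCoerciveRiesz.range_sqrt_formInverse`), that is, the domain of `(-A)^(1/2)` is the form domain.
Moreover `J = R^(1/2) Z` with `Z` bounded, so for two forms
`(-A)^(1/2) (A⁻¹ - A'⁻¹) = Z (T'⁻¹ - T⁻¹) J*`, whose norm is controlled by `‖T - T'‖`
(`IsFormOperator.exists_sqrt_inverse_sub_inverse`). Only Hölder continuity of `t ↦ T(t)` is then
needed, and this is Hölder continuity of the coefficients, which act by multiplication.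

*Traces.* The space `V` is `formDomain`, the triples made of a function in `H^s(Ω)`, with its
boundary values, and of its difference quotients on `Ω × Ω` and `∂Ω × ∂Ω`. Its properties follow
from a trace theorem which is proved without extension operators. The (ε, δ) condition is used only
to find, in each small ball about a boundary point, a ball of comparable radius well inside `Ω`
(`exists_ball_subset_interiorLayer`). The mean values of `u` over such interior layers at the dyadic
scales `r₀ 2⁻ʲ` form a sequence whose steps are bounded by the energy located in the layers
(`TraceGeometry.enorm_layerMean_sub_sq_le`). As `N - d < 2 s`, these bounds carry a geometric
factor, and a discrete Hardy inequality (`enorm_sub_sq_le_sum`) yields convergence to the trace with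
a rate (`TraceGeometry.exists_hasTraceAt`). A point of `Ω` lies in layers of boundedly many scales,
so the energies of the layers, summed over the scales and integrated over the boundary, are bounded
by the total energy (`TraceGeometry.exists_lintegral_tsum_scaledEnergy_le`). This gives the bounds
of the trace in `L²(∂Ω)` and in the Besov space on `∂Ω`, and a Poincaré inequality by which the
energy and the trace control the `L²(Ω)` norm; they are collected in
`TraceGeometry.exists_trace_bounds`. The first of them makes the form domain complete, the second
makes the boundary term of the form finite, and the third makes the form coercive. Density of the
form domain comes from restrictions of smooth functions.

*Coefficients.* The bounds on the coefficients hold for almost every time only; by the Hölder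
condition they pass to every time (`aemeasurable_and_bounds_of_holder`).
-/

noncomputable section

/-! ### Operators given by coercive forms, and their square roots -/

section AbstractOperators

open ContinuousLinearMap

variable {H V : Type*} [NormedAddCommGroup H] [InnerProductSpace ℂ H]
  [NormedAddCommGroup V] [InnerProductSpace ℂ V]

theorem IsBoundedInverse.unique {L : H →ₗ.[ℂ] H} {R R' : H →L[ℂ] H}
    (h : IsBoundedInverse L R) (h' : IsBoundedInverse L R') : R = R' := by
  ext f
  obtain ⟨u, hu, hf⟩ := h.1 f
  rw [← hu, ← h'.2 u, hf]

theorem IsBoundedInverse.boundedInverse_eq {L : H →ₗ.[ℂ] H} {R : H →L[ℂ] H}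
    (h : IsBoundedInverse L R) : boundedInverse L = R := by
  have hL : HasBoundedInverse L := ⟨R, h⟩
  rw [boundedInverse, dif_pos hL]
  exact hL.choose_spec.unique h

theorem IsBoundedInverse.of_mem_graph_iff {L : H →ₗ.[ℂ] H} {R : H →L[ℂ] H}
    (h : ∀ u f, (u, f) ∈ L.graph ↔ u = R f) : IsBoundedInverse L R := by
  refine ⟨fun f => ?_, fun u => ?_⟩
  · obtain ⟨y, hy, hf⟩ := (LinearPMap.mem_graph_iff _).1 ((h (R f) f).2 rfl)
    exact ⟨y, hy, hf⟩
  · exact ((h u (L u)).1 (LinearPMap.mem_graph L u)).symm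

/-- The ray through a nonzero complex number outside the sector of half-angle `π / 4` stays at
distance at least `1 / √2` from the point `1`. -/
theorem half_le_norm_one_sub_mul {z : ℂ} (hz : z ∉ openSector (Real.pi / 4)) (hz0 : z ≠ 0)
    {r : ℝ} (hr : 0 ≤ r) : 1 / 2 ≤ ‖1 - z * r‖ := by
  have harg : Real.pi / 4 ≤ |Complex.arg z| := by
    by_contra h
    exact hz ⟨hz0, not_le.1 h⟩
  have hcos : Real.cos (Complex.arg z) ≤ Real.sqrt 2 / 2 := by
    rw [← Real.cos_abs, ← Real.cos_pi_div_four]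
    exact Real.cos_le_cos_of_nonneg_of_le_pi (by positivity) (Complex.abs_arg_le_pi z) harg
  have hre : z.re ≤ ‖z‖ * (Real.sqrt 2 / 2) := by
    rw [← Complex.norm_mul_cos_arg z]
    exact mul_le_mul_of_nonneg_left hcos (norm_nonneg z)
  have h2 : Real.sqrt 2 * Real.sqrt 2 = 2 := Real.mul_self_sqrt (by norm_num)
  have hsq : ‖1 - z * r‖ ^ 2 = 1 - 2 * (z.re * r) + (‖z‖ * r) ^ 2 := by
    rw [mul_pow, Complex.sq_norm, Complex.sq_norm, Complex.normSq_apply, Complex.normSq_apply]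
    simp
    ring
  have hre' : z.re * r ≤ ‖z‖ * r * (Real.sqrt 2 / 2) := by
    calc z.re * r ≤ ‖z‖ * (Real.sqrt 2 / 2) * r := mul_le_mul_of_nonneg_right hre hr
      _ = _ := by ring
  refine le_of_sq_le_sq ?_ (norm_nonneg _)
  rw [hsq]
  nlinarith [sq_nonneg (‖z‖ * r - Real.sqrt 2 / 2)]

theorem norm_inverse_apply_le {c : ℝ} (hc : 0 < c) {D : H →L[ℂ] H}
    (hD : ∀ x, ‖x‖ ^ 2 * c ≤ ‖inner ℂ (D x) x‖) (x : H) : ‖x‖ ≤ c⁻¹ * ‖D x‖ := by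
  rw [inv_mul_eq_div, le_div_iff₀ hc]
  rcases eq_or_ne x 0 with rfl | hx
  · simp
  · have h0 : 0 < ‖x‖ := norm_pos_iff.2 hx
    have := (hD x).trans (norm_inner_le_norm (𝕜 := ℂ) (D x) x)
    nlinarith

variable [CompleteSpace H]

/-- Resolvent estimate for the inverse `L` of a nonnegative bounded operator `R`: the resolvent is
`(z - L)⁻¹ = - R (1 - z R)⁻¹`, and `1 - z R` is coercive since `⟪R x, x⟫ ≥ 0`. -/
theorem exists_resolvent {L : H →ₗ.[ℂ] H} {R : H →L[ℂ] H}
    (h : ∀ u f, (u, f) ∈ L.graph ↔ u = R f) (hR : R.IsPositive) {z : ℂ}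
    (hz : z ∉ openSector (Real.pi / 4)) (hz0 : z ≠ 0) :
    ∃ S, IsBoundedInverse (shiftSub z L) S ∧ ‖S‖ ≤ 3 / ‖z‖ := by
  set D : H →L[ℂ] H := 1 - z • R with hDdef
  have hD : ∀ x, ‖x‖ ^ 2 * ((1 / 2 : NNReal) : ℝ) ≤ ‖inner ℂ (D x) x‖ := by
    intro x
    rcases eq_or_ne x 0 with rfl | hx
    · simp
    have h0 : 0 < ‖x‖ := norm_pos_iff.2 hx
    obtain ⟨ρ, hρ0, hρ⟩ : ∃ ρ : ℝ, 0 ≤ ρ ∧ inner ℂ x (R x) = (ρ : ℂ) := by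
      have h1 := hR.inner_nonneg_right x
      rw [Complex.le_def] at h1
      refine ⟨(inner ℂ x (R x)).re, h1.1, ?_⟩
      apply Complex.ext
      · simp
      · simpa using h1.2.symm
    have e : inner ℂ x (D x) = ((‖x‖ ^ 2 : ℝ) : ℂ) * (1 - z * ((ρ / ‖x‖ ^ 2 : ℝ) : ℂ)) := by
      have : ((‖x‖ : ℝ) : ℂ) ≠ 0 := by exact_mod_cast h0.ne'
      simp only [hDdef, sub_apply, one_apply_eq_self, _root_.smul_apply,
        inner_sub_right, inner_smul_right, hρ, inner_self_eq_norm_sq_to_K]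
      push_cast
      field_simp
      simp
    rw [norm_inner_symm, e, norm_mul]
    have h3 := half_le_norm_one_sub_mul hz hz0 (r := ρ / ‖x‖ ^ 2) (by positivity)
    rw [Complex.norm_real, Real.norm_of_nonneg (by positivity)]
    have : ((1 / 2 : NNReal) : ℝ) = 1 / 2 := by norm_num
    rw [this]
    exact mul_le_mul_of_nonneg_left h3 (by positivity)
  have hunit : IsUnit D := isUnit_of_forall_le_norm_inner_map D (c := 1 / 2) (by norm_num) hD
  have hbd : ∀ x, ‖x‖ ≤ 2 * ‖D x‖ := by
    intro x
    have := norm_inverse_apply_le (c := 1 / 2) (by norm_num) (D := D)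
      (by intro x; simpa using hD x) x
    simpa using this
  set G := Ring.inverse D
  have hDG : ∀ x, D (G x) = x := fun x => by
    have := congrArg (fun F : H →L[ℂ] H => F x) (Ring.mul_inverse_cancel D hunit)
    simpa using this
  have hGD : ∀ x, G (D x) = x := fun x => by
    have := congrArg (fun F : H →L[ℂ] H => F x) (Ring.inverse_mul_cancel D hunit)
    simpa using this
  have hDx : ∀ x, D x = x - z • R x := fun x => by simp [hDdef]
  refine ⟨-(R ∘L G), ⟨fun f => ?_, fun u => ?_⟩, ?_⟩
  · obtain ⟨y, hy, hf⟩ := (LinearPMap.mem_graph_iff _).1 ((h (R (-G f)) (-G f)).2 rfl)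
    simp only at hy hf
    refine ⟨y, by simpa using hy, ?_⟩
    change z • (y : H) - L y = f
    rw [hy, hf, map_neg]
    have := hDG f
    rw [hDx] at this
    rw [smul_neg, sub_neg_eq_add, neg_add_eq_sub, this]
  · have hu := (h u (L u)).1 (LinearPMap.mem_graph L u)
    change (-(R ∘L G)) (z • (u : H) - L u) = u
    have e : z • (u : H) - L u = - D (L u) := by
      rw [hDx, ← hu]; abel
    rw [e, map_neg]
    simp only [_root_.neg_apply, comp_apply, hGD, neg_neg]
    exact hu.symm
  · refine opNorm_le_bound _ (by positivity) fun f => ?_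
    have h1 : z • (-(R ∘L G)) f = f - G f := by
      have := hDG f
      rw [hDx] at this
      simp only [_root_.neg_apply, comp_apply, smul_neg]
      nth_rewrite 2 [← this]
      abel
    have h2 : ‖z‖ * ‖(-(R ∘L G)) f‖ ≤ 3 * ‖f‖ := by
      rw [← norm_smul, h1]
      have h3 := hbd (G f)
      rw [hDG] at h3
      linarith [norm_sub_le f (G f)]
    have hz' : 0 < ‖z‖ := norm_pos_iff.2 hz0
    rw [div_mul_eq_mul_div, le_div_iff₀ hz']
    linarith

theorem rpow_half_mul_self {R : H →L[ℂ] H} (hR : 0 ≤ R) :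
    (R ^ (1 / 2 : ℝ)) ∘L (R ^ (1 / 2 : ℝ)) = R := by
  rw [← CFC.sqrt_eq_rpow]
  exact CFC.sqrt_mul_sqrt_self R

theorem rpow_half_rpow_half_apply {R : H →L[ℂ] H} (hR : 0 ≤ R) (f : H) :
    (R ^ (1 / 2 : ℝ)) ((R ^ (1 / 2 : ℝ)) f) = R f := by
  conv_rhs => rw [← rpow_half_mul_self hR]
  rfl

theorem isSelfAdjoint_rpow (R : H →L[ℂ] H) (ν : ℝ) : IsSelfAdjoint (R ^ ν) :=
  (CFC.rpow_nonneg (a := R) (y := ν)).isSelfAdjoint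

theorem norm_rpow_half_apply_sq {R : H →L[ℂ] H} (hR : 0 ≤ R) (f : H) :
    ‖(R ^ (1 / 2 : ℝ)) f‖ ^ 2 = (inner ℂ f (R f)).re := by
  rw [← rpow_half_rpow_half_apply hR f, ← adjoint_inner_left,
    (isSelfAdjoint_rpow R _).adjoint_eq, inner_self_eq_norm_sq_to_K]
  norm_cast

theorem injective_rpow_half {R : H →L[ℂ] H} (hR : 0 ≤ R) (hinj : Function.Injective R) :
    Function.Injective (R ^ (1 / 2 : ℝ)) := by
  intro x y hxy
  apply hinj
  rw [← rpow_half_rpow_half_apply hR, ← rpow_half_rpow_half_apply hR, hxy]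

theorem range_rpow_half_le {R : H →L[ℂ] H} {ν : ℝ} (h0 : 0 < ν)
    (h1 : ν ≤ 1 / 2) : LinearMap.range ((R ^ (1 / 2 : ℝ) : H →L[ℂ] H) : H →ₗ[ℂ] H) ≤
      LinearMap.range ((R ^ ν : H →L[ℂ] H) : H →ₗ[ℂ] H) := by
  rcases h1.eq_or_lt with rfl | h1
  · exact le_rfl
  have key : (R ^ (1 / 2 : ℝ) : H →L[ℂ] H) = R ^ ν * R ^ (1 / 2 - ν) := by
    obtain ⟨p, rfl⟩ : ∃ p : NNReal, (p : ℝ) = ν := ⟨⟨ν, h0.le⟩, rfl⟩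
    obtain ⟨q, hq⟩ : ∃ q : NNReal, (q : ℝ) = 1 / 2 - p := ⟨⟨1 / 2 - p, by linarith⟩, rfl⟩
    have hp0 : 0 < p := by exact_mod_cast h0
    have hq0 : 0 < q := by
      rw [← NNReal.coe_pos, hq]
      linarith
    have e := CFC.nnrpow_add (a := R) hp0 hq0
    rw [CFC.nnrpow_eq_rpow hp0, CFC.nnrpow_eq_rpow hq0, CFC.nnrpow_eq_rpow (add_pos hp0 hq0),
      NNReal.coe_add, hq, add_sub_cancel] at e
    exact e
  rintro _ ⟨f, rfl⟩
  refine ⟨(R ^ (1 / 2 - ν) : H →L[ℂ] H) f, ?_⟩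
  rw [key]
  rfl

theorem fracPower_domain {L : H →ₗ.[ℂ] H} {R : H →L[ℂ] H} (h : IsBoundedInverse L R) (ν : ℝ) :
    (fracPower L ν).domain = LinearMap.range ((R ^ ν : H →L[ℂ] H) : H →ₗ[ℂ] H) := by
  rw [fracPower, LinearPMap.inverse_domain, h.boundedInverse_eq]
  ext x
  constructor
  · rintro ⟨y, rfl⟩
    exact ⟨y, rfl⟩
  · rintro ⟨y, rfl⟩
    exact ⟨⟨y, trivial⟩, rfl⟩

theorem fracPower_apply {L : H →ₗ.[ℂ] H} {R : H →L[ℂ] H} (h : IsBoundedInverse L R) {ν : ℝ}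
    (hinj : Function.Injective (R ^ ν : H →L[ℂ] H)) (g : (fracPower L ν).domain) (x : H)
    (hx : (R ^ ν : H →L[ℂ] H) x = g) : fracPower L ν g = x := by
  obtain rfl := h.boundedInverse_eq
  refine LinearPMap.inverse_apply_eq
    (f := ((boundedInverse L ^ ν : H →L[ℂ] H) : H →ₗ[ℂ] H).toPMap ⊤)
    (x := ⟨x, Submodule.mem_top⟩) ?_ ?_
  · rw [Submodule.eq_bot_iff]
    rintro y hy
    apply Subtype.ext
    apply hinj
    rw [ZeroMemClass.coe_zero, map_zero]
    exact hy
  · exact hx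

variable [CompleteSpace V]

/-- A form of Douglas' factorisation lemma: an operator dominated by `B` factors through `B`. -/
theorem exists_comp_eq_of_norm_le {E F G : Type*} [NormedAddCommGroup E] [NormedSpace ℂ E]
    [NormedAddCommGroup F] [NormedSpace ℂ F] [NormedAddCommGroup G] [NormedSpace ℂ G]
    [CompleteSpace G] (A : E →L[ℂ] G) (B : E →L[ℂ] F) (hB : DenseRange B) {k : ℝ} (hk : 0 ≤ k)
    (h : ∀ x, ‖A x‖ ≤ k * ‖B x‖) : ∃ W : F →L[ℂ] G, W ∘L B = A ∧ ‖W‖ ≤ k := by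
  refine ⟨(A : E →ₗ[ℂ] G).extendOfNorm (B : E →ₗ[ℂ] F), ?_, ?_⟩
  · ext x
    exact LinearMap.extendOfNorm_eq hB ⟨k, h⟩ x
  · exact LinearMap.opNorm_extendOfNorm_le hB hk h

theorem denseRange_adjoint_of_injective {E F : Type*} [NormedAddCommGroup E]
    [InnerProductSpace ℂ E] [CompleteSpace E] [NormedAddCommGroup F] [InnerProductSpace ℂ F]
    [CompleteSpace F] {J : E →L[ℂ] F} (hJ : Function.Injective J) : DenseRange (adjoint J) := by
  have : (LinearMap.range (adjoint J : F →ₗ[ℂ] E)).topologicalClosure = ⊤ := by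
    rw [Submodule.topologicalClosure_eq_top_iff, Submodule.eq_bot_iff]
    intro x hx
    apply hJ
    rw [map_zero, ← inner_self_eq_zero (𝕜 := ℂ), ← adjoint_inner_right]
    rw [Submodule.mem_orthogonal'] at hx
    exact hx _ ⟨J x, rfl⟩
  have h2 := congrArg (fun S : Submodule ℂ E => (S : Set E)) this
  simp only [Submodule.topologicalClosure_coe, Submodule.top_coe] at h2
  rw [DenseRange, dense_iff_closure_eq]
  exact h2

theorem injective_adjoint_of_denseRange {J : V →L[ℂ] H} (hJ : DenseRange J) :
    Function.Injective (adjoint J) := by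
  rw [injective_iff_map_eq_zero]
  intro x hx
  refine hJ.induction_on (p := fun y => inner ℂ x y = 0) x ?_ ?_ |> inner_self_eq_zero.1
  · exact isClosed_eq (by fun_prop) (by fun_prop)
  · intro v
    rw [← adjoint_inner_left, hx, inner_zero_left]

/-- The inverse `J T⁻¹ J*` of the operator associated with the closed form
`(u, v) ↦ ⟪v, T u⟫` on `V`, where `J` embeds the form domain `V` into `H`. -/
def formInverse (J : V →L[ℂ] H) (T : V →L[ℂ] V) : H →L[ℂ] H :=
  J ∘L Ring.inverse T ∘L adjoint J

/-- A bounded symmetric form with Riesz operator `T` which is coercive with constant `c`. -/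
structure IsCoerciveRiesz (c : ℝ) (T : V →L[ℂ] V) : Prop where
  pos : 0 < c
  selfAdjoint : IsSelfAdjoint T
  coercive : ∀ u, c * ‖u‖ ^ 2 ≤ (inner ℂ u (T u)).re

namespace IsCoerciveRiesz

variable {c : ℝ} {T T' : V →L[ℂ] V} {J : V →L[ℂ] H}

theorem sq_mul_le (h : IsCoerciveRiesz c T) (u : V) : ‖u‖ ^ 2 * c ≤ ‖inner ℂ (T u) u‖ := by
  rw [norm_inner_symm, mul_comm]
  exact (h.coercive u).trans (Complex.re_le_norm _)

theorem isUnit (h : IsCoerciveRiesz c T) : IsUnit T :=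
  isUnit_of_forall_le_norm_inner_map T (c := ⟨c, h.pos.le⟩) h.pos h.sq_mul_le

theorem apply_inverse (h : IsCoerciveRiesz c T) (x : V) : T (Ring.inverse T x) = x := by
  have := congrArg (fun F : V →L[ℂ] V => F x) (Ring.mul_inverse_cancel T h.isUnit)
  simpa using this

theorem inverse_apply (h : IsCoerciveRiesz c T) (x : V) : Ring.inverse T (T x) = x := by
  have := congrArg (fun F : V →L[ℂ] V => F x) (Ring.inverse_mul_cancel T h.isUnit)
  simpa using this

theorem norm_inverse_le (h : IsCoerciveRiesz c T) : ‖Ring.inverse T‖ ≤ c⁻¹ := by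
  refine opNorm_le_bound _ (inv_nonneg.2 h.pos.le) fun x => ?_
  have := norm_inverse_apply_le h.pos h.sq_mul_le (Ring.inverse T x)
  rwa [h.apply_inverse] at this

theorem norm_inverse_sub_inverse_le (h : IsCoerciveRiesz c T) (h' : IsCoerciveRiesz c T') :
    ‖Ring.inverse T' - Ring.inverse T‖ ≤ c⁻¹ * ‖T - T'‖ * c⁻¹ := by
  have e : Ring.inverse T' - Ring.inverse T =
      Ring.inverse T ∘L (T - T') ∘L Ring.inverse T' := by
    ext x
    simp [h.inverse_apply, h'.apply_inverse]
  rw [e]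
  calc _ ≤ ‖Ring.inverse T‖ * (‖T - T'‖ * ‖Ring.inverse T'‖) :=
        (opNorm_comp_le _ _).trans
          (mul_le_mul_of_nonneg_left (opNorm_comp_le _ _) (norm_nonneg _))
    _ ≤ c⁻¹ * (‖T - T'‖ * c⁻¹) := by
        have := inv_nonneg.2 h.pos.le
        gcongr
        · exact h.norm_inverse_le
        · exact h'.norm_inverse_le
    _ = _ := by ring

theorem inner_inverse_re_eq (h : IsCoerciveRiesz c T) (x : V) :
    inner ℂ x (Ring.inverse T x) =
      inner ℂ (Ring.inverse T x) (T (Ring.inverse T x)) := by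
  rw [← adjoint_inner_left T, h.selfAdjoint.adjoint_eq, h.apply_inverse]

theorem inner_formInverse (f g : H) :
    inner ℂ f (formInverse J T g) = inner ℂ (adjoint J f) (Ring.inverse T (adjoint J g)) := by
  simp only [formInverse, comp_apply]
  rw [adjoint_inner_left]

theorem formInverse_isPositive (h : IsCoerciveRiesz c T) : (formInverse J T).IsPositive := by
  rw [isPositive_iff_complex]
  intro f
  have h1 := h.inner_inverse_re_eq (adjoint J f)
  rw [← inner_formInverse] at h1
  set w := Ring.inverse T (adjoint J f)
  have h2 : conj (inner ℂ w (T w)) = inner ℂ w (T w) := by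
    rw [inner_conj_symm, ← adjoint_inner_right, h.selfAdjoint.adjoint_eq]
  have h3 : inner ℂ (formInverse J T f) f = inner ℂ w (T w) := by
    rw [← inner_conj_symm, h1, h2]
  rw [h3]
  refine ⟨?_, ?_⟩
  · rw [Complex.conj_eq_iff_re] at h2
    exact h2
  · exact le_trans (by have := h.pos; positivity) (h.coercive w)

theorem formInverse_nonneg (h : IsCoerciveRiesz c T) : 0 ≤ formInverse J T :=
  (nonneg_iff_isPositive _).2 h.formInverse_isPositive

theorem formInverse_injective (h : IsCoerciveRiesz c T) (hJ : Function.Injective J)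
    (hJ' : DenseRange J) : Function.Injective (formInverse J T) := by
  intro x y hxy
  apply injective_adjoint_of_denseRange hJ'
  have := hJ hxy
  have h2 := congrArg T this
  change T (Ring.inverse T (adjoint J x)) = T (Ring.inverse T (adjoint J y)) at h2
  rwa [h.apply_inverse, h.apply_inverse] at h2

theorem norm_sqrt_formInverse_le (h : IsCoerciveRiesz c T) (f : H) :
    ‖(formInverse J T ^ (1 / 2 : ℝ)) f‖ ≤ Real.sqrt c⁻¹ * ‖adjoint J f‖ := by
  have hc := inv_nonneg.2 h.pos.le
  refine le_of_sq_le_sq ?_ (by positivity)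
  rw [norm_rpow_half_apply_sq h.formInverse_nonneg, inner_formInverse, mul_pow,
    Real.sq_sqrt hc]
  calc _ ≤ ‖adjoint J f‖ * ‖Ring.inverse T (adjoint J f)‖ :=
        (Complex.re_le_norm _).trans (norm_inner_le_norm _ _)
    _ ≤ ‖adjoint J f‖ * (c⁻¹ * ‖adjoint J f‖) := by
        gcongr
        exact (le_opNorm _ _).trans (by gcongr; exact h.norm_inverse_le)
    _ = _ := by ring

theorem norm_adjoint_le (h : IsCoerciveRiesz c T) {k : ℝ} (hk : ‖T‖ ≤ k) (f : H) :
    ‖adjoint J f‖ ≤ k / Real.sqrt c * ‖(formInverse J T ^ (1 / 2 : ℝ)) f‖ := by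
  have hc := h.pos
  have hk0 : 0 ≤ k := (norm_nonneg _).trans hk
  refine le_of_sq_le_sq ?_ (by positivity)
  rw [mul_pow, norm_rpow_half_apply_sq h.formInverse_nonneg, inner_formInverse, div_pow,
    Real.sq_sqrt hc.le, h.inner_inverse_re_eq]
  have h1 := h.coercive (Ring.inverse T (adjoint J f))
  set w := Ring.inverse T (adjoint J f) with hw
  have h2 : adjoint J f = T w := (h.apply_inverse _).symm
  rw [h2]
  have h3 : ‖T w‖ ≤ k * ‖w‖ := (le_opNorm _ _).trans (by gcongr)
  calc ‖T w‖ ^ 2 ≤ (k * ‖w‖) ^ 2 := by gcongr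
    _ = k ^ 2 / c * (c * ‖w‖ ^ 2) := by field_simp
    _ ≤ _ := by gcongr

/-- The embedding of the form domain factors through `R^(1/2)`, where `R = J T⁻¹ J*`. -/
theorem exists_sqrt_comp_eq (h : IsCoerciveRiesz c T) (hJ : Function.Injective J)
    (hJ' : DenseRange J) {k : ℝ} (hk : ‖T‖ ≤ k) :
    ∃ Z : V →L[ℂ] H, (formInverse J T ^ (1 / 2 : ℝ)) ∘L Z = J ∧ ‖Z‖ ≤ k / Real.sqrt c := by
  have hk0 : 0 ≤ k := (norm_nonneg _).trans hk
  have hsa := isSelfAdjoint_rpow (formInverse J T) (1 / 2)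
  have hinj := injective_rpow_half h.formInverse_nonneg (h.formInverse_injective hJ hJ')
  have hd := denseRange_adjoint_of_injective hinj
  rw [hsa.adjoint_eq] at hd
  obtain ⟨W, hW, hWk⟩ := exists_comp_eq_of_norm_le (adjoint J) _ hd (by positivity)
    (h.norm_adjoint_le hk)
  refine ⟨adjoint W, ?_, ?_⟩
  · have := congrArg adjoint hW
    rwa [adjoint_comp, adjoint_adjoint, hsa.adjoint_eq] at this
  · rwa [LinearIsometryEquiv.norm_map]

/-- The domain of the square root of the operator is the form domain. -/
theorem range_sqrt_formInverse (h : IsCoerciveRiesz c T) (hJ : Function.Injective J)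
    (hJ' : DenseRange J) :
    LinearMap.range ((formInverse J T ^ (1 / 2 : ℝ) : H →L[ℂ] H) : H →ₗ[ℂ] H) =
      LinearMap.range (J : V →ₗ[ℂ] H) := by
  have hsa := isSelfAdjoint_rpow (formInverse J T) (1 / 2)
  apply le_antisymm
  · obtain ⟨W, hW, -⟩ := exists_comp_eq_of_norm_le (formInverse J T ^ (1 / 2 : ℝ)) (adjoint J)
      (denseRange_adjoint_of_injective hJ) (by positivity) h.norm_sqrt_formInverse_le
    have := congrArg adjoint hW
    rw [adjoint_comp, adjoint_adjoint, hsa.adjoint_eq] at this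
    rintro _ ⟨f, rfl⟩
    exact ⟨adjoint W f, congrArg (fun F : H →L[ℂ] H => F f) this⟩
  · obtain ⟨Z, hZ, -⟩ := h.exists_sqrt_comp_eq hJ hJ' le_rfl
    rintro _ ⟨v, rfl⟩
    exact ⟨Z v, congrArg (fun F : V →L[ℂ] H => F v) hZ⟩

end IsCoerciveRiesz

end AbstractOperators

/-! ### The geometry of bounded (ε, δ) domains near the boundary -/

section Geometry

variable {N : ℕ} {d ε δ : ℝ} {Ω : Set (EuclideanSpace ℝ (Fin N))}
  {μ : Measure (EuclideanSpace ℝ (Fin N))}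

/-- The part of the ball `B(x, r)` at distance at least `c r` from the complement of `Ω`. -/
def interiorLayer (Ω : Set (EuclideanSpace ℝ (Fin N))) (c : ℝ) (x : EuclideanSpace ℝ (Fin N))
    (r : ℝ) : Set (EuclideanSpace ℝ (Fin N)) :=
  Metric.ball x r ∩ {y | c * r ≤ Metric.infDist y Ωᶜ}

theorem interiorLayer_subset {c : ℝ} (hc : 0 < c) (x : EuclideanSpace ℝ (Fin N)) {r : ℝ}
    (hr : 0 < r) : interiorLayer Ω c x r ⊆ Ω := by
  rintro y ⟨-, hy⟩
  by_contra h
  have h0 := Metric.infDist_zero_of_mem (s := Ωᶜ) h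
  have : c * r ≤ Metric.infDist y Ωᶜ := hy
  have := mul_pos hc hr
  linarith

/-- At every boundary point and every small scale `r` there is a ball of radius comparable to `r`
well inside `Ω`. Its centre is a point of the path joining a point of `Ω` near `x` to a point of
`Ω` at distance `r / 2` from `x`, where the (ε, δ) condition keeps the path away from `∂Ω`. -/
theorem exists_ball_subset_interiorLayer [Nontrivial (EuclideanSpace ℝ (Fin N))]
    (hε : 0 < ε) (hδ : 0 < δ) (hΩ : IsEpsDeltaDomain ε δ Ω) (hΩb : Bornology.IsBounded Ω) :
    ∃ c r₀ : ℝ, 0 < c ∧ 0 < r₀ ∧ ∀ x ∈ frontier Ω, ∀ r, 0 < r → r ≤ r₀ →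
      ∃ w, Metric.ball w (c * r) ⊆ interiorLayer Ω c x r := by
  have hne : (Ωᶜ).Nonempty := by
    rw [nonempty_compl]
    rintro rfl
    exact NormedSpace.unbounded_univ ℝ (EuclideanSpace ℝ (Fin N)) hΩb
  obtain ⟨p, hp⟩ := hΩ.isConnected.nonempty
  obtain ⟨q, hq, hpq⟩ : ∃ q ∈ Ω, 0 < dist p q := by
    obtain ⟨e, he, hball⟩ := Metric.isOpen_iff.1 hΩ.isOpen p hp
    obtain ⟨v, hv⟩ := exists_ne (0 : EuclideanSpace ℝ (Fin N))
    have hv' : 0 < ‖v‖ := norm_pos_iff.2 hv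
    have hd : dist p (p + (e / 2 / ‖v‖) • v) = e / 2 := by
      rw [dist_eq_norm, sub_add_cancel_left, norm_neg, norm_smul, Real.norm_of_nonneg
        (by positivity)]
      field_simp
    refine ⟨p + (e / 2 / ‖v‖) • v, hball ?_, by rw [hd]; positivity⟩
    rw [Metric.mem_ball, dist_comm, hd]
    linarith
  -- the bound by `dist p q` leaves `p` or `q` at distance at least `r / 2` from each `x`
  refine ⟨min (ε / 20) (1 / 2), min δ (dist p q), by positivity, by positivity, ?_⟩
  intro x hx r hr hr0
  have hrδ : r ≤ δ := hr0.trans (min_le_left _ _)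
  have hrp : r ≤ dist p q := hr0.trans (min_le_right _ _)
  obtain ⟨y, hy, hxy⟩ := Metric.mem_closure_iff.1 (frontier_subset_closure hx) (r / 10)
    (by positivity)
  -- one of the two fixed points of `Ω` is far from `x`
  obtain ⟨z, hz, hxz⟩ : ∃ z ∈ Ω, r / 2 ≤ dist x z := by
    by_contra! h
    have h1 := h p hp
    have h2 := h q hq
    have := dist_triangle_left p q x
    linarith
  obtain ⟨z, hz, hxz⟩ : ∃ z ∈ Ω, dist x z = r / 2 :=
    hΩ.isConnected.isPreconnected.intermediate_value hy hz
      (f := fun z => dist x z) (by fun_prop) ⟨by linarith, hxz⟩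
  have hyz1 : 2 * r / 5 ≤ dist y z := by
    have := dist_triangle x y z
    linarith
  have hyz2 : dist y z ≤ 3 * r / 5 := by
    have := dist_triangle_left y z x
    linarith
  obtain ⟨γ, -, -, hγ⟩ := hΩ.exists_path y hy z hz (by linarith)
  -- the point of the path halfway, in distance from `y`, is far from both end points
  obtain ⟨t, ht⟩ : ∃ t, dist y (γ t) = dist y z / 2 := by
    have hc : Continuous fun t => dist y (γ t) := by fun_prop
    exact mem_range_of_exists_le_of_exists_ge hc
      ⟨0, by simp; positivity⟩ ⟨1, by simp⟩
  have hyz0 : 0 < dist y z := by linarith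
  have h1 : ε * r / 10 ≤ Metric.infDist (γ t) Ωᶜ := by
    have h2 := (ENNReal.ofReal_le_iff_le_toReal (Metric.infEDist_ne_top hne)).1 (hγ t)
    refine le_trans ?_ h2
    have h3 : dist y z / 2 ≤ dist z (γ t) := by
      have := dist_triangle_right y z (γ t)
      linarith
    rw [le_div_iff₀ hyz0, ht]
    calc ε * r / 10 * dist y z ≤ ε * (dist y z / 2) * (dist y z / 2) := by
          nlinarith [mul_pos hε hyz0]
      _ ≤ _ := by gcongr
  refine ⟨γ t, fun u hu => ⟨?_, ?_⟩⟩
  · rw [Metric.mem_ball] at hu ⊢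
    have h2 := dist_triangle u (γ t) x
    have h3 := dist_triangle (γ t) y x
    rw [dist_comm (γ t) y, dist_comm y x] at h3
    have h4 : min (ε / 20) (1 / 2) * r ≤ 1 / 2 * r := by
      gcongr
      exact min_le_right _ _
    linarith
  · rw [Metric.mem_ball] at hu
    have h2 := Metric.infDist_le_infDist_add_dist (s := Ωᶜ) (x := γ t) (y := u)
    rw [dist_comm] at h2
    have h4 : min (ε / 20) (1 / 2) * r ≤ ε / 20 * r := by
      gcongr
      exact min_le_left _ _
    rw [mem_ofPred_eq]
    linarith

/-- The quantitative geometric facts on which the trace estimates rest: at every boundary point and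
every small scale a fixed proportion of the ball lies well inside `Ω`, and `μ` is an upper
`d`-regular finite nonzero measure carried by `∂Ω`. -/
structure TraceGeometry (d : ℝ) (Ω : Set (EuclideanSpace ℝ (Fin N)))
    (μ : Measure (EuclideanSpace ℝ (Fin N))) (c v r₀ k : ℝ) : Prop where
  isOpen : IsOpen Ω
  isBounded : Bornology.IsBounded Ω
  c_pos : 0 < c
  v_pos : 0 < v
  r₀_pos : 0 < r₀
  volume_layer : ∀ x ∈ frontier Ω, ∀ r, 0 < r → r ≤ r₀ →
    ENNReal.ofReal (v * r ^ (N : ℝ)) ≤ volume (interiorLayer Ω c x r)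
  measure_ball : ∀ y, ∀ r, 0 < r → r ≤ r₀ → μ (Metric.ball y r) ≤ ENNReal.ofReal (k * r ^ d)
  isFinite : IsFiniteMeasure μ
  mem_frontier : ∀ᵐ x ∂μ, x ∈ frontier Ω
  measure_ne_zero : μ univ ≠ 0

theorem IsDMeasure.ae_mem {S : Set (EuclideanSpace ℝ (Fin N))} (hμ : IsDMeasure d S μ) :
    ∀ᵐ x ∂μ, x ∈ S := by
  have := Measure.support_mem_ae (μ := μ)
  rw [hμ.support_eq] at this
  exact this

theorem IsDMeasure.isFiniteMeasure {S : Set (EuclideanSpace ℝ (Fin N))} (hμ : IsDMeasure d S μ)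
    (hS : Bornology.IsBounded S) : IsFiniteMeasure μ := by
  obtain ⟨c₁, c₂, -, -, h⟩ := hμ.bounds
  have hc : IsCompact S := Metric.isCompact_of_isClosed_isBounded hμ.isClosed hS
  have hfin : μ S < ∞ := by
    refine hc.measure_lt_top_of_nhdsWithin fun x hx => ?_
    refine ⟨Metric.ball x 1 ∩ S, ?_, ?_⟩
    · rw [inter_comm]
      exact inter_mem_nhdsWithin S (Metric.ball_mem_nhds x one_pos)
    · exact (h x hx 1 one_pos le_rfl).2.trans_lt ENNReal.ofReal_lt_top
  refine ⟨?_⟩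
  have : μ univ = μ S := measure_congr (by
    filter_upwards [hμ.ae_mem] with x hx
    exact propext ⟨fun _ => hx, fun _ => trivial⟩)
  rwa [this]

/-- Bounded (ε, δ) domains whose boundary is a `d`-set satisfy the geometric conditions. The radii
are at most `1 / 2` since a ball about an arbitrary point is compared with a boundary ball of twice
its radius. -/
theorem exists_traceGeometry [Nontrivial (EuclideanSpace ℝ (Fin N))]
    (hε : 0 < ε) (hδ : 0 < δ) (hΩ : IsEpsDeltaDomain ε δ Ω) (hΩb : Bornology.IsBounded Ω)
    (hμ : IsDMeasure d (frontier Ω) μ) :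
    ∃ c v r₀ k : ℝ, TraceGeometry d Ω μ c v r₀ k := by
  obtain ⟨c, r₁, hc, hr₁, hball⟩ := exists_ball_subset_interiorLayer hε hδ hΩ hΩb
  obtain ⟨c₁, c₂, hc₁, hc₂, hbd⟩ := hμ.bounds
  have hfr : Bornology.IsBounded (frontier Ω) := hΩb.closure.subset frontier_subset_closure
  have hae := hμ.ae_mem
  have hinter : ∀ A, μ (A ∩ frontier Ω) = μ A := fun A => measure_congr (by
    filter_upwards [hae] with x hx
    exact propext ⟨fun h => h.1, fun h => ⟨h, hx⟩⟩)
  set β := volume (Metric.ball (0 : EuclideanSpace ℝ (Fin N)) 1) with hβ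
  have hβ0 : β ≠ 0 := (Metric.measure_ball_pos _ _ one_pos).ne'
  have hβt : β ≠ ∞ := measure_ball_lt_top.ne
  refine ⟨c, c ^ (N : ℝ) * β.toReal, min r₁ (1 / 2), c₂ * 2 ^ d, hΩ.isOpen, hΩb, hc, ?_,
    by positivity, ?_, ?_, hμ.isFiniteMeasure hfr, hae, ?_⟩
  · have := ENNReal.toReal_pos hβ0 hβt
    positivity
  · intro x hx r hr hr0
    obtain ⟨w, hw⟩ := hball x hx r hr (hr0.trans (min_le_left _ _))
    refine le_trans (le_of_eq ?_) (measure_mono hw)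
    rw [Measure.addHaar_ball _ _ (by positivity), finrank_euclideanSpace_fin, ← hβ,
      Real.rpow_natCast, Real.rpow_natCast, mul_right_comm, ← mul_pow,
      ENNReal.ofReal_mul (by positivity), ENNReal.ofReal_toReal hβt]
  · intro y r hr hr0
    have hr2 : r ≤ 1 / 2 := hr0.trans (min_le_right _ _)
    rw [← hinter]
    rcases (Metric.ball y r ∩ frontier Ω).eq_empty_or_nonempty with h | ⟨x, hx, hxS⟩
    · simp [h]
    · have hsub : Metric.ball y r ∩ frontier Ω ⊆ Metric.ball x (2 * r) ∩ frontier Ω := by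
        refine inter_subset_inter_left _ fun z hz => ?_
        rw [Metric.mem_ball] at hx hz ⊢
        have := dist_triangle_right z x y
        linarith
      refine (measure_mono hsub).trans ((hbd x hxS (2 * r) (by positivity) (by linarith)).2.trans
        (le_of_eq ?_))
      rw [Real.mul_rpow (by norm_num) hr.le, mul_assoc]
  · obtain ⟨x, hx⟩ := hμ.nonempty
    have h1 := (hbd x hx 1 one_pos le_rfl).1
    intro h0
    have h2 : μ (Metric.ball x 1 ∩ frontier Ω) = 0 := measure_mono_null (subset_univ _) h0
    rw [h2, Real.one_rpow, mul_one] at h1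
    have h3 : 0 < ENNReal.ofReal c₁ := ENNReal.ofReal_pos.2 hc₁
    exact absurd h1 (not_le.2 h3)

end Geometry

/-! ### Jensen's inequality for mean values -/

section Averages

variable {X : Type*} [MeasurableSpace X] {F : Type*} [NormedAddCommGroup F] [NormedSpace ℝ F]

theorem enorm_integral_sq_le {P : Measure X} [IsProbabilityMeasure P] {f : X → F}
    (hf : AEStronglyMeasurable f P) : ‖∫ x, f x ∂P‖ₑ ^ 2 ≤ ∫⁻ x, ‖f x‖ₑ ^ 2 ∂P := by
  have h1 : ‖∫ x, f x ∂P‖ₑ ≤ eLpNorm f 2 P := by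
    refine (enorm_integral_le_lintegral_enorm f).trans ?_
    rw [← eLpNorm_one_eq_lintegral_enorm]
    exact eLpNorm_le_eLpNorm_of_exponent_le (by norm_num) hf
  calc ‖∫ x, f x ∂P‖ₑ ^ 2 ≤ eLpNorm f 2 P ^ 2 := by gcongr
    _ = ∫⁻ x, ‖f x‖ₑ ^ 2 ∂P := by
      have := eLpNorm_nnreal_pow_eq_lintegral (f := f) (μ := P) (p := 2) (by norm_num)
      simpa using this

theorem enorm_average_sub_const_sq_le [CompleteSpace F] {ν : Measure X} [IsFiniteMeasure ν]
    [NeZero ν] {f : X → F} (hf : Integrable f ν) (a : F) :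
    ‖(⨍ x, f x ∂ν) - a‖ₑ ^ 2 ≤ (ν univ)⁻¹ * ∫⁻ x, ‖f x - a‖ₑ ^ 2 ∂ν := by
  have hf' : Integrable f ((ν univ)⁻¹ • ν) := hf.to_average
  have e : (⨍ x, f x ∂ν) - a = ∫ x, (f x - a) ∂((ν univ)⁻¹ • ν) := by
    rw [integral_sub hf' (integrable_const a)]
    simp [average]
  rw [e, ← smul_eq_mul, ← lintegral_smul_measure]
  exact enorm_integral_sq_le (hf'.aestronglyMeasurable.sub aestronglyMeasurable_const)

/-- Jensen's inequality for the difference of the mean values of a function over two sets. -/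
theorem enorm_setAverage_sub_setAverage_sq_le [CompleteSpace F] {ν : Measure X} {A B : Set X}
    {f : X → F} (hA : IntegrableOn f A ν) (hB : IntegrableOn f B ν) (hA0 : ν A ≠ 0)
    (hA1 : ν A ≠ ∞) (hB0 : ν B ≠ 0) (hB1 : ν B ≠ ∞) :
    ‖(⨍ x in A, f x ∂ν) - ⨍ x in B, f x ∂ν‖ₑ ^ 2 ≤
      (ν A)⁻¹ * (ν B)⁻¹ * ∫⁻ y in A, ∫⁻ z in B, ‖f y - f z‖ₑ ^ 2 ∂ν ∂ν := by
  have : IsFiniteMeasure (ν.restrict A) := ⟨by simpa using hA1.lt_top⟩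
  have : IsFiniteMeasure (ν.restrict B) := ⟨by simpa using hB1.lt_top⟩
  have : NeZero (ν.restrict A) := ⟨by simpa [Measure.restrict_eq_zero] using hA0⟩
  have : NeZero (ν.restrict B) := ⟨by simpa [Measure.restrict_eq_zero] using hB0⟩
  refine (enorm_average_sub_const_sq_le hA _).trans ?_
  rw [Measure.restrict_apply_univ, mul_assoc]
  refine mul_le_mul_right ?_ _
  rw [← lintegral_const_mul' _ _ (ENNReal.inv_ne_top.2 hB0)]
  refine lintegral_mono fun y => ?_
  have h1 := enorm_average_sub_const_sq_le hB (f y)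
  rw [Measure.restrict_apply_univ] at h1
  have h2 : ∀ a b : F, ‖a - b‖ₑ = ‖b - a‖ₑ := fun a b => by
    rw [← enorm_neg, neg_sub]
  simp only [h2 (f y)]
  exact h1

end Averages

/-! ### Mean values over interior layers -/

section Trace

variable {N : ℕ} {d s : ℝ} {Ω : Set (EuclideanSpace ℝ (Fin N))}
  {μ : Measure (EuclideanSpace ℝ (Fin N))} {c v r₀ k : ℝ} {u : EuclideanSpace ℝ (Fin N) → ℂ}

/-- The Gagliardo density `|u(x) - u(y)|² / |x - y|^(N + 2s)`. -/
def gagliardo (s : ℝ) (u : EuclideanSpace ℝ (Fin N) → ℂ)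
    (p : EuclideanSpace ℝ (Fin N) × EuclideanSpace ℝ (Fin N)) : ℝ≥0∞ :=
  ‖(u p.1 - u p.2) / ((dist p.1 p.2 ^ (((N : ℝ) + 2 * s) / 2) : ℝ) : ℂ)‖ₑ ^ 2

theorem measurable_gagliardo (hu : Measurable u) : Measurable (gagliardo s u) := by
  unfold gagliardo
  fun_prop

/-- The mean value of `u` over the interior layer at `x` of radius `r`. -/
def layerMean (Ω : Set (EuclideanSpace ℝ (Fin N))) (c : ℝ) (u : EuclideanSpace ℝ (Fin N) → ℂ)
    (x : EuclideanSpace ℝ (Fin N)) (r : ℝ) : ℂ :=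
  ⨍ y in interiorLayer Ω c x r, u y

/-- The part of the Gagliardo energy on `Ω × Ω` whose first variable lies in the interior layer. -/
def layerEnergy (s : ℝ) (Ω : Set (EuclideanSpace ℝ (Fin N))) (c : ℝ)
    (u : EuclideanSpace ℝ (Fin N) → ℂ) (x : EuclideanSpace ℝ (Fin N)) (r : ℝ) : ℝ≥0∞ :=
  ∫⁻ y in interiorLayer Ω c x r, ∫⁻ z in Ω, gagliardo s u (y, z)

/-- The Gagliardo energy on `Ω × Ω`. -/
def totalEnergy (s : ℝ) (Ω : Set (EuclideanSpace ℝ (Fin N)))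
    (u : EuclideanSpace ℝ (Fin N) → ℂ) : ℝ≥0∞ :=
  ∫⁻ y in Ω, ∫⁻ z in Ω, gagliardo s u (y, z)

/-- The dyadic scales `r₀ 2⁻ʲ`. -/
def scale (r₀ : ℝ) (j : ℕ) : ℝ := r₀ * (1 / 2) ^ j

/-- The layer energy at the scale `j`, normalised by the measure of a boundary ball. -/
def scaledEnergy (d s : ℝ) (Ω : Set (EuclideanSpace ℝ (Fin N))) (c r₀ : ℝ)
    (u : EuclideanSpace ℝ (Fin N) → ℂ) (x : EuclideanSpace ℝ (Fin N)) (j : ℕ) : ℝ≥0∞ :=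
  ENNReal.ofReal (scale r₀ j ^ (-d)) * layerEnergy s Ω c u x (scale r₀ j)

/-- The constant in the comparison of mean values over neighbouring interior layers. -/
def layerConst (N : ℕ) (s v : ℝ) : ℝ := (v * v)⁻¹ * 2 ^ (N : ℝ) * 3 ^ ((N : ℝ) + 2 * s)

theorem scale_pos (hr : 0 < r₀) (j : ℕ) : 0 < scale r₀ j := by
  unfold scale
  positivity

theorem scale_succ (j : ℕ) : scale r₀ (j + 1) = scale r₀ j / 2 := by
  unfold scale
  ring

theorem scale_le (hr : 0 < r₀) (j : ℕ) : scale r₀ j ≤ r₀ := by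
  unfold scale
  exact mul_le_of_le_one_right hr.le (pow_le_one₀ (by norm_num) (by norm_num))

theorem tendsto_scale (r₀ : ℝ) : Tendsto (scale r₀) atTop (𝓝 0) := by
  have := (tendsto_pow_atTop_nhds_zero_of_lt_one (r := (1 / 2 : ℝ)) (by norm_num)
    (by norm_num)).const_mul r₀
  rw [mul_zero] at this
  exact this

theorem exists_scale_mem {r : ℝ} (h0 : 0 < r) (h1 : r < r₀) :
    ∃ j, scale r₀ (j + 1) ≤ r ∧ r < scale r₀ j := by
  obtain ⟨n, hn⟩ := ((tendsto_scale r₀).eventually (ge_mem_nhds h0)).exists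
  classical
  have hex : ∃ n, scale r₀ n ≤ r := ⟨n, hn⟩
  have h2 := Nat.find_spec hex
  have h3 : Nat.find hex ≠ 0 := by
    intro h
    rw [h] at h2
    simp [scale] at h2
    linarith
  obtain ⟨j, hj⟩ := Nat.exists_eq_succ_of_ne_zero h3
  refine ⟨j, by rw [hj] at h2; exact h2, ?_⟩
  have := Nat.find_min hex (m := j) (by omega)
  exact not_le.1 this

/-- On the diagonal, where `gagliardo` has the value zero, the left-hand side vanishes. -/
theorem enorm_sub_sq_le_gagliardo (hs : 0 < s) {y z : EuclideanSpace ℝ (Fin N)} {D : ℝ}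
    (hD : dist y z ≤ D) : ‖u y - u z‖ₑ ^ 2 ≤
      ENNReal.ofReal (D ^ ((N : ℝ) + 2 * s)) * gagliardo s u (y, z) := by
  rcases eq_or_ne y z with rfl | hne
  · simp
  have h0 : 0 < dist y z := dist_pos.2 hne
  have hp : 0 < dist y z ^ (((N : ℝ) + 2 * s) / 2) := Real.rpow_pos_of_pos h0 _
  have e : u y - u z = ((dist y z ^ (((N : ℝ) + 2 * s) / 2) : ℝ) : ℂ) *
      ((u y - u z) / ((dist y z ^ (((N : ℝ) + 2 * s) / 2) : ℝ) : ℂ)) := by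
    rw [mul_div_cancel₀]
    exact_mod_cast hp.ne'
  unfold gagliardo
  conv_lhs => rw [e]
  rw [enorm_mul, mul_pow]
  refine mul_le_mul_left ?_ _
  rw [← ofReal_norm, Complex.norm_real, Real.norm_of_nonneg hp.le,
    ← ENNReal.ofReal_pow hp.le]
  refine ENNReal.ofReal_le_ofReal ?_
  rw [← Real.rpow_natCast, ← Real.rpow_mul h0.le]
  have : ((N : ℝ) + 2 * s) / 2 * ((2 : ℕ) : ℝ) = (N : ℝ) + 2 * s := by
    push_cast; ring
  rw [this]
  exact Real.rpow_le_rpow h0.le hD (by positivity)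

theorem measurableSet_interiorLayer (c : ℝ) (x : EuclideanSpace ℝ (Fin N)) (r : ℝ) :
    MeasurableSet (interiorLayer Ω c x r) :=
  Metric.isOpen_ball.measurableSet.inter
    (measurableSet_le measurable_const (Metric.continuous_infDist_pt _).measurable)

namespace TraceGeometry

theorem notMem (hG : TraceGeometry d Ω μ c v r₀ k) {x : EuclideanSpace ℝ (Fin N)}
    (hx : x ∈ frontier Ω) : x ∉ Ω := by
  have := hx.2
  rwa [hG.isOpen.interior_eq] at this

theorem volume_lt_top (hG : TraceGeometry d Ω μ c v r₀ k) : volume Ω < ∞ :=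
  hG.isBounded.measure_lt_top

theorem integrableOn (hG : TraceGeometry d Ω μ c v r₀ k) (hu : MemLp u 2 (volume.restrict Ω)) :
    IntegrableOn u Ω := by
  have : IsFiniteMeasure (volume.restrict Ω) := ⟨by simpa using hG.volume_lt_top⟩
  exact hu.integrable (by norm_num)

/-- Comparison of the mean over an interior layer with the mean over another set of comparable size
at comparable distance. -/
theorem enorm_layerMean_sub_sq_le (hG : TraceGeometry d Ω μ c v r₀ k) (hs : 0 < s)
    (hu : MemLp u 2 (volume.restrict Ω)) {x : EuclideanSpace ℝ (Fin N)} (hx : x ∈ frontier Ω)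
    {r : ℝ} (hr : 0 < r) (hr0 : r ≤ r₀) {A : Set (EuclideanSpace ℝ (Fin N))} (hAΩ : A ⊆ Ω)
    (hA : MeasurableSet A)
    (hvol : ENNReal.ofReal (v * (r / 2) ^ (N : ℝ)) ≤ volume A)
    (hdist : ∀ y ∈ interiorLayer Ω c x r, ∀ z ∈ A, dist y z ≤ 3 * r) :
    ‖layerMean Ω c u x r - ⨍ y in A, u y‖ₑ ^ 2 ≤
      ENNReal.ofReal (layerConst N s v * r ^ (2 * s - (N : ℝ) + d)) *
        (ENNReal.ofReal (r ^ (-d)) * layerEnergy s Ω c u x r) := by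
  have hv := hG.v_pos
  set B := interiorLayer Ω c x r with hB
  have hBΩ : B ⊆ Ω := interiorLayer_subset hG.c_pos x hr
  have hBvol := hG.volume_layer x hx r hr hr0
  have hBpos : 0 < v * r ^ (N : ℝ) := by positivity
  have hApos : 0 < v * (r / 2) ^ (N : ℝ) := by positivity
  have hB0 : volume B ≠ 0 := ((ENNReal.ofReal_pos.2 hBpos).trans_le hBvol).ne'
  have hA0 : volume A ≠ 0 := ((ENNReal.ofReal_pos.2 hApos).trans_le hvol).ne'
  have hui := hG.integrableOn hu
  have hfin := hG.volume_lt_top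
  refine (enorm_setAverage_sub_setAverage_sq_le (hui.mono_set hBΩ) (hui.mono_set hAΩ) hB0
    ((measure_mono hBΩ).trans_lt hfin).ne hA0 ((measure_mono hAΩ).trans_lt hfin).ne).trans ?_
  have hint : ∫⁻ y in B, ∫⁻ z in A, ‖u y - u z‖ₑ ^ 2 ≤
      ENNReal.ofReal ((3 * r) ^ ((N : ℝ) + 2 * s)) * layerEnergy s Ω c u x r := by
    unfold layerEnergy
    rw [← lintegral_const_mul' _ _ ENNReal.ofReal_ne_top]
    refine setLIntegral_mono' (measurableSet_interiorLayer c x r) fun y hy => ?_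
    rw [← lintegral_const_mul' _ _ ENNReal.ofReal_ne_top]
    refine le_trans ?_ (lintegral_mono_set hAΩ)
    refine setLIntegral_mono' hA fun z hz => ?_
    exact enorm_sub_sq_le_gagliardo hs (hdist y hy z hz)
  calc _ ≤ ENNReal.ofReal (v * r ^ (N : ℝ))⁻¹ * ENNReal.ofReal (v * (r / 2) ^ (N : ℝ))⁻¹ *
        (ENNReal.ofReal ((3 * r) ^ ((N : ℝ) + 2 * s)) * layerEnergy s Ω c u x r) := by
        rw [ENNReal.ofReal_inv_of_pos hBpos, ENNReal.ofReal_inv_of_pos hApos]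
        gcongr
    _ = _ := by
        rw [← mul_assoc, ← mul_assoc, ← ENNReal.ofReal_mul (by positivity),
          ← ENNReal.ofReal_mul (by positivity), ← ENNReal.ofReal_mul (by
            unfold layerConst; positivity)]
        congr 2
        rw [Real.div_rpow hr.le (by norm_num), Real.mul_rpow (by norm_num) hr.le, mul_assoc _ _
          (r ^ (-d)), ← Real.rpow_add hr, Real.rpow_add hr, layerConst]
        have h1 : 2 * s - (N : ℝ) + d + -d = 2 * s + -(N : ℝ) := by ring
        rw [h1, Real.rpow_add hr, Real.rpow_neg hr.le]
        have h2 : r ^ (N : ℝ) ≠ 0 := by positivity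
        field_simp

end TraceGeometry
end Trace

/-! ### A discrete Hardy inequality -/

section Sequences

/-- Convexity of the square, with weights `q` and `1 - q`. -/
theorem add_sq_le_div_add_div {q : ℝ} (h0 : 0 < q) (h1 : q < 1) (x y : ℝ) :
    (x + y) ^ 2 ≤ q⁻¹ * x ^ 2 + (1 - q)⁻¹ * y ^ 2 := by
  have h2 : 0 < 1 - q := by linarith
  have : q⁻¹ * x ^ 2 + (1 - q)⁻¹ * y ^ 2 - (x + y) ^ 2 =
      ((1 - q) * x - q * y) ^ 2 / (q * (1 - q)) := by
    field_simp
    ring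
  have : 0 ≤ ((1 - q) * x - q * y) ^ 2 / (q * (1 - q)) := by positivity
  linarith

theorem enorm_add_sq_le {F : Type*} [NormedAddCommGroup F] {q : ℝ} (h0 : 0 < q) (h1 : q < 1)
    (x y : F) : ‖x + y‖ₑ ^ 2 ≤
      ENNReal.ofReal q⁻¹ * ‖x‖ₑ ^ 2 + ENNReal.ofReal (1 - q)⁻¹ * ‖y‖ₑ ^ 2 := by
  have h2 : 0 ≤ (1 - q)⁻¹ := inv_nonneg.2 (by linarith)
  have h3 : 0 ≤ q⁻¹ := inv_nonneg.2 h0.le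
  simp only [← ofReal_norm]
  rw [← ENNReal.ofReal_pow (norm_nonneg _), ← ENNReal.ofReal_pow (norm_nonneg _),
    ← ENNReal.ofReal_pow (norm_nonneg _), ← ENNReal.ofReal_mul h3, ← ENNReal.ofReal_mul h2,
    ← ENNReal.ofReal_add (by positivity) (by positivity)]
  refine ENNReal.ofReal_le_ofReal ?_
  calc ‖x + y‖ ^ 2 ≤ (‖x‖ + ‖y‖) ^ 2 := by gcongr; exact norm_add_le x y
    _ ≤ _ := add_sq_le_div_add_div h0 h1 _ _

/-- A discrete Hardy inequality: the squared distance between two terms of a sequence is controlled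
by a geometrically weighted sum of the squared increments. -/
theorem enorm_sub_sq_le_sum {F : Type*} [NormedAddCommGroup F] {q : ℝ} (h0 : 0 < q)
    (h1 : q < 1) {K : ℝ≥0∞} {a : ℕ → F} {b : ℕ → ℝ≥0∞}
    (h : ∀ j, ‖a j - a (j + 1)‖ₑ ^ 2 ≤ K * ENNReal.ofReal q ^ (2 * j) * b j) (n j : ℕ) :
    ‖a (j + n) - a j‖ₑ ^ 2 ≤ ENNReal.ofReal (1 - q)⁻¹ * (K * ENNReal.ofReal q ^ (2 * j) *
      ∑ i ∈ Finset.range n, ENNReal.ofReal q ^ i * b (j + i)) := by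
  induction n generalizing j with
  | zero => simp
  | succ n ih =>
    have e : a (j + (n + 1)) - a j = (a (j + 1 + n) - a (j + 1)) + (a (j + 1) - a j) := by
      rw [show j + (n + 1) = j + 1 + n by ring]
      abel
    have h2 : ‖a (j + 1) - a j‖ₑ = ‖a j - a (j + 1)‖ₑ := by rw [← enorm_neg, neg_sub]
    have hq : ENNReal.ofReal q⁻¹ * ENNReal.ofReal q = 1 := by
      rw [← ENNReal.ofReal_mul (by positivity), inv_mul_cancel₀ h0.ne', ENNReal.ofReal_one]
    rw [e]
    refine (enorm_add_sq_le h0 h1 _ _).trans ?_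
    rw [h2, Finset.sum_range_succ']
    calc _ ≤ ENNReal.ofReal q⁻¹ * (ENNReal.ofReal (1 - q)⁻¹ *
            (K * ENNReal.ofReal q ^ (2 * (j + 1)) *
              ∑ i ∈ Finset.range n, ENNReal.ofReal q ^ i * b (j + 1 + i))) +
          ENNReal.ofReal (1 - q)⁻¹ * (K * ENNReal.ofReal q ^ (2 * j) * b j) := by
          gcongr
          · exact ih (j + 1)
          · exact h j
      _ = (ENNReal.ofReal q⁻¹ * ENNReal.ofReal q) * (ENNReal.ofReal (1 - q)⁻¹ *
            (K * ENNReal.ofReal q ^ (2 * j) *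
              ∑ i ∈ Finset.range n, ENNReal.ofReal q * (ENNReal.ofReal q ^ i * b (j + 1 + i)))) +
          ENNReal.ofReal (1 - q)⁻¹ * (K * ENNReal.ofReal q ^ (2 * j) * b j) := by
          rw [← Finset.mul_sum]
          ring
      _ = _ := by
          rw [hq, one_mul, ← mul_add, ← mul_add]
          congr 3
          · refine Finset.sum_congr rfl fun i _ => ?_
            rw [show j + 1 + i = j + (i + 1) by ring]
            ring
          · simp

/-- The geometrically weighted tail of a sequence. -/
def weightedTail (q : ℝ) (b : ℕ → ℝ≥0∞) (j : ℕ) : ℝ≥0∞ :=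
  ∑' i, ENNReal.ofReal q ^ i * b (j + i)

theorem le_weightedTail (q : ℝ) (b : ℕ → ℝ≥0∞) (j : ℕ) : b j ≤ weightedTail q b j := by
  refine le_trans ?_ (ENNReal.le_tsum 0)
  simp

theorem weightedTail_le_tsum {q : ℝ} (h1 : q < 1) (b : ℕ → ℝ≥0∞) (j : ℕ) :
    weightedTail q b j ≤ ∑' i, b i := by
  have hq : ENNReal.ofReal q ≤ 1 := by
    rw [← ENNReal.ofReal_one]
    exact ENNReal.ofReal_le_ofReal h1.le
  calc weightedTail q b j ≤ ∑' i, b (j + i) :=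
        ENNReal.tsum_le_tsum fun i => mul_le_of_le_one_left (zero_le) (pow_le_one₀ (zero_le) hq)
    _ ≤ ∑' i, b i := ENNReal.tsum_comp_le_tsum_of_injective (add_right_injective j) b

theorem tsum_weightedTail_le (q : ℝ) (b : ℕ → ℝ≥0∞) :
    ∑' j, weightedTail q b j ≤ (1 - ENNReal.ofReal q)⁻¹ * ∑' i, b i := by
  unfold weightedTail
  rw [ENNReal.tsum_comm]
  calc _ = ∑' i, ENNReal.ofReal q ^ i * ∑' j, b (j + i) := by simp_rw [ENNReal.tsum_mul_left]
    _ ≤ ∑' i, ENNReal.ofReal q ^ i * ∑' j, b j := by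
        refine ENNReal.tsum_le_tsum fun i => mul_le_mul_right ?_ _
        exact ENNReal.tsum_comp_le_tsum_of_injective (add_left_injective i) b
    _ = _ := by rw [ENNReal.tsum_mul_right, ENNReal.tsum_geometric]

/-- If the squared steps of a sequence are at most `K q^(2 j) b j` with `b` summable, then the
sequence converges, and its squared distance to the limit is controlled by the weighted tails. -/
theorem exists_tendsto_of_step {F : Type*} [NormedAddCommGroup F] [CompleteSpace F] {q : ℝ}
    (h0 : 0 < q) (h1 : q < 1) {K : ℝ≥0∞} (hK : K ≠ ∞) {a : ℕ → F} {b : ℕ → ℝ≥0∞}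
    (hb : ∑' i, b i ≠ ∞)
    (h : ∀ j, ‖a j - a (j + 1)‖ₑ ^ 2 ≤ K * ENNReal.ofReal q ^ (2 * j) * b j) :
    ∃ w, Tendsto a atTop (𝓝 w) ∧ ∀ j, ‖w - a j‖ₑ ^ 2 ≤
      ENNReal.ofReal (1 - q)⁻¹ * (K * ENNReal.ofReal q ^ (2 * j) * weightedTail q b j) := by
  have hq : ENNReal.ofReal q < 1 := by
    rw [← ENNReal.ofReal_one]
    exact (ENNReal.ofReal_lt_ofReal_iff one_pos).2 h1
  have hCauchy : CauchySeq a := by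
    refine cauchySeq_of_edist_le_geometric (ENNReal.ofReal q) ((K * ∑' i, b i) ^ (1 / 2 : ℝ)) hq
      (ENNReal.rpow_ne_top_of_nonneg (by norm_num) (ENNReal.mul_ne_top hK hb)) fun j => ?_
    rw [edist_eq_enorm_sub]
    have h2 : ‖a j - a (j + 1)‖ₑ ^ (2 : ℝ) ≤
        ((K * ∑' i, b i) ^ (1 / 2 : ℝ) * ENNReal.ofReal q ^ j) ^ (2 : ℝ) := by
      rw [ENNReal.mul_rpow_of_nonneg _ _ (by norm_num), ← ENNReal.rpow_mul]
      norm_num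
      refine (h j).trans ?_
      calc K * ENNReal.ofReal q ^ (2 * j) * b j ≤ K * ENNReal.ofReal q ^ (2 * j) * ∑' i, b i := by
            gcongr
            exact ENNReal.le_tsum j
        _ = _ := by ring
    exact (ENNReal.rpow_le_rpow_iff (by norm_num)).1 h2
  obtain ⟨w, hw⟩ := cauchySeq_tendsto_of_complete hCauchy
  refine ⟨w, hw, fun j => ?_⟩
  have h3 : Tendsto (fun n => ‖a (j + n) - a j‖ₑ ^ 2) atTop (𝓝 (‖w - a j‖ₑ ^ 2)) := by
    have h4 : Tendsto (fun n => a (j + n)) atTop (𝓝 w) := by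
      simp_rw [add_comm j]
      exact (tendsto_add_atTop_iff_nat j).2 hw
    have h5 : Continuous fun z : F => ‖z - a j‖ₑ ^ 2 := by
      exact (ENNReal.continuous_pow 2).comp (continuous_enorm.comp (by fun_prop))
    exact (h5.tendsto w).comp h4
  refine le_of_tendsto' h3 fun n => (enorm_sub_sq_le_sum h0 h1 h n j).trans ?_
  gcongr
  exact ENNReal.sum_le_tsum _

end Sequences

/-! ### The trace at a boundary point -/

section PointwiseTrace

variable {N : ℕ} {d s : ℝ} {Ω : Set (EuclideanSpace ℝ (Fin N))}
  {μ : Measure (EuclideanSpace ℝ (Fin N))} {c v r₀ k : ℝ} {u : EuclideanSpace ℝ (Fin N) → ℂ}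

/-- The ratio `2^(-β/2)` of the geometric weights belonging to the exponent `β`. -/
def geomRatio (β : ℝ) : ℝ := (1 / 2) ^ (β / 2)

theorem geomRatio_pos (β : ℝ) : 0 < geomRatio β := by
  unfold geomRatio
  positivity

theorem geomRatio_lt_one {β : ℝ} (hβ : 0 < β) : geomRatio β < 1 :=
  Real.rpow_lt_one (by norm_num) (by norm_num) (by positivity)

theorem ofReal_mul_scale_rpow (hr : 0 < r₀) {K : ℝ} (hK : 0 ≤ K) (β : ℝ) (j : ℕ) :
    ENNReal.ofReal (K * scale r₀ j ^ β) =
      ENNReal.ofReal (K * r₀ ^ β) * ENNReal.ofReal (geomRatio β) ^ (2 * j) := by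
  rw [← ENNReal.ofReal_pow (geomRatio_pos β).le, ← ENNReal.ofReal_mul (by positivity)]
  congr 1
  unfold scale geomRatio
  rw [Real.mul_rpow hr.le (by positivity), mul_assoc]
  congr 2
  rw [← Real.rpow_natCast, ← Real.rpow_natCast, ← Real.rpow_mul (by norm_num),
    ← Real.rpow_mul (by norm_num)]
  congr 1
  push_cast
  ring

theorem interiorLayer_subset_ball (c : ℝ) (x : EuclideanSpace ℝ (Fin N)) (r : ℝ) :
    interiorLayer Ω c x r ⊆ Metric.ball x r := inter_subset_left

theorem layerConst_pos (hv : 0 < v) : 0 < layerConst N s v := by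
  unfold layerConst
  positivity

namespace TraceGeometry

theorem volume_layer_half (hG : TraceGeometry d Ω μ c v r₀ k) {x : EuclideanSpace ℝ (Fin N)}
    (hx : x ∈ frontier Ω) {r r' : ℝ} (hr : 0 < r) (h1 : r / 2 ≤ r') (h2 : r' ≤ r₀) :
    ENNReal.ofReal (v * (r / 2) ^ (N : ℝ)) ≤ volume (interiorLayer Ω c x r') := by
  refine le_trans ?_ (hG.volume_layer x hx r' (by linarith) h2)
  have := hG.v_pos
  gcongr

theorem enorm_layerMean_sub_succ_sq_le (hG : TraceGeometry d Ω μ c v r₀ k) (hs : 0 < s)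
    (hu : MemLp u 2 (volume.restrict Ω)) {x : EuclideanSpace ℝ (Fin N)} (hx : x ∈ frontier Ω)
    (j : ℕ) :
    ‖layerMean Ω c u x (scale r₀ j) - layerMean Ω c u x (scale r₀ (j + 1))‖ₑ ^ 2 ≤
      ENNReal.ofReal (layerConst N s v * scale r₀ j ^ (2 * s - (N : ℝ) + d)) *
        scaledEnergy d s Ω c r₀ u x j := by
  have hp := scale_pos hG.r₀_pos j
  have hp' := scale_pos hG.r₀_pos (j + 1)
  refine hG.enorm_layerMean_sub_sq_le hs hu hx hp (scale_le hG.r₀_pos j)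
    (interiorLayer_subset hG.c_pos x hp') (measurableSet_interiorLayer _ _ _)
    (hG.volume_layer_half hx hp (scale_succ j).ge (scale_le hG.r₀_pos _)) ?_
  intro y hy z hz
  have h1 := Metric.mem_ball.1 hy.1
  have h2 := Metric.mem_ball.1 hz.1
  rw [scale_succ] at h2
  have := dist_triangle_right y z x
  linarith

theorem enorm_layerMean_sub_layerMean_sq_le (hG : TraceGeometry d Ω μ c v r₀ k) (hs : 0 < s)
    (hu : MemLp u 2 (volume.restrict Ω)) {x x' : EuclideanSpace ℝ (Fin N)} (hx : x ∈ frontier Ω)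
    (hx' : x' ∈ frontier Ω) (j : ℕ) (hxx' : dist x x' < scale r₀ j) :
    ‖layerMean Ω c u x (scale r₀ j) - layerMean Ω c u x' (scale r₀ j)‖ₑ ^ 2 ≤
      ENNReal.ofReal (layerConst N s v * scale r₀ j ^ (2 * s - (N : ℝ) + d)) *
        scaledEnergy d s Ω c r₀ u x j := by
  have hp := scale_pos hG.r₀_pos j
  refine hG.enorm_layerMean_sub_sq_le hs hu hx hp (scale_le hG.r₀_pos j)
    (interiorLayer_subset hG.c_pos x' hp) (measurableSet_interiorLayer _ _ _)
    (hG.volume_layer_half hx' hp (by linarith) (scale_le hG.r₀_pos _)) ?_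
  intro y hy z hz
  have h1 := Metric.mem_ball.1 hy.1
  have h2 := Metric.mem_ball'.1 hz.1
  have := dist_triangle4 y x x' z
  linarith

theorem enorm_layerMean_sub_average_ball_sq_le (hG : TraceGeometry d Ω μ c v r₀ k) (hs : 0 < s)
    (hu : MemLp u 2 (volume.restrict Ω)) {x : EuclideanSpace ℝ (Fin N)} (hx : x ∈ frontier Ω)
    (j : ℕ) {r : ℝ} (h1 : scale r₀ j ≤ r) (h2 : r ≤ 2 * scale r₀ j) :
    ‖layerMean Ω c u x (scale r₀ j) - ⨍ y in Metric.ball x r ∩ Ω, u y‖ₑ ^ 2 ≤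
      ENNReal.ofReal (layerConst N s v * scale r₀ j ^ (2 * s - (N : ℝ) + d)) *
        scaledEnergy d s Ω c r₀ u x j := by
  have hp := scale_pos hG.r₀_pos j
  refine hG.enorm_layerMean_sub_sq_le hs hu hx hp (scale_le hG.r₀_pos j) inter_subset_right
    (Metric.isOpen_ball.measurableSet.inter hG.isOpen.measurableSet)
    ((hG.volume_layer_half hx hp (by linarith) (scale_le hG.r₀_pos j)).trans
      (measure_mono fun y hy => ⟨Metric.ball_subset_ball h1 hy.1,
        interiorLayer_subset hG.c_pos x hp hy⟩)) ?_
  intro y hy z hz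
  have h3 := Metric.mem_ball.1 hy.1
  have h4 := Metric.mem_ball.1 hz.1
  have := dist_triangle_right y z x
  linarith

/-- At a boundary point where the scaled energies are summable the trace exists; it is approached
by the layer means at the rate dictated by the geometrically weighted tails. -/
theorem exists_hasTraceAt (hG : TraceGeometry d Ω μ c v r₀ k) (hs : 0 < s)
    (hβ : 0 < 2 * s - (N : ℝ) + d)
    (hu : MemLp u 2 (volume.restrict Ω)) {x : EuclideanSpace ℝ (Fin N)} (hx : x ∈ frontier Ω)
    (hsum : ∑' j, scaledEnergy d s Ω c r₀ u x j ≠ ∞) :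
    ∃ w, HasTraceAt Ω u x w ∧
      Tendsto (fun j => layerMean Ω c u x (scale r₀ j)) atTop (𝓝 w) ∧
      ∀ j, ‖w - layerMean Ω c u x (scale r₀ j)‖ₑ ^ 2 ≤
        ENNReal.ofReal ((1 - geomRatio (2 * s - (N : ℝ) + d))⁻¹) *
          (ENNReal.ofReal (layerConst N s v * scale r₀ j ^ (2 * s - (N : ℝ) + d)) *
          weightedTail (geomRatio (2 * s - (N : ℝ) + d)) (scaledEnergy d s Ω c r₀ u x) j) := by
  set β := 2 * s - (N : ℝ) + d with hβdef
  set q := geomRatio β with hq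
  have hK := layerConst_pos (N := N) (s := s) hG.v_pos
  set κ := layerConst N s v with hκ
  have hr₀ := hG.r₀_pos
  obtain ⟨w, hw, hwj⟩ := exists_tendsto_of_step (geomRatio_pos β) (geomRatio_lt_one hβ)
    (K := ENNReal.ofReal (κ * r₀ ^ β)) ENNReal.ofReal_ne_top
    (a := fun j => layerMean Ω c u x (scale r₀ j)) hsum (fun j => by
      rw [← ofReal_mul_scale_rpow hr₀ hK.le]
      exact hG.enorm_layerMean_sub_succ_sq_le hs hu hx j)
  simp_rw [← ofReal_mul_scale_rpow hr₀ hK.le] at hwj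
  refine ⟨w, ?_, hw, hwj⟩
  set S := ∑' j, scaledEnergy d s Ω c r₀ u x j
  have hq1 : 0 ≤ (1 - q)⁻¹ := inv_nonneg.2 (by linarith [geomRatio_lt_one hβ])
  set M : ℝ := 2 * ((1 - q)⁻¹ * (κ * S.toReal)) + 2 * (κ * S.toReal) with hM
  have key : ∀ r, 0 < r → r < r₀ → ‖(⨍ y in Metric.ball x r ∩ Ω, u y) - w‖ ^ 2 ≤ M * r ^ β := by
    intro r h0 h1
    obtain ⟨j, hj1, hj2⟩ := exists_scale_mem h0 h1
    have hp := scale_pos hr₀ (j + 1)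
    have hscale : scale r₀ (j + 1) ^ β ≤ r ^ β := Real.rpow_le_rpow hp.le hj1 hβ.le
    have hS0 : 0 ≤ S.toReal := ENNReal.toReal_nonneg
    have e1 := hG.enorm_layerMean_sub_average_ball_sq_le hs hu hx (j + 1) hj1
      (by rw [scale_succ]; linarith)
    have e2 := hwj (j + 1)
    have e1' : ‖layerMean Ω c u x (scale r₀ (j + 1)) - ⨍ y in Metric.ball x r ∩ Ω, u y‖ ^ 2 ≤
        κ * r ^ β * S.toReal := by
      rw [← ENNReal.ofReal_le_ofReal_iff (by positivity), ENNReal.ofReal_pow (norm_nonneg _),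
        ofReal_norm, ENNReal.ofReal_mul (by positivity), ENNReal.ofReal_toReal hsum]
      refine e1.trans ?_
      gcongr
      exact ENNReal.le_tsum _
    have e2' : ‖w - layerMean Ω c u x (scale r₀ (j + 1))‖ ^ 2 ≤
        (1 - q)⁻¹ * (κ * r ^ β * S.toReal) := by
      rw [← ENNReal.ofReal_le_ofReal_iff (by positivity), ENNReal.ofReal_pow (norm_nonneg _),
        ofReal_norm, ENNReal.ofReal_mul hq1, ENNReal.ofReal_mul (by positivity),
        ENNReal.ofReal_toReal hsum]
      refine e2.trans ?_
      gcongr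
      exact weightedTail_le_tsum (geomRatio_lt_one hβ) _ _
    set A := layerMean Ω c u x (scale r₀ (j + 1))
    set m := ⨍ y in Metric.ball x r ∩ Ω, u y
    have h3 : ‖m - w‖ ≤ ‖w - A‖ + ‖A - m‖ := by
      rw [norm_sub_rev m w]
      exact norm_sub_le_norm_sub_add_norm_sub _ _ _
    have h4 : ‖m - w‖ ^ 2 ≤ (‖w - A‖ + ‖A - m‖) ^ 2 := by gcongr
    nlinarith [sq_nonneg (‖w - A‖ - ‖A - m‖)]
  have h0 : Tendsto (fun r : ℝ => M * r ^ β) (𝓝[>] 0) (𝓝 0) := by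
    have : Tendsto (fun r : ℝ => M * r ^ β) (𝓝 0) (𝓝 (M * 0 ^ β)) :=
      ((Real.continuousAt_rpow_const 0 β (Or.inr hβ.le)).tendsto).const_mul M
    rw [Real.zero_rpow hβ.ne', mul_zero] at this
    exact this.mono_left nhdsWithin_le_nhds
  have h1 : Tendsto (fun r : ℝ => ‖(⨍ y in Metric.ball x r ∩ Ω, u y) - w‖ ^ 2) (𝓝[>] 0)
      (𝓝 0) := by
    refine tendsto_of_tendsto_of_tendsto_of_le_of_le' tendsto_const_nhds h0
      (Eventually.of_forall fun r => by positivity) ?_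
    filter_upwards [Ioo_mem_nhdsGT hr₀] with r hr
    exact key r hr.1 hr.2
  unfold HasTraceAt
  rw [tendsto_iff_norm_sub_tendsto_zero]
  have h2 := h1.sqrt
  simpa [Real.sqrt_sq (norm_nonneg _)] using h2

end TraceGeometry

theorem HasTraceAt.unique {x : EuclideanSpace ℝ (Fin N)} {w w' : ℂ} (h : HasTraceAt Ω u x w)
    (h' : HasTraceAt Ω u x w') : w = w' :=
  tendsto_nhds_unique h h'

end PointwiseTrace

/-! ### Integration of the layer energies over the boundary -/

section IntegratedTrace

variable {N : ℕ} {d s : ℝ} {Ω : Set (EuclideanSpace ℝ (Fin N))}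
  {μ : Measure (EuclideanSpace ℝ (Fin N))} {c v r₀ k : ℝ} {u : EuclideanSpace ℝ (Fin N) → ℂ}

/-- A point at distance `D` from the complement of `Ω` belongs to the interior layers of boundary
points for boundedly many scales only. -/
theorem exists_tsum_scale_le (hr : 0 < r₀) (hc : 0 < c) : ∃ M : ℕ, ∀ D : ℝ,
    ∑' j, (if c * scale r₀ j ≤ D ∧ D < scale r₀ j then (1 : ℝ≥0∞) else 0) ≤ M := by
  classical
  obtain ⟨M, hM⟩ := exists_pow_lt_of_lt_one hc (show (1 / 2 : ℝ) < 1 by norm_num)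
  refine ⟨M, fun D => ?_⟩
  by_cases hex : ∃ j, c * scale r₀ j ≤ D ∧ D < scale r₀ j
  · set j₀ := Nat.find hex with hj₀
    have h0 := Nat.find_spec hex
    rw [← hj₀] at h0
    rw [tsum_eq_sum (s := Finset.Ico j₀ (j₀ + M))]
    · refine (Finset.sum_le_sum (g := fun _ => (1 : ℝ≥0∞)) fun j _ => ?_).trans ?_
      · split_ifs <;> simp
      · simp
    · intro j hj
      rw [if_neg]
      intro h
      have h1 : j₀ ≤ j := Nat.find_min' hex h
      have h2 : j₀ + M ≤ j := by
        by_contra h3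
        exact hj (Finset.mem_Ico.2 ⟨h1, not_le.1 h3⟩)
      have h4 : scale r₀ j ≤ scale r₀ j₀ * (1 / 2) ^ M := by
        unfold scale
        rw [mul_assoc, ← pow_add]
        gcongr r₀ * ?_
        exact pow_le_pow_of_le_one (by norm_num) (by norm_num) h2
      have h5 : scale r₀ j₀ * (1 / 2) ^ M < scale r₀ j₀ * c :=
        mul_lt_mul_of_pos_left hM (scale_pos hr j₀)
      linarith [h.2, h0.1]
  · push Not at hex
    have : ∀ j, (if c * scale r₀ j ≤ D ∧ D < scale r₀ j then (1 : ℝ≥0∞) else 0) = 0 := by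
      intro j
      rw [if_neg]
      exact fun h => absurd h.2 (not_lt.2 (hex j h.1))
    simp [this]

theorem measurableSet_prod_interiorLayer (c r : ℝ) :
    MeasurableSet {p : EuclideanSpace ℝ (Fin N) × EuclideanSpace ℝ (Fin N) |
      p.2 ∈ interiorLayer Ω c p.1 r} := by
  have h1 : MeasurableSet {p : EuclideanSpace ℝ (Fin N) × EuclideanSpace ℝ (Fin N) |
      dist p.2 p.1 < r} := measurableSet_lt (by fun_prop) measurable_const
  have h2 : MeasurableSet {p : EuclideanSpace ℝ (Fin N) × EuclideanSpace ℝ (Fin N) |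
      c * r ≤ Metric.infDist p.2 Ωᶜ} := measurableSet_le measurable_const
    ((Metric.continuous_infDist_pt _).measurable.comp measurable_snd)
  exact h1.inter h2

theorem measurable_energyDensity (hu : Measurable u) :
    Measurable fun y => ∫⁻ z in Ω, gagliardo s u (y, z) :=
  (measurable_gagliardo hu).lintegral_prod_right'

theorem layerEnergy_eq (s c r : ℝ) (Ω : Set (EuclideanSpace ℝ (Fin N)))
    (u : EuclideanSpace ℝ (Fin N) → ℂ) (x : EuclideanSpace ℝ (Fin N)) :
    layerEnergy s Ω c u x r = ∫⁻ y, {p : EuclideanSpace ℝ (Fin N) × EuclideanSpace ℝ (Fin N) |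
      p.2 ∈ interiorLayer Ω c p.1 r}.indicator
        (fun p => ∫⁻ z in Ω, gagliardo s u (p.2, z)) (x, y) := by
  unfold layerEnergy
  rw [← lintegral_indicator (measurableSet_interiorLayer c x r)]
  rfl

theorem measurable_layerEnergy (hu : Measurable u) (c r : ℝ) :
    Measurable fun x => layerEnergy s Ω c u x r := by
  simp_rw [layerEnergy_eq]
  exact Measurable.lintegral_prod_right' (((measurable_energyDensity hu).comp
    measurable_snd).indicator (measurableSet_prod_interiorLayer c r))

theorem measurable_scaledEnergy (hu : Measurable u) (c r₀ : ℝ) (j : ℕ) :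
    Measurable fun x => scaledEnergy d s Ω c r₀ u x j :=
  (measurable_layerEnergy hu c _).const_mul _

theorem measurable_layerMean (hu : Measurable u) (c r : ℝ) :
    Measurable fun x => layerMean Ω c u x r := by
  have hS := measurableSet_prod_interiorLayer (Ω := Ω) c r
  have h1 : ∀ x, layerMean Ω c u x r = (volume.real (interiorLayer Ω c x r))⁻¹ •
      ∫ y, {p : EuclideanSpace ℝ (Fin N) × EuclideanSpace ℝ (Fin N) |
        p.2 ∈ interiorLayer Ω c p.1 r}.indicator (fun p => u p.2) (x, y) := by
    intro x
    rw [layerMean, setAverage_eq, ← integral_indicator (measurableSet_interiorLayer c x r)]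
    rfl
  simp_rw [h1]
  have h2 : Measurable fun x => volume.real (interiorLayer Ω c x r) :=
    (measurable_measure_prodMk_left hS).ennreal_toReal
  refine h2.inv.smul ?_
  exact (StronglyMeasurable.integral_prod_right'
    (((hu.comp measurable_snd).indicator hS).stronglyMeasurable)).measurable

namespace TraceGeometry

/-- Summed over the scales, the layer energies are integrable over the boundary. -/
theorem exists_lintegral_tsum_scaledEnergy_le (hG : TraceGeometry d Ω μ c v r₀ k) (s : ℝ) :
    ∃ C : ℝ≥0∞, C ≠ ∞ ∧ ∀ u : EuclideanSpace ℝ (Fin N) → ℂ, Measurable u →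
      ∫⁻ x, ∑' j, scaledEnergy d s Ω c r₀ u x j ∂μ ≤ C * totalEnergy s Ω u := by
  have := hG.isFinite
  obtain ⟨M, hM⟩ := exists_tsum_scale_le hG.r₀_pos hG.c_pos
  refine ⟨M * ENNReal.ofReal k, by finiteness, fun u hu => ?_⟩
  set g : EuclideanSpace ℝ (Fin N) → ℝ≥0∞ := fun y => ∫⁻ z in Ω, gagliardo s u (y, z) with hg
  have hgm : Measurable g := measurable_energyDensity hu
  have hS := fun j => measurableSet_prod_interiorLayer (Ω := Ω) c (scale r₀ j)
  have hswap : ∀ j, ∫⁻ x, scaledEnergy d s Ω c r₀ u x j ∂μ =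
      ∫⁻ y, ENNReal.ofReal (scale r₀ j ^ (-d)) *
        (g y * μ {x | y ∈ interiorLayer Ω c x (scale r₀ j)}) := by
    intro j
    unfold scaledEnergy
    rw [lintegral_const_mul' _ _ ENNReal.ofReal_ne_top,
      lintegral_const_mul' _ _ ENNReal.ofReal_ne_top]
    congr 1
    simp_rw [layerEnergy_eq]
    rw [lintegral_lintegral_swap]
    · refine lintegral_congr fun y => ?_
      have hSy : MeasurableSet {x | y ∈ interiorLayer Ω c x (scale r₀ j)} :=
        measurable_prodMk_right (hS j)
      rw [← setLIntegral_const, ← lintegral_indicator hSy]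
      rfl
    · exact ((hgm.comp measurable_snd).indicator (hS j)).aemeasurable
  -- `y` lies in the layers at scale `j` only of boundary points in `B(y, scale r₀ j)`, a set of
  -- measure at most `k (scale r₀ j) ^ d`, and only if `dist(y, ∂Ω)` is comparable to that scale
  have hpt : ∀ y j, ENNReal.ofReal (scale r₀ j ^ (-d)) *
      (g y * μ {x | y ∈ interiorLayer Ω c x (scale r₀ j)}) ≤
      (Ω.indicator g y * ENNReal.ofReal k) * (if c * scale r₀ j ≤ Metric.infDist y Ωᶜ ∧
        Metric.infDist y Ωᶜ < scale r₀ j then (1 : ℝ≥0∞) else 0) := by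
    intro y j
    have hp := scale_pos hG.r₀_pos j
    split_ifs with h
    · have hy : y ∈ Ω := by
        by_contra hy
        have h0 := Metric.infDist_zero_of_mem (s := Ωᶜ) hy
        have := mul_pos hG.c_pos hp
        linarith [h.1]
      have h1 : μ {x | y ∈ interiorLayer Ω c x (scale r₀ j)} ≤
          ENNReal.ofReal (k * scale r₀ j ^ d) := by
        refine (measure_mono fun x hx => ?_).trans
          (hG.measure_ball y _ hp (scale_le hG.r₀_pos j))
        exact Metric.mem_ball_comm.1 (interiorLayer_subset_ball _ _ _ hx)
      rw [indicator_of_mem hy, mul_one]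
      calc _ ≤ ENNReal.ofReal (scale r₀ j ^ (-d)) *
            (g y * ENNReal.ofReal (k * scale r₀ j ^ d)) := by gcongr
        _ = g y * ENNReal.ofReal (scale r₀ j ^ (-d) * (k * scale r₀ j ^ d)) := by
            rw [ENNReal.ofReal_mul (p := scale r₀ j ^ (-d)) (by positivity)]
            ring
        _ = _ := by
            congr 2
            rw [Real.rpow_neg hp.le]
            have : scale r₀ j ^ d ≠ 0 := by positivity
            field_simp
    · have h1 : μ {x | y ∈ interiorLayer Ω c x (scale r₀ j)} = 0 := by
        have : ∀ᵐ x ∂μ, ¬ y ∈ interiorLayer Ω c x (scale r₀ j) := by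
          filter_upwards [hG.mem_frontier] with x hx hy
          refine h ⟨hy.2, ?_⟩
          exact (Metric.infDist_le_dist_of_mem (hG.notMem hx)).trans_lt
            (Metric.mem_ball.1 hy.1)
        simpa [ae_iff] using this
      simp [h1]
  rw [lintegral_tsum fun j => (measurable_scaledEnergy hu c r₀ j).aemeasurable]
  simp_rw [hswap]
  rw [← lintegral_tsum]
  · calc _ ≤ ∫⁻ y, Ω.indicator g y * (M * ENNReal.ofReal k) := by
          refine lintegral_mono fun y => ?_
          refine (ENNReal.tsum_le_tsum (hpt y)).trans ?_
          rw [ENNReal.tsum_mul_left, mul_assoc, mul_comm (M : ℝ≥0∞)]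
          gcongr
          exact hM _
      _ = _ := by
          rw [lintegral_mul_const _ (hgm.indicator hG.isOpen.measurableSet),
            lintegral_indicator hG.isOpen.measurableSet, mul_comm]
          rfl
  · intro j
    exact ((hgm.mul (measurable_measure_prodMk_right (hS j))).const_mul _).aemeasurable

theorem ae_tsum_scaledEnergy_ne_top (hG : TraceGeometry d Ω μ c v r₀ k) (hu : Measurable u)
    (hfin : totalEnergy s Ω u ≠ ∞) : ∀ᵐ x ∂μ, ∑' j, scaledEnergy d s Ω c r₀ u x j ≠ ∞ := by
  obtain ⟨C, hC, h⟩ := hG.exists_lintegral_tsum_scaledEnergy_le s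
  have h1 := (h u hu).trans_lt (ENNReal.mul_lt_top hC.lt_top hfin.lt_top)
  have hm : Measurable fun x => ∑' j, scaledEnergy d s Ω c r₀ u x j :=
    Measurable.tsum fun j => measurable_scaledEnergy hu c r₀ j
  filter_upwards [ae_lt_top hm h1.ne] with x hx
  exact hx.ne

/-- Functions of finite Gagliardo energy have a trace almost everywhere on the boundary. -/
theorem exists_trace (hG : TraceGeometry d Ω μ c v r₀ k) (hs : 0 < s)
    (hβ : 0 < 2 * s - (N : ℝ) + d) (hu : Measurable u) (hu2 : MemLp u 2 (volume.restrict Ω))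
    (hfin : totalEnergy s Ω u ≠ ∞) : ∃ w : EuclideanSpace ℝ (Fin N) → ℂ,
      AEStronglyMeasurable w μ ∧ ∀ᵐ x ∂μ, HasTraceAt Ω u x (w x) := by
  -- the trace is chosen as a limit of the layer means, which are measurable in `x`
  classical
  have hex : ∀ x, ∃ w, (∃ w', HasTraceAt Ω u x w' ∧
      Tendsto (fun j => layerMean Ω c u x (scale r₀ j)) atTop (𝓝 w')) → HasTraceAt Ω u x w ∧
      Tendsto (fun j => layerMean Ω c u x (scale r₀ j)) atTop (𝓝 w) := by
    intro x
    by_cases h : ∃ w', HasTraceAt Ω u x w' ∧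
      Tendsto (fun j => layerMean Ω c u x (scale r₀ j)) atTop (𝓝 w')
    · exact ⟨h.choose, fun _ => h.choose_spec⟩
    · exact ⟨0, fun h' => absurd h' h⟩
  choose w hw using hex
  have hae : ∀ᵐ x ∂μ, HasTraceAt Ω u x (w x) ∧
      Tendsto (fun j => layerMean Ω c u x (scale r₀ j)) atTop (𝓝 (w x)) := by
    filter_upwards [hG.mem_frontier, hG.ae_tsum_scaledEnergy_ne_top hu hfin] with x hx hsum
    obtain ⟨w', h1, h2, -⟩ := hG.exists_hasTraceAt hs hβ hu2 hx hsum
    exact hw x ⟨w', h1, h2⟩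
  refine ⟨w, ?_, hae.mono fun x hx => hx.1⟩
  exact aestronglyMeasurable_of_tendsto_ae atTop
    (fun j => (measurable_layerMean hu c (scale r₀ j)).aestronglyMeasurable)
    (hae.mono fun x hx => hx.2)

end TraceGeometry

end IntegratedTrace

/-! ### The trace in L² of the boundary, and a Poincaré inequality -/

section TraceInequalities

variable {N : ℕ} {d s : ℝ} {Ω : Set (EuclideanSpace ℝ (Fin N))}
  {μ : Measure (EuclideanSpace ℝ (Fin N))} {c v r₀ k : ℝ} {u : EuclideanSpace ℝ (Fin N) → ℂ}

theorem enorm_add_sq_le_two {F : Type*} [NormedAddCommGroup F] (x y : F) :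
    ‖x + y‖ₑ ^ 2 ≤ 2 * (‖x‖ₑ ^ 2 + ‖y‖ₑ ^ 2) := by
  have := enorm_add_sq_le (q := 1 / 2) (by norm_num) (by norm_num) x y
  norm_num at this
  rw [mul_add]
  exact this

theorem enorm_sub_sq_le_two {F : Type*} [NormedAddCommGroup F] (x y : F) :
    ‖x - y‖ₑ ^ 2 ≤ 2 * (‖x‖ₑ ^ 2 + ‖y‖ₑ ^ 2) := by
  have := enorm_add_sq_le_two x (-y)
  rwa [← sub_eq_add_neg, enorm_neg] at this

theorem enorm_sub_sq_comm {F : Type*} [NormedAddCommGroup F] (x y : F) :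
    ‖x - y‖ₑ ^ 2 = ‖y - x‖ₑ ^ 2 := by
  rw [← enorm_neg, neg_sub]

/-- The constant in the estimate of the distance between the trace and the layer means. -/
def tailConst (N : ℕ) (s d v : ℝ) : ℝ :=
  (1 - geomRatio (2 * s - (N : ℝ) + d))⁻¹ * layerConst N s v

/-- The weighted tail of the scaled energies at a boundary point. -/
def energyTail (d s : ℝ) (Ω : Set (EuclideanSpace ℝ (Fin N))) (c r₀ : ℝ)
    (u : EuclideanSpace ℝ (Fin N) → ℂ) (x : EuclideanSpace ℝ (Fin N)) (j : ℕ) : ℝ≥0∞ :=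
  weightedTail (geomRatio (2 * s - (N : ℝ) + d)) (scaledEnergy d s Ω c r₀ u x) j

theorem measurable_energyTail (hu : Measurable u) (c r₀ : ℝ) (j : ℕ) :
    Measurable fun x => energyTail d s Ω c r₀ u x j :=
  Measurable.tsum fun _ => (measurable_scaledEnergy hu c r₀ _).const_mul _

theorem one_le_inv_one_sub_geomRatio {β : ℝ} (hβ : 0 < β) : 1 ≤ (1 - geomRatio β)⁻¹ :=
  (one_le_inv₀ (by linarith [geomRatio_lt_one hβ])).2 (by linarith [geomRatio_pos β])

theorem tailConst_pos (hβ : 0 < 2 * s - (N : ℝ) + d) (hv : 0 < v) : 0 < tailConst N s d v :=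
  mul_pos (by linarith [one_le_inv_one_sub_geomRatio hβ]) (layerConst_pos hv)

namespace TraceGeometry

theorem enorm_trace_sub_layerMean_sq_le (hG : TraceGeometry d Ω μ c v r₀ k) (hs : 0 < s)
    (hβ : 0 < 2 * s - (N : ℝ) + d)
    (hu : MemLp u 2 (volume.restrict Ω)) {x : EuclideanSpace ℝ (Fin N)} (hx : x ∈ frontier Ω)
    (hsum : ∑' j, scaledEnergy d s Ω c r₀ u x j ≠ ∞) {w : ℂ} (hw : HasTraceAt Ω u x w) (j : ℕ) :
    ‖w - layerMean Ω c u x (scale r₀ j)‖ₑ ^ 2 ≤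
      ENNReal.ofReal (tailConst N s d v * scale r₀ j ^ (2 * s - (N : ℝ) + d)) *
        energyTail d s Ω c r₀ u x j := by
  obtain ⟨w', hw', -, h⟩ := hG.exists_hasTraceAt hs hβ hu hx hsum
  rw [hw.unique hw', tailConst, mul_assoc, ENNReal.ofReal_mul (by
    linarith [one_le_inv_one_sub_geomRatio hβ]), mul_assoc]
  exact h j

/-- The traces at two boundary points closer than the scale `j` are compared through the layer means
at that scale. -/
theorem enorm_trace_sub_trace_sq_le (hG : TraceGeometry d Ω μ c v r₀ k) (hs : 0 < s)
    (hβ : 0 < 2 * s - (N : ℝ) + d)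
    (hu : MemLp u 2 (volume.restrict Ω)) {x y : EuclideanSpace ℝ (Fin N)} (hx : x ∈ frontier Ω)
    (hy : y ∈ frontier Ω)
    (hsumx : ∑' j, scaledEnergy d s Ω c r₀ u x j ≠ ∞)
    (hsumy : ∑' j, scaledEnergy d s Ω c r₀ u y j ≠ ∞) {w w' : ℂ} (hw : HasTraceAt Ω u x w)
    (hw' : HasTraceAt Ω u y w') (j : ℕ) (hxy : dist x y < scale r₀ j) :
    ‖w - w'‖ₑ ^ 2 ≤ 6 * ENNReal.ofReal (tailConst N s d v * scale r₀ j ^ (2 * s - (N : ℝ) + d)) *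
        (energyTail d s Ω c r₀ u x j + energyTail d s Ω c r₀ u y j) := by
  have h1 := hG.enorm_trace_sub_layerMean_sq_le hs hβ hu hx hsumx hw j
  have h2 := hG.enorm_trace_sub_layerMean_sq_le hs hβ hu hy hsumy hw' j
  have h3 := hG.enorm_layerMean_sub_layerMean_sq_le hs hu hx hy j hxy
  have hp := scale_pos hG.r₀_pos j
  have h3' : ‖layerMean Ω c u x (scale r₀ j) - layerMean Ω c u y (scale r₀ j)‖ₑ ^ 2 ≤
      ENNReal.ofReal (tailConst N s d v * scale r₀ j ^ (2 * s - (N : ℝ) + d)) *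
        energyTail d s Ω c r₀ u x j := by
    refine h3.trans ?_
    gcongr
    · exact le_mul_of_one_le_left (layerConst_pos hG.v_pos).le (one_le_inv_one_sub_geomRatio hβ)
    · exact le_weightedTail _ _ _
  set a := layerMean Ω c u x (scale r₀ j)
  set a' := layerMean Ω c u y (scale r₀ j)
  set κ := ENNReal.ofReal (tailConst N s d v * scale r₀ j ^ (2 * s - (N : ℝ) + d))
  set X := energyTail d s Ω c r₀ u x j
  set Y := energyTail d s Ω c r₀ u y j
  calc ‖w - w'‖ₑ ^ 2 = ‖(w - a) + ((a - a') + (a' - w'))‖ₑ ^ 2 := by congr 2; ring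
    _ ≤ 2 * (‖w - a‖ₑ ^ 2 + 2 * (‖a - a'‖ₑ ^ 2 + ‖a' - w'‖ₑ ^ 2)) := by
        refine (enorm_add_sq_le_two _ _).trans ?_
        gcongr
        exact enorm_add_sq_le_two _ _
    _ ≤ 2 * (κ * X + 2 * (κ * X + κ * Y)) := by
        rw [enorm_sub_sq_comm a' w']
        gcongr
    _ = 6 * κ * X + 4 * κ * Y := by ring
    _ ≤ 6 * κ * X + 6 * κ * Y := by
        gcongr
        norm_num
    _ = _ := by ring

theorem exists_lintegral_tsum_energyTail_le (hG : TraceGeometry d Ω μ c v r₀ k)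
    (hβ : 0 < 2 * s - (N : ℝ) + d) :
    ∃ C : ℝ≥0∞, C ≠ ∞ ∧ ∀ u : EuclideanSpace ℝ (Fin N) → ℂ, Measurable u →
      ∑' j, ∫⁻ x, energyTail d s Ω c r₀ u x j ∂μ ≤ C * totalEnergy s Ω u := by
  obtain ⟨C, hC, h⟩ := hG.exists_lintegral_tsum_scaledEnergy_le s
  set q := geomRatio (2 * s - (N : ℝ) + d) with hq
  have hq1 : (1 - ENNReal.ofReal q)⁻¹ ≠ ∞ := by
    rw [ENNReal.inv_ne_top]
    refine (tsub_pos_of_lt ?_).ne'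
    rw [← ENNReal.ofReal_one]
    exact (ENNReal.ofReal_lt_ofReal_iff one_pos).2 (geomRatio_lt_one hβ)
  refine ⟨(1 - ENNReal.ofReal q)⁻¹ * C, ENNReal.mul_ne_top hq1 hC, fun u hu => ?_⟩
  rw [← lintegral_tsum fun j => (measurable_energyTail hu c r₀ j).aemeasurable]
  calc _ ≤ ∫⁻ x, (1 - ENNReal.ofReal q)⁻¹ * ∑' j, scaledEnergy d s Ω c r₀ u x j ∂μ :=
        lintegral_mono fun x => tsum_weightedTail_le q _
    _ ≤ _ := by
        rw [lintegral_const_mul' _ _ hq1, mul_assoc]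
        gcongr
        exact h u hu

theorem exists_lintegral_trace_sub_layerMean_le (hG : TraceGeometry d Ω μ c v r₀ k)
    (hs : 0 < s) (hβ : 0 < 2 * s - (N : ℝ) + d) :
    ∃ C : ℝ≥0∞, C ≠ ∞ ∧ ∀ u w : EuclideanSpace ℝ (Fin N) → ℂ, Measurable u →
      MemLp u 2 (volume.restrict Ω) → totalEnergy s Ω u ≠ ∞ →
      (∀ᵐ x ∂μ, HasTraceAt Ω u x (w x)) →
      ∫⁻ x, ‖w x - layerMean Ω c u x r₀‖ₑ ^ 2 ∂μ ≤ C * totalEnergy s Ω u := by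
  obtain ⟨C, hC, h⟩ := hG.exists_lintegral_tsum_energyTail_le hβ
  set κ := ENNReal.ofReal (tailConst N s d v * r₀ ^ (2 * s - (N : ℝ) + d))
  refine ⟨κ * C, by finiteness, fun u w hu hu2 hfin hw => ?_⟩
  have h0 : scale r₀ 0 = r₀ := by simp [scale]
  calc _ ≤ ∫⁻ x, κ * energyTail d s Ω c r₀ u x 0 ∂μ := by
        refine lintegral_mono_ae ?_
        filter_upwards [hG.mem_frontier, hG.ae_tsum_scaledEnergy_ne_top hu hfin, hw]
          with x hx hsum hwx
        have := hG.enorm_trace_sub_layerMean_sq_le hs hβ hu2 hx hsum hwx 0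
        rwa [h0] at this
    _ ≤ _ := by
        rw [lintegral_const_mul' _ _ ENNReal.ofReal_ne_top, mul_assoc]
        gcongr
        exact (ENNReal.le_tsum 0).trans (h u hu)

theorem volume_layer_pos (hG : TraceGeometry d Ω μ c v r₀ k) {x : EuclideanSpace ℝ (Fin N)}
    (hx : x ∈ frontier Ω) : volume (interiorLayer Ω c x r₀) ≠ 0 := by
  refine ((ENNReal.ofReal_pos.2 ?_).trans_le (hG.volume_layer x hx r₀ hG.r₀_pos le_rfl)).ne'
  have := hG.v_pos
  have := hG.r₀_pos
  positivity

theorem enorm_layerMean_sub_const_sq_le (hG : TraceGeometry d Ω μ c v r₀ k)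
    (hu2 : MemLp u 2 (volume.restrict Ω)) {x : EuclideanSpace ℝ (Fin N)} (hx : x ∈ frontier Ω)
    (a : ℂ) : ‖layerMean Ω c u x r₀ - a‖ₑ ^ 2 ≤
      ENNReal.ofReal (v * r₀ ^ (N : ℝ))⁻¹ * ∫⁻ y in Ω, ‖u y - a‖ₑ ^ 2 := by
  have hr₀ := hG.r₀_pos
  have hv := hG.v_pos
  have hsub := interiorLayer_subset (Ω := Ω) hG.c_pos x hr₀
  have : IsFiniteMeasure (volume.restrict (interiorLayer Ω c x r₀)) :=
    ⟨by simpa using (measure_mono hsub).trans_lt hG.volume_lt_top⟩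
  have : NeZero (volume.restrict (interiorLayer Ω c x r₀)) :=
    ⟨by simpa [Measure.restrict_eq_zero] using hG.volume_layer_pos hx⟩
  refine (enorm_average_sub_const_sq_le ((hG.integrableOn hu2).mono_set hsub) a).trans ?_
  rw [Measure.restrict_apply_univ, ENNReal.ofReal_inv_of_pos (by positivity)]
  gcongr
  exact hG.volume_layer x hx r₀ hr₀ le_rfl

/-- The trace is bounded from `H^s(Ω)` to `L²(∂Ω, μ)`. -/
theorem exists_lintegral_trace_le (hG : TraceGeometry d Ω μ c v r₀ k)
    (hs : 0 < s) (hβ : 0 < 2 * s - (N : ℝ) + d) :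
    ∃ C : ℝ≥0∞, C ≠ ∞ ∧ ∀ u w : EuclideanSpace ℝ (Fin N) → ℂ, Measurable u →
      MemLp u 2 (volume.restrict Ω) → totalEnergy s Ω u ≠ ∞ →
      (∀ᵐ x ∂μ, HasTraceAt Ω u x (w x)) →
      ∫⁻ x, ‖w x‖ₑ ^ 2 ∂μ ≤ C * ((∫⁻ y in Ω, ‖u y‖ₑ ^ 2) + totalEnergy s Ω u) := by
  have := hG.isFinite
  obtain ⟨C, hC, h⟩ := hG.exists_lintegral_trace_sub_layerMean_le hs hβ
  set κ := ENNReal.ofReal (v * r₀ ^ (N : ℝ))⁻¹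
  refine ⟨2 * C + 2 * (κ * μ univ), by finiteness, fun u w hu hu2 hfin hw => ?_⟩
  have hm : Measurable fun x => layerMean Ω c u x r₀ := measurable_layerMean hu c r₀
  set I := ∫⁻ y in Ω, ‖u y‖ₑ ^ 2 with hI
  have h1 : ∫⁻ x, ‖layerMean Ω c u x r₀‖ₑ ^ 2 ∂μ ≤ κ * I * μ univ := by
    rw [← lintegral_const]
    refine lintegral_mono_ae ?_
    filter_upwards [hG.mem_frontier] with x hx
    simpa only [sub_zero] using hG.enorm_layerMean_sub_const_sq_le hu2 hx 0
  calc ∫⁻ x, ‖w x‖ₑ ^ 2 ∂μ ≤ ∫⁻ x, (2 * ‖w x - layerMean Ω c u x r₀‖ₑ ^ 2 +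
        2 * ‖layerMean Ω c u x r₀‖ₑ ^ 2) ∂μ := by
        refine lintegral_mono fun x => ?_
        have := enorm_add_sq_le_two (w x - layerMean Ω c u x r₀) (layerMean Ω c u x r₀)
        rwa [sub_add_cancel, mul_add] at this
    _ = 2 * (∫⁻ x, ‖w x - layerMean Ω c u x r₀‖ₑ ^ 2 ∂μ) +
        2 * ∫⁻ x, ‖layerMean Ω c u x r₀‖ₑ ^ 2 ∂μ := by
        rw [lintegral_add_right _ (by fun_prop), lintegral_const_mul' _ _ (by norm_num),
          lintegral_const_mul' _ _ (by norm_num)]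
    _ ≤ 2 * (C * totalEnergy s Ω u) + 2 * (κ * I * μ univ) := by
        gcongr
        exact h u w hu hu2 hfin hw
    _ = (2 * C) * totalEnergy s Ω u + 2 * (κ * μ univ) * I := by ring
    _ ≤ (2 * C + 2 * (κ * μ univ)) * totalEnergy s Ω u +
          (2 * C + 2 * (κ * μ univ)) * I := by
        gcongr
        · exact le_self_add
        · exact le_add_self
    _ = _ := by ring

/-- A Poincaré inequality: the Gagliardo energy and the trace control the `L²(Ω)` norm. -/
theorem exists_lintegral_le_energy_add_trace (hG : TraceGeometry d Ω μ c v r₀ k)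
    (hs : 0 < s) (hβ : 0 < 2 * s - (N : ℝ) + d) :
    ∃ C : ℝ≥0∞, C ≠ ∞ ∧ ∀ u w : EuclideanSpace ℝ (Fin N) → ℂ, Measurable u →
      MemLp u 2 (volume.restrict Ω) → totalEnergy s Ω u ≠ ∞ → AEStronglyMeasurable w μ →
      (∀ᵐ x ∂μ, HasTraceAt Ω u x (w x)) →
      ∫⁻ y in Ω, ‖u y‖ₑ ^ 2 ≤ C * (totalEnergy s Ω u + ∫⁻ x, ‖w x‖ₑ ^ 2 ∂μ) := by
  have := hG.isFinite
  have hΩfin := hG.volume_lt_top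
  obtain ⟨C, hC, h⟩ := hG.exists_lintegral_trace_sub_layerMean_le hs hβ
  obtain ⟨D, hD⟩ := Metric.isBounded_iff.1 hG.isBounded
  set κ := ENNReal.ofReal (v * r₀ ^ (N : ℝ))⁻¹
  set L := ENNReal.ofReal (D ^ ((N : ℝ) + 2 * s))
  set m := μ univ
  have hm0 : m ≠ 0 := hG.measure_ne_zero
  have hm1 : m ≠ ∞ := measure_ne_top _ _
  have hm2 : m⁻¹ ≠ ∞ := ENNReal.inv_ne_top.2 hm0
  have hV : volume Ω ≠ ∞ := hΩfin.ne
  refine ⟨m⁻¹ * (2 * (κ * L * m) + 4 * (C * volume Ω) + 4 * volume Ω), by finiteness,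
    fun u w hu hu2 hfin hwm hw => ?_⟩
  have hΩm := hG.isOpen.measurableSet
  have hmean : Measurable fun x => layerMean Ω c u x r₀ := measurable_layerMean hu c r₀
  set I := ∫⁻ y in Ω, ‖u y‖ₑ ^ 2 with hI
  set G := totalEnergy s Ω u with hGdef
  -- the oscillation of `u` about its mean over an interior layer
  have hosc : ∀ x ∈ frontier Ω, ∫⁻ y in Ω, ‖u y - layerMean Ω c u x r₀‖ₑ ^ 2 ≤ κ * L * G := by
    intro x hx
    calc _ ≤ ∫⁻ y in Ω, κ * ∫⁻ z in Ω, L * gagliardo s u (y, z) := by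
          refine setLIntegral_mono' hΩm fun y hy => ?_
          rw [enorm_sub_sq_comm]
          refine (hG.enorm_layerMean_sub_const_sq_le hu2 hx (u y)).trans ?_
          refine mul_le_mul_right ?_ _
          refine setLIntegral_mono' hΩm fun z hz => ?_
          rw [enorm_sub_sq_comm]
          exact enorm_sub_sq_le_gagliardo hs (hD hy hz)
      _ = _ := by
          rw [lintegral_const_mul' _ _ ENNReal.ofReal_ne_top]
          simp_rw [lintegral_const_mul' L _ ENNReal.ofReal_ne_top]
          rw [hGdef, totalEnergy, mul_assoc]
  -- an estimate of `∫ |u|²` from each boundary point, to be averaged over `∂Ω`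
  have hpt : ∀ x ∈ frontier Ω, I ≤ 2 * (κ * L * G) +
      (4 * volume Ω * ‖w x - layerMean Ω c u x r₀‖ₑ ^ 2 + 4 * volume Ω * ‖w x‖ₑ ^ 2) := by
    intro x hx
    set a := layerMean Ω c u x r₀
    calc I ≤ ∫⁻ y in Ω, (2 * ‖u y - a‖ₑ ^ 2 + 2 * ‖a‖ₑ ^ 2) := by
          refine lintegral_mono fun y => ?_
          have := enorm_add_sq_le_two (u y - a) a
          rwa [sub_add_cancel, mul_add] at this
      _ = 2 * (∫⁻ y in Ω, ‖u y - a‖ₑ ^ 2) + 2 * ‖a‖ₑ ^ 2 * volume Ω := by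
          rw [lintegral_add_right _ measurable_const, lintegral_const_mul' _ _ (by norm_num),
            lintegral_const, Measure.restrict_apply_univ]
      _ ≤ 2 * (κ * L * G) + 2 * (2 * (‖w x - a‖ₑ ^ 2 + ‖w x‖ₑ ^ 2)) * volume Ω := by
          gcongr
          · exact hosc x hx
          · have := enorm_sub_sq_le_two (w x) (w x - a)
            rwa [sub_sub_cancel, add_comm] at this
      _ = _ := by ring
  have hmain : m * I ≤ (2 * (κ * L * m) + 4 * (C * volume Ω) + 4 * volume Ω) *
      (G + ∫⁻ x, ‖w x‖ₑ ^ 2 ∂μ) := by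
    set J := ∫⁻ x, ‖w x‖ₑ ^ 2 ∂μ
    calc m * I = ∫⁻ _, I ∂μ := by rw [lintegral_const, mul_comm]
      _ ≤ ∫⁻ x, (2 * (κ * L * G) + (4 * volume Ω * ‖w x - layerMean Ω c u x r₀‖ₑ ^ 2 +
            4 * volume Ω * ‖w x‖ₑ ^ 2)) ∂μ :=
          lintegral_mono_ae (hG.mem_frontier.mono hpt)
      _ = 2 * (κ * L * G) * m + (4 * volume Ω * (∫⁻ x, ‖w x - layerMean Ω c u x r₀‖ₑ ^ 2 ∂μ) +
            4 * volume Ω * J) := by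
          rw [lintegral_add_left measurable_const, lintegral_const,
            lintegral_add_right' _ ((hwm.enorm.pow_const 2).const_mul _),
            lintegral_const_mul' _ _ (by finiteness), lintegral_const_mul' _ _ (by finiteness)]
      _ ≤ 2 * (κ * L * G) * m + (4 * volume Ω * (C * G) + 4 * volume Ω * J) := by
          gcongr
          exact h u w hu hu2 hfin hw
      _ = (2 * (κ * L * m) + 4 * (C * volume Ω)) * G + 4 * volume Ω * J := by ring
      _ ≤ (2 * (κ * L * m) + 4 * (C * volume Ω) + 4 * volume Ω) * G +
            (2 * (κ * L * m) + 4 * (C * volume Ω) + 4 * volume Ω) * J :=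
          add_le_add (mul_le_mul_left le_self_add _) (mul_le_mul_left le_add_self _)
      _ = _ := by ring
  calc I = m⁻¹ * (m * I) := by rw [← mul_assoc, ENNReal.inv_mul_cancel hm0 hm1, one_mul]
    _ ≤ _ := by
        rw [mul_assoc]
        gcongr

end TraceGeometry

end TraceInequalities

/-! ### The trace in the Besov space of the boundary -/

section BesovTrace

variable {N : ℕ} {d s : ℝ} {Ω : Set (EuclideanSpace ℝ (Fin N))}
  {μ : Measure (EuclideanSpace ℝ (Fin N))} {c v r₀ k : ℝ} {u : EuclideanSpace ℝ (Fin N) → ℂ}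

/-- The squared difference quotient of order `a / 2`. -/
def besovDensity (a : ℝ) (w : EuclideanSpace ℝ (Fin N) → ℂ)
    (p : EuclideanSpace ℝ (Fin N) × EuclideanSpace ℝ (Fin N)) : ℝ≥0∞ :=
  ‖(w p.1 - w p.2) / ((dist p.1 p.2 ^ (a / 2) : ℝ) : ℂ)‖ₑ ^ 2

theorem besovDensity_le {a : ℝ} (ha : 0 ≤ a) {w : EuclideanSpace ℝ (Fin N) → ℂ}
    {x y : EuclideanSpace ℝ (Fin N)} (hxy : x ≠ y) {r : ℝ} (hr : 0 < r) (hrd : r ≤ dist x y) :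
    besovDensity a w (x, y) ≤ ENNReal.ofReal (r ^ (-a)) * ‖w x - w y‖ₑ ^ 2 := by
  have h0 : 0 < dist x y := dist_pos.2 hxy
  unfold besovDensity
  rw [div_eq_mul_inv, enorm_mul, mul_pow, mul_comm]
  refine mul_le_mul_left ?_ _
  rw [← Complex.ofReal_inv, ← ofReal_norm, Complex.norm_real,
    Real.norm_of_nonneg (by positivity), ← ENNReal.ofReal_pow (by positivity)]
  refine ENNReal.ofReal_le_ofReal ?_
  rw [inv_pow, ← Real.rpow_natCast, ← Real.rpow_mul h0.le, Real.rpow_neg hr.le]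
  have : a / 2 * ((2 : ℕ) : ℝ) = a := by push_cast; ring
  rw [this]
  gcongr

/-- The energy tail at the first of two points, where these are closer than the scale `j`. -/
def nearTail (d s : ℝ) (Ω : Set (EuclideanSpace ℝ (Fin N))) (c r₀ : ℝ)
    (u : EuclideanSpace ℝ (Fin N) → ℂ) (j : ℕ)
    (p : EuclideanSpace ℝ (Fin N) × EuclideanSpace ℝ (Fin N)) : ℝ≥0∞ :=
  if dist p.1 p.2 < scale r₀ j then energyTail d s Ω c r₀ u p.1 j else 0

namespace TraceGeometry

/-- Pointwise majorant of the difference quotients of the trace: a symmetric dyadic sum for nearby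
points, and the values of the trace for distant points. -/
theorem besovDensity_trace_le (hG : TraceGeometry d Ω μ c v r₀ k)
    (hs : 0 < s) (hd : 0 < d) (hβ : 0 < 2 * s - (N : ℝ) + d)
    (hu2 : MemLp u 2 (volume.restrict Ω)) {w : EuclideanSpace ℝ (Fin N) → ℂ}
    {x y : EuclideanSpace ℝ (Fin N)} (hx : x ∈ frontier Ω) (hy : y ∈ frontier Ω)
    (hsx : ∑' j, scaledEnergy d s Ω c r₀ u x j ≠ ∞)
    (hsy : ∑' j, scaledEnergy d s Ω c r₀ u y j ≠ ∞) (hwx : HasTraceAt Ω u x (w x))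
    (hwy : HasTraceAt Ω u y (w y)) :
    besovDensity (d + (2 * s - (N : ℝ) + d)) w (x, y) ≤
      (∑' j, ENNReal.ofReal (6 * tailConst N s d v * 2 ^ (d + (2 * s - (N : ℝ) + d))) *
        ENNReal.ofReal (scale r₀ j ^ (-d)) *
          (nearTail d s Ω c r₀ u j (x, y) + nearTail d s Ω c r₀ u j (y, x))) +
        (2 * ENNReal.ofReal (r₀ ^ (-(d + (2 * s - (N : ℝ) + d)))) * ‖w x‖ₑ ^ 2 +
          2 * ENNReal.ofReal (r₀ ^ (-(d + (2 * s - (N : ℝ) + d)))) * ‖w y‖ₑ ^ 2) := by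
  have hr₀ := hG.r₀_pos
  have hT0 := tailConst_pos hβ hG.v_pos
  set β := 2 * s - (N : ℝ) + d with hβdef
  set L := ENNReal.ofReal (r₀ ^ (-(d + β)))
  rcases eq_or_ne x y with rfl | hxy
  · simp [besovDensity]
  rcases lt_or_ge (dist x y) r₀ with hlt | hge
  · obtain ⟨j, hj1, hj2⟩ := exists_scale_mem (dist_pos.2 hxy) hlt
    have hp := scale_pos hr₀ j
    refine le_trans ?_ le_self_add
    refine le_trans ?_ (ENNReal.le_tsum j)
    have e1 : nearTail d s Ω c r₀ u j (x, y) = energyTail d s Ω c r₀ u x j := if_pos hj2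
    have e2 : nearTail d s Ω c r₀ u j (y, x) = energyTail d s Ω c r₀ u y j :=
      if_pos (by rw [dist_comm]; exact hj2)
    rw [e1, e2]
    refine (besovDensity_le (by positivity) hxy (scale_pos hr₀ (j + 1)) hj1).trans ?_
    have h1 := hG.enorm_trace_sub_trace_sq_le hs hβ hu2 hx hy hsx hsy hwx hwy j hj2
    calc _ ≤ ENNReal.ofReal (scale r₀ (j + 1) ^ (-(d + β))) *
          (6 * ENNReal.ofReal (tailConst N s d v * scale r₀ j ^ β) *
            (energyTail d s Ω c r₀ u x j + energyTail d s Ω c r₀ u y j)) := by gcongr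
      _ = _ := by
          rw [← mul_assoc]
          congr 1
          have h6 : (6 : ℝ≥0∞) = ENNReal.ofReal 6 := by norm_num
          rw [h6, ← ENNReal.ofReal_mul (by norm_num), ← ENNReal.ofReal_mul (by
            have := scale_pos hr₀ (j + 1); positivity), ← ENNReal.ofReal_mul (by positivity)]
          congr 1
          rw [scale_succ, Real.div_rpow hp.le (by norm_num), Real.rpow_neg (x := 2) (by norm_num),
            neg_add, Real.rpow_add hp, Real.rpow_neg hp.le β]
          have : scale r₀ j ^ β ≠ 0 := by positivity
          field_simp
  · refine le_trans ?_ le_add_self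
    refine (besovDensity_le (by positivity) hxy hr₀ hge).trans ?_
    calc _ ≤ L * (2 * (‖w x‖ₑ ^ 2 + ‖w y‖ₑ ^ 2)) := by
          gcongr
          exact enorm_sub_sq_le_two _ _
      _ = _ := by ring

/-- The trace is bounded from `H^s(Ω)` to the Besov space on `∂Ω`: after integration in the second
variable over a ball of measure at most `k (scale r₀ j) ^ d`, the dyadic majorant becomes the sum of
the energy tails over all scales. -/
theorem exists_lintegral_besovDensity_le (hG : TraceGeometry d Ω μ c v r₀ k)
    (hs : 0 < s) (hd : 0 < d) (hβ : 0 < 2 * s - (N : ℝ) + d) :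
    ∃ C : ℝ≥0∞, C ≠ ∞ ∧ ∀ u w : EuclideanSpace ℝ (Fin N) → ℂ, Measurable u →
      MemLp u 2 (volume.restrict Ω) → totalEnergy s Ω u ≠ ∞ → AEStronglyMeasurable w μ →
      (∀ᵐ x ∂μ, HasTraceAt Ω u x (w x)) →
      ∫⁻ p, besovDensity (d + (2 * s - (N : ℝ) + d)) w p ∂(μ.prod μ) ≤
        C * (totalEnergy s Ω u + ∫⁻ x, ‖w x‖ₑ ^ 2 ∂μ) := by
  have := hG.isFinite
  have hr₀ := hG.r₀_pos
  obtain ⟨C, hC, h⟩ := hG.exists_lintegral_tsum_energyTail_le hβ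
  set β := 2 * s - (N : ℝ) + d with hβdef
  set κ := ENNReal.ofReal (6 * tailConst N s d v * 2 ^ (d + β)) with hκ
  set L := ENNReal.ofReal (r₀ ^ (-(d + β)))
  set m := μ univ
  have hm1 : m ≠ ∞ := measure_ne_top _ _
  refine ⟨κ * 2 * ENNReal.ofReal k * C + 4 * L * m, by finiteness,
    fun u w hu hu2 hfin hwm hw => ?_⟩
  have hT0 := tailConst_pos hβ hG.v_pos
  set B : ℕ → EuclideanSpace ℝ (Fin N) × EuclideanSpace ℝ (Fin N) → ℝ≥0∞ :=
    nearTail d s Ω c r₀ u with hB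
  have hBm : ∀ j, Measurable (B j) := fun j =>
    Measurable.ite (measurableSet_lt (by fun_prop) measurable_const)
      ((measurable_energyTail hu c r₀ j).comp measurable_fst) measurable_const
  have hgood : ∀ᵐ x ∂μ, x ∈ frontier Ω ∧ ∑' j, scaledEnergy d s Ω c r₀ u x j ≠ ∞ ∧
      HasTraceAt Ω u x (w x) := by
    filter_upwards [hG.mem_frontier, hG.ae_tsum_scaledEnergy_ne_top hu hfin, hw] with x h1 h2 h3
    exact ⟨h1, h2, h3⟩
  have hpt : ∀ᵐ p ∂(μ.prod μ), besovDensity (d + β) w p ≤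
      (∑' j, κ * ENNReal.ofReal (scale r₀ j ^ (-d)) * (B j p + B j p.swap)) +
        (2 * L * ‖w p.1‖ₑ ^ 2 + 2 * L * ‖w p.2‖ₑ ^ 2) := by
    filter_upwards [Measure.quasiMeasurePreserving_fst.ae hgood,
      Measure.quasiMeasurePreserving_snd.ae hgood] with p hp1 hp2
    obtain ⟨x, y⟩ := p
    obtain ⟨hx, hsx, hwx⟩ := hp1
    obtain ⟨hy, hsy, hwy⟩ := hp2
    simp only at hx hsx hwx hy hsy hwy ⊢
    exact hG.besovDensity_trace_le hs hd hβ hu2 hx hy hsx hsy hwx hwy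
  have hBint : ∀ j, ∫⁻ p, B j p ∂(μ.prod μ) ≤
      ENNReal.ofReal (k * scale r₀ j ^ d) * ∫⁻ x, energyTail d s Ω c r₀ u x j ∂μ := by
    intro j
    rw [lintegral_prod _ (hBm j).aemeasurable,
      ← lintegral_const_mul _ (measurable_energyTail hu c r₀ j)]
    refine lintegral_mono fun x => ?_
    have e : ∀ y, B j (x, y) = (Metric.ball x (scale r₀ j)).indicator
        (fun _ => energyTail d s Ω c r₀ u x j) y := by
      intro y
      simp only [hB, nearTail, indicator, Metric.mem_ball']
    simp_rw [e]
    rw [lintegral_indicator Metric.isOpen_ball.measurableSet, setLIntegral_const, mul_comm]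
    gcongr
    exact hG.measure_ball x _ (scale_pos hr₀ j) (scale_le hr₀ j)
  have hBswap : ∀ j, ∫⁻ p, B j p.swap ∂(μ.prod μ) = ∫⁻ p, B j p ∂(μ.prod μ) :=
    fun j => lintegral_prod_swap (B j)
  have hterm : ∀ j, ∫⁻ p, κ * ENNReal.ofReal (scale r₀ j ^ (-d)) * (B j p + B j p.swap)
      ∂(μ.prod μ) ≤ κ * 2 * ENNReal.ofReal k * ∫⁻ x, energyTail d s Ω c r₀ u x j ∂μ := by
    intro j
    have hp := scale_pos hr₀ j
    rw [lintegral_const_mul' _ _ (by finiteness), lintegral_add_left (hBm j), hBswap]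
    calc _ ≤ κ * ENNReal.ofReal (scale r₀ j ^ (-d)) *
          (ENNReal.ofReal (k * scale r₀ j ^ d) * (∫⁻ x, energyTail d s Ω c r₀ u x j ∂μ) +
            ENNReal.ofReal (k * scale r₀ j ^ d) * ∫⁻ x, energyTail d s Ω c r₀ u x j ∂μ) := by
          gcongr <;> exact hBint j
      _ = κ * 2 * (ENNReal.ofReal (scale r₀ j ^ (-d)) * ENNReal.ofReal (k * scale r₀ j ^ d)) *
            ∫⁻ x, energyTail d s Ω c r₀ u x j ∂μ := by ring
      _ = _ := by
          rw [← ENNReal.ofReal_mul (by positivity)]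
          congr 3
          rw [Real.rpow_neg hp.le]
          have : scale r₀ j ^ d ≠ 0 := by positivity
          field_simp
  have hwsq : AEMeasurable (fun x => ‖w x‖ₑ ^ 2) μ := hwm.enorm.pow_const 2
  have hfst : ∫⁻ p, ‖w p.1‖ₑ ^ 2 ∂(μ.prod μ) = m * ∫⁻ x, ‖w x‖ₑ ^ 2 ∂μ := by
    rw [lintegral_prod (fun p => ‖w p.1‖ₑ ^ 2) hwsq.comp_fst]
    simp only [lintegral_const]
    rw [lintegral_mul_const' _ _ hm1, mul_comm]
  have hsnd : ∫⁻ p, ‖w p.2‖ₑ ^ 2 ∂(μ.prod μ) = m * ∫⁻ x, ‖w x‖ₑ ^ 2 ∂μ := by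
    rw [lintegral_prod (fun p => ‖w p.2‖ₑ ^ 2) hwsq.comp_snd]
    simp only [lintegral_const]
    rw [mul_comm]
  set J := ∫⁻ x, ‖w x‖ₑ ^ 2 ∂μ
  have hLfin : 2 * L ≠ ∞ := by finiteness
  calc _ ≤ ∫⁻ p, ((∑' j, κ * ENNReal.ofReal (scale r₀ j ^ (-d)) * (B j p + B j p.swap)) +
        (2 * L * ‖w p.1‖ₑ ^ 2 + 2 * L * ‖w p.2‖ₑ ^ 2)) ∂(μ.prod μ) := lintegral_mono_ae hpt
    _ = (∑' j, ∫⁻ p, κ * ENNReal.ofReal (scale r₀ j ^ (-d)) * (B j p + B j p.swap) ∂(μ.prod μ)) +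
        (2 * L * (m * J) + 2 * L * (m * J)) := by
        have hterms : ∀ j, Measurable fun p =>
            κ * ENNReal.ofReal (scale r₀ j ^ (-d)) * (B j p + B j p.swap) := fun j =>
          ((hBm j).add ((hBm j).comp measurable_swap)).const_mul _
        rw [lintegral_add_left (Measurable.tsum hterms),
          lintegral_tsum fun j => (hterms j).aemeasurable,
          lintegral_add_left' (hwsq.comp_fst.const_mul _), lintegral_const_mul' _ _ hLfin,
          lintegral_const_mul' _ _ hLfin, hfst, hsnd]
    _ ≤ (∑' j, κ * 2 * ENNReal.ofReal k * ∫⁻ x, energyTail d s Ω c r₀ u x j ∂μ) +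
        (2 * L * (m * J) + 2 * L * (m * J)) := by
        gcongr with j
        exact hterm j
    _ ≤ κ * 2 * ENNReal.ofReal k * (C * totalEnergy s Ω u) + 4 * L * m * J := by
        rw [ENNReal.tsum_mul_left]
        gcongr ?_ + ?_
        · gcongr
          exact h u hu
        · exact le_of_eq (by ring)
    _ ≤ (κ * 2 * ENNReal.ofReal k * C + 4 * L * m) * totalEnergy s Ω u +
        (κ * 2 * ENNReal.ofReal k * C + 4 * L * m) * J := by
        rw [← mul_assoc]
        exact add_le_add (mul_le_mul_left le_self_add _) (mul_le_mul_left le_add_self _)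
    _ = _ := by ring

end TraceGeometry

end BesovTrace

/-! ### Difference quotients and the trace theorem on H^s -/

section FormDomain

variable {N : ℕ} {a d s : ℝ} {Ω : Set (EuclideanSpace ℝ (Fin N))}
  {μ ν : Measure (EuclideanSpace ℝ (Fin N))} {c v r₀ k : ℝ}
  {u u' : EuclideanSpace ℝ (Fin N) → ℂ}

theorem eLpNorm_two_sq {X F : Type*} [MeasurableSpace X] [NormedAddCommGroup F] (f : X → F)
    (P : Measure X) : eLpNorm f 2 P ^ 2 = ∫⁻ x, ‖f x‖ₑ ^ 2 ∂P := by
  simpa using eLpNorm_nnreal_pow_eq_lintegral (f := f) (μ := P) (p := 2) (by norm_num)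

theorem memLp_two_iff_lintegral {X F : Type*} [MeasurableSpace X] [NormedAddCommGroup F]
    {f : X → F} {P : Measure X} (hf : AEStronglyMeasurable f P) :
    MemLp f 2 P ↔ ∫⁻ x, ‖f x‖ₑ ^ 2 ∂P ≠ ∞ := by
  rw [← eLpNorm_two_sq, MemLp, and_iff_right hf, lt_top_iff_ne_top]
  simp

/-- The difference quotient `(u(x) - u(y)) / |x - y|^(a / 2)`, with the value zero on the
diagonal. -/
def diffQuot (a : ℝ) (u : EuclideanSpace ℝ (Fin N) → ℂ)
    (p : EuclideanSpace ℝ (Fin N) × EuclideanSpace ℝ (Fin N)) : ℂ :=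
  (u p.1 - u p.2) / ((dist p.1 p.2 ^ (a / 2) : ℝ) : ℂ)

theorem diffQuot_ae_congr [SFinite ν] (h : u =ᵐ[ν] u') :
    diffQuot a u =ᵐ[ν.prod ν] diffQuot a u' := by
  filter_upwards [Measure.quasiMeasurePreserving_fst.ae h,
    Measure.quasiMeasurePreserving_snd.ae h] with p hp1 hp2
  simp only [diffQuot, hp1, hp2]

theorem aestronglyMeasurable_diffQuot [SFinite ν] (h : AEStronglyMeasurable u ν) :
    AEStronglyMeasurable (diffQuot a u) (ν.prod ν) := by
  have h1 : AEMeasurable (fun p : EuclideanSpace ℝ (Fin N) × EuclideanSpace ℝ (Fin N) =>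
      u p.1 - u p.2) (ν.prod ν) := h.aemeasurable.comp_fst.sub h.aemeasurable.comp_snd
  have h2 : Measurable fun p : EuclideanSpace ℝ (Fin N) × EuclideanSpace ℝ (Fin N) =>
      ((dist p.1 p.2 ^ (a / 2) : ℝ) : ℂ) := by fun_prop
  exact (h1.div h2.aemeasurable).aestronglyMeasurable

theorem totalEnergy_eq (hu : Measurable u) : totalEnergy s Ω u =
    ∫⁻ p, ‖diffQuot ((N : ℝ) + 2 * s) u p‖ₑ ^ 2
      ∂((volume.restrict Ω).prod (volume.restrict Ω)) := by
  rw [totalEnergy, ← lintegral_prod _ (measurable_gagliardo hu).aemeasurable]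
  rfl

theorem MemHs.lintegral_ne_top (hu : MemHs s Ω u) :
    ∫⁻ p, ‖diffQuot ((N : ℝ) + 2 * s) u p‖ₑ ^ 2
      ∂((volume.restrict Ω).prod (volume.restrict Ω)) ≠ ∞ :=
  (memLp_two_iff_lintegral hu.2.aestronglyMeasurable).1 hu.2

theorem MemHs.exists_measurable (hu : MemHs s Ω u) : ∃ u', Measurable u' ∧
    u =ᵐ[volume.restrict Ω] u' ∧ MemHs s Ω u' ∧ totalEnergy s Ω u' =
      ∫⁻ p, ‖diffQuot ((N : ℝ) + 2 * s) u p‖ₑ ^ 2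
        ∂((volume.restrict Ω).prod (volume.restrict Ω)) ∧ totalEnergy s Ω u' ≠ ∞ := by
  have hm := hu.1.aestronglyMeasurable
  have h1 := hm.ae_eq_mk
  have h2 : Measurable (hm.mk u) := hm.stronglyMeasurable_mk.measurable
  have h3 : totalEnergy s Ω (hm.mk u) =
      ∫⁻ p, ‖diffQuot ((N : ℝ) + 2 * s) u p‖ₑ ^ 2
        ∂((volume.restrict Ω).prod (volume.restrict Ω)) := by
    rw [totalEnergy_eq h2]
    refine lintegral_congr_ae ?_
    filter_upwards [diffQuot_ae_congr h1] with p hp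
    rw [hp]
  exact ⟨_, h2, h1, hu.congr h1, h3, h3 ▸ hu.lintegral_ne_top⟩

namespace TraceGeometry

theorem exists_trace_of_memHs (hG : TraceGeometry d Ω μ c v r₀ k) (hs : 0 < s)
    (hβ : 0 < 2 * s - (N : ℝ) + d) (hu : MemHs s Ω u) :
    ∃ w : EuclideanSpace ℝ (Fin N) → ℂ,
      AEStronglyMeasurable w μ ∧ ∀ᵐ x ∂μ, HasTraceAt Ω u x (w x) := by
  obtain ⟨u', hm, heq, hu', -, hfin⟩ := hu.exists_measurable
  obtain ⟨w, hw, hae⟩ := hG.exists_trace hs hβ hm hu'.1 hfin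
  exact ⟨w, hw, hae.mono fun x hx => hx.congr heq.symm⟩

/-- The trace inequalities for functions in `H^s(Ω)`. -/
theorem exists_trace_bounds (hG : TraceGeometry d Ω μ c v r₀ k) (hs : 0 < s) (hd : 0 < d)
    (hβ : 0 < 2 * s - (N : ℝ) + d) : ∃ C : ℝ≥0∞, C ≠ ∞ ∧
      ∀ u w : EuclideanSpace ℝ (Fin N) → ℂ, MemHs s Ω u → AEStronglyMeasurable w μ →
      (∀ᵐ x ∂μ, HasTraceAt Ω u x (w x)) →
      ∫⁻ x, ‖w x‖ₑ ^ 2 ∂μ ≤ C * ((∫⁻ y in Ω, ‖u y‖ₑ ^ 2) +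
        ∫⁻ p, ‖diffQuot ((N : ℝ) + 2 * s) u p‖ₑ ^ 2
          ∂((volume.restrict Ω).prod (volume.restrict Ω))) ∧
      ∫⁻ y in Ω, ‖u y‖ₑ ^ 2 ≤ C * ((∫⁻ p, ‖diffQuot ((N : ℝ) + 2 * s) u p‖ₑ ^ 2
          ∂((volume.restrict Ω).prod (volume.restrict Ω))) + ∫⁻ x, ‖w x‖ₑ ^ 2 ∂μ) ∧
      ∫⁻ p, ‖diffQuot (d + (2 * s - (N : ℝ) + d)) w p‖ₑ ^ 2 ∂(μ.prod μ) ≤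
        C * ((∫⁻ p, ‖diffQuot ((N : ℝ) + 2 * s) u p‖ₑ ^ 2
          ∂((volume.restrict Ω).prod (volume.restrict Ω))) + ∫⁻ x, ‖w x‖ₑ ^ 2 ∂μ) := by
  obtain ⟨C₁, hC₁, h₁⟩ := hG.exists_lintegral_trace_le hs hβ
  obtain ⟨C₂, hC₂, h₂⟩ := hG.exists_lintegral_le_energy_add_trace hs hβ
  obtain ⟨C₃, hC₃, h₃⟩ := hG.exists_lintegral_besovDensity_le hs hd hβ
  refine ⟨C₁ + C₂ + C₃, by finiteness, fun u w hu hw hae => ?_⟩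
  obtain ⟨u', hm, heq, hu', hE, hfin⟩ := hu.exists_measurable
  have hae' : ∀ᵐ x ∂μ, HasTraceAt Ω u' x (w x) := hae.mono fun x hx => hx.congr heq
  have hI : ∫⁻ y in Ω, ‖u y‖ₑ ^ 2 = ∫⁻ y in Ω, ‖u' y‖ₑ ^ 2 := by
    refine lintegral_congr_ae ?_
    filter_upwards [heq] with y hy
    rw [hy]
  rw [← hE, hI]
  refine ⟨(h₁ u' w hm hu'.1 hfin hae').trans (mul_le_mul_left ?_ _),
    (h₂ u' w hm hu'.1 hfin hw hae').trans (mul_le_mul_left ?_ _),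
    (h₃ u' w hm hu'.1 hfin hw hae').trans (mul_le_mul_left ?_ _)⟩
  · exact le_self_add.trans le_self_add
  · exact le_add_self.trans le_self_add
  · exact le_add_self

/-- A function in `H^s(Ω)` together with its trace defines an element of `L²(Ω, m)`. -/
theorem exists_mem_hsSubspace (hG : TraceGeometry d Ω μ c v r₀ k) (hs : 0 < s) (hd : 0 < d)
    (hβ : 0 < 2 * s - (N : ℝ) + d) (hu : MemHs s Ω u) :
    ∃ U ∈ hsSubspace s Ω μ, U =ᵐ[volume.restrict Ω] u := by
  classical
  obtain ⟨C, hC, h⟩ := hG.exists_trace_bounds hs hd hβ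
  obtain ⟨w, hw, hae⟩ := hG.exists_trace_of_memHs hs hβ hu
  obtain ⟨h1, -, -⟩ := h u w hu hw hae
  have hI := (memLp_two_iff_lintegral hu.1.aestronglyMeasurable).1 hu.1
  have hw2 : MemLp w 2 μ := by
    rw [memLp_two_iff_lintegral hw]
    refine (h1.trans_lt ?_).ne
    have := hu.lintegral_ne_top
    exact ENNReal.mul_lt_top hC.lt_top (ENNReal.add_lt_top.2 ⟨hI.lt_top, this.lt_top⟩)
  set f := Ω.piecewise u w with hf
  have hfu : f =ᵐ[volume.restrict Ω] u := piecewise_ae_eq_restrict hG.isOpen.measurableSet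
  have hfw : f =ᵐ[μ] w := by
    filter_upwards [hG.mem_frontier] with x hx
    exact piecewise_eq_of_notMem _ _ _ (hG.notMem hx)
  have hf2 : MemLp f 2 (bulkBoundaryMeasure Ω μ) := by
    have hm : AEStronglyMeasurable f (bulkBoundaryMeasure Ω μ) :=
      AEStronglyMeasurable.add_measure (hu.1.aestronglyMeasurable.congr hfu.symm)
        (hw.congr hfw.symm)
    rw [memLp_two_iff_lintegral hm, bulkBoundaryMeasure, lintegral_add_measure, ENNReal.add_ne_top]
    exact ⟨(memLp_two_iff_lintegral (hu.1.ae_eq hfu.symm).aestronglyMeasurable).1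
      (hu.1.ae_eq hfu.symm), (memLp_two_iff_lintegral (hw2.ae_eq hfw.symm).aestronglyMeasurable).1
      (hw2.ae_eq hfw.symm)⟩
  have hU := hf2.coeFn_toLp
  have hUu : hf2.toLp f =ᵐ[volume.restrict Ω] u :=
    EventuallyEq.trans (ae_mono (restrict_le_bulkBoundary Ω μ) hU) hfu
  have hUw : hf2.toLp f =ᵐ[μ] w := EventuallyEq.trans (ae_mono (le_bulkBoundary Ω μ) hU) hfw
  refine ⟨hf2.toLp f, ⟨hu.congr hUu.symm, ?_⟩, hUu⟩
  filter_upwards [hUw, hae] with x hx hxw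
  rw [hx]
  exact hxw.congr hUu.symm

end TraceGeometry

/-- The space of pairs of difference quotients of functions on `Ω` and on `∂Ω`. -/
abbrev QuotientL2 (Ω : Set (EuclideanSpace ℝ (Fin N)))
    (μ : Measure (EuclideanSpace ℝ (Fin N))) : Type :=
  WithLp 2 (Lp ℂ 2 ((volume.restrict Ω).prod (volume.restrict Ω)) × Lp ℂ 2 (μ.prod μ))

/-- The ambient Hilbert space of the form domain: triples of an element of `L²(Ω, m)` and of
square integrable functions on `Ω × Ω` and on `∂Ω × ∂Ω`. -/
abbrev FormAmbient (Ω : Set (EuclideanSpace ℝ (Fin N)))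
    (μ : Measure (EuclideanSpace ℝ (Fin N))) : Type :=
  WithLp 2 (BulkBoundaryL2 Ω μ × QuotientL2 Ω μ)

theorem diffQuot_zero : diffQuot a (0 : EuclideanSpace ℝ (Fin N) → ℂ) = 0 := by
  funext p
  simp [diffQuot]

theorem diffQuot_add : diffQuot a (u + u') = diffQuot a u + diffQuot a u' := by
  funext p
  simp only [diffQuot, Pi.add_apply]
  ring

theorem diffQuot_sub : diffQuot a (u - u') = diffQuot a u - diffQuot a u' := by
  funext p
  simp only [diffQuot, Pi.sub_apply]
  ring

theorem diffQuot_smul (z : ℂ) : diffQuot a (z • u) = z • diffQuot a u := by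
  funext p
  simp only [diffQuot, Pi.smul_apply, smul_eq_mul]
  ring

/-- Pairs consisting of a function in `L²(Ω, m)` and of its difference quotient with respect to one
of the two parts of the measure `m`. -/
def quotientGraph (a : ℝ) (Ω : Set (EuclideanSpace ℝ (Fin N)))
    (μ ν : Measure (EuclideanSpace ℝ (Fin N))) [SFinite ν]
    (hν : ν ≤ bulkBoundaryMeasure Ω μ) :
    Submodule ℂ (BulkBoundaryL2 Ω μ × Lp ℂ 2 (ν.prod ν)) where
  carrier := {q | q.2 =ᵐ[ν.prod ν] diffQuot a q.1}
  zero_mem' := by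
    have h := ae_mono hν (Lp.coeFn_zero ℂ 2 (bulkBoundaryMeasure Ω μ))
    exact (Lp.coeFn_zero _ _ _).trans
      ((EventuallyEq.of_eq diffQuot_zero.symm).trans (diffQuot_ae_congr h).symm)
  add_mem' := by
    intro q q' hq hq'
    have h : ⇑(q.1 + q'.1) =ᵐ[ν] q.1 + q'.1 := ae_mono hν (Lp.coeFn_add q.1 q'.1)
    exact (Lp.coeFn_add q.2 q'.2).trans ((EventuallyEq.add
      (show _ =ᵐ[ν.prod ν] _ from hq) hq').trans
      ((EventuallyEq.of_eq diffQuot_add.symm).trans (diffQuot_ae_congr h).symm))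
  smul_mem' := by
    intro z q hq
    have h : ⇑(z • q.1) =ᵐ[ν] z • ⇑q.1 := ae_mono hν (Lp.coeFn_smul z q.1)
    exact (Lp.coeFn_smul z q.2).trans ((EventuallyEq.const_smul
      (show _ =ᵐ[ν.prod ν] _ from hq) z).trans
      ((EventuallyEq.of_eq (diffQuot_smul z).symm).trans (diffQuot_ae_congr h).symm))

theorem isClosed_quotientGraph [SFinite ν] (hν : ν ≤ bulkBoundaryMeasure Ω μ) :
    IsClosed (quotientGraph a Ω μ ν hν : Set (BulkBoundaryL2 Ω μ × Lp ℂ 2 (ν.prod ν))) := by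
  refine IsSeqClosed.isClosed fun q q₀ hq hlim => ?_
  have h1 : Tendsto (fun n => (q n).1) atTop (𝓝 q₀.1) := (continuous_fst.tendsto _).comp hlim
  obtain ⟨φ, hφ, hφlim⟩ := (tendstoInMeasure_of_tendsto_Lp h1).exists_seq_tendsto_ae
  have h2 : Tendsto (fun n => (q (φ n)).2) atTop (𝓝 q₀.2) :=
    ((continuous_snd.tendsto _).comp hlim).comp hφ.tendsto_atTop
  obtain ⟨ψ, hψ, hψlim⟩ := (tendstoInMeasure_of_tendsto_Lp h2).exists_seq_tendsto_ae
  have h3 := ae_mono hν hφlim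
  have h4 : ∀ᵐ p ∂(ν.prod ν), ∀ n, (q (φ (ψ n))).2 p = diffQuot a (q (φ (ψ n))).1 p :=
    ae_all_iff.2 fun n => hq (φ (ψ n))
  change q₀.2 =ᵐ[ν.prod ν] diffQuot a q₀.1
  filter_upwards [hψlim, h4, Measure.quasiMeasurePreserving_fst.ae h3,
    Measure.quasiMeasurePreserving_snd.ae h3] with p hp hpn hp1 hp2
  refine tendsto_nhds_unique hp ?_
  simp_rw [hpn]
  exact ((hp1.comp hψ.tendsto_atTop).sub (hp2.comp hψ.tendsto_atTop)).div_const _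

end FormDomain

/-! ### The form domain as a Hilbert space -/

section FormHilbertSpace

variable {N : ℕ} {a d s : ℝ} {Ω : Set (EuclideanSpace ℝ (Fin N))}
  {μ ν : Measure (EuclideanSpace ℝ (Fin N))} {c v r₀ k : ℝ}

theorem Lp_enorm_sq_eq {X : Type*} [MeasurableSpace X] {P : Measure X} (f : Lp ℂ 2 P) :
    ‖f‖ₑ ^ 2 = ∫⁻ x, ‖f x‖ₑ ^ 2 ∂P := by
  rw [Lp.enorm_def, eLpNorm_two_sq]

theorem lintegral_enorm_sub_sq_le {X : Type*} [MeasurableSpace X] {P ν : Measure X}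
    (hν : ν ≤ P) (f g : Lp ℂ 2 P) : ∫⁻ x, ‖f x - g x‖ₑ ^ 2 ∂ν ≤ ‖f - g‖ₑ ^ 2 := by
  rw [Lp_enorm_sq_eq]
  refine (lintegral_mono' hν le_rfl).trans (le_of_eq (lintegral_congr_ae ?_))
  filter_upwards [Lp.coeFn_sub f g] with x hx
  rw [hx, Pi.sub_apply]

/-- The form domain `H^s(Ω)` realised as the space of triples consisting of `u ∈ H^s(Ω)` and of the
difference quotients of `u` on `Ω × Ω` and on `∂Ω × ∂Ω`; the norm of the ambient space is the
natural norm of the form domain. -/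
def formDomain (s d : ℝ) (Ω : Set (EuclideanSpace ℝ (Fin N)))
    (μ : Measure (EuclideanSpace ℝ (Fin N))) [SFinite μ] : Submodule ℂ (FormAmbient Ω μ) :=
  (hsSubspace s Ω μ).comap (WithLp.fstL 2 ℂ _ _ : FormAmbient Ω μ →L[ℂ] _).toLinearMap ⊓
  (quotientGraph ((N : ℝ) + 2 * s) Ω μ (volume.restrict Ω) (restrict_le_bulkBoundary Ω μ)).comap
    ((WithLp.fstL 2 ℂ _ _ : FormAmbient Ω μ →L[ℂ] _).prod
      (WithLp.fstL 2 ℂ _ _ ∘L WithLp.sndL 2 ℂ _ _)).toLinearMap ⊓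
  (quotientGraph (d + 2 * besovExponent N s d) Ω μ μ (le_bulkBoundary Ω μ)).comap
    ((WithLp.fstL 2 ℂ _ _ : FormAmbient Ω μ →L[ℂ] _).prod
      (WithLp.sndL 2 ℂ _ _ ∘L WithLp.sndL 2 ℂ _ _)).toLinearMap

theorem mem_formDomain [SFinite μ] {ω : FormAmbient Ω μ} : ω ∈ formDomain s d Ω μ ↔
    (ω.fst ∈ hsSubspace s Ω μ ∧
      ω.snd.fst =ᵐ[(volume.restrict Ω).prod (volume.restrict Ω)]
        diffQuot ((N : ℝ) + 2 * s) ω.fst) ∧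
      ω.snd.snd =ᵐ[μ.prod μ] diffQuot (d + 2 * besovExponent N s d) ω.fst :=
  Iff.rfl

theorem isClosed_quotientConditions [SFinite μ] : IsClosed {ω : FormAmbient Ω μ |
      ω.snd.fst =ᵐ[(volume.restrict Ω).prod (volume.restrict Ω)]
        diffQuot ((N : ℝ) + 2 * s) ω.fst ∧
      ω.snd.snd =ᵐ[μ.prod μ] diffQuot a ω.fst} := by
  have h1 := (isClosed_quotientGraph (a := (N : ℝ) + 2 * s)
    (restrict_le_bulkBoundary Ω μ)).preimage
    ((WithLp.fstL 2 ℂ _ _ : FormAmbient Ω μ →L[ℂ] _).prod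
      (WithLp.fstL 2 ℂ _ _ ∘L WithLp.sndL 2 ℂ _ _)).continuous
  have h2 := (isClosed_quotientGraph (a := a) (le_bulkBoundary Ω μ)).preimage
    ((WithLp.fstL 2 ℂ _ _ : FormAmbient Ω μ →L[ℂ] _).prod
      (WithLp.sndL 2 ℂ _ _ ∘L WithLp.sndL 2 ℂ _ _)).continuous
  exact h1.inter h2

theorem besov_exponent_eq (N : ℕ) (s d : ℝ) :
    d + 2 * besovExponent N s d = d + (2 * s - (N : ℝ) + d) := by
  unfold besovExponent
  ring

/-- The form domain is complete: limits of functions in `H^s(Ω)` are again in `H^s(Ω)`, and the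
boundary values of the limit are its trace by the continuity of the trace. -/
theorem TraceGeometry.isClosed_formDomain [SFinite μ] (hG : TraceGeometry d Ω μ c v r₀ k)
    (hs : 0 < s) (hd : 0 < d) (hβ : 0 < 2 * s - (N : ℝ) + d) :
    IsClosed (formDomain s d Ω μ : Set (FormAmbient Ω μ)) := by
  obtain ⟨C, hC, hbd⟩ := hG.exists_trace_bounds hs hd hβ
  refine IsSeqClosed.isClosed fun ω ω₀ hω hlim => ?_
  have hω' := fun n => mem_formDomain.1 (hω n)
  obtain ⟨hP, hQ⟩ := isClosed_quotientConditions.mem_of_tendsto hlim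
    (Eventually.of_forall fun n => ⟨(hω' n).1.2, (hω' n).2⟩)
  set P₀ := ω₀.snd.fst
  set U₀ := ω₀.fst with hU₀
  have hHs : MemHs s Ω U₀ := by
    refine ⟨(Lp.memLp U₀).mono_measure (restrict_le_bulkBoundary Ω μ), ?_⟩
    exact (Lp.memLp P₀).ae_eq hP
  obtain ⟨w, hw, hwtr⟩ := hG.exists_trace_of_memHs hs hβ hHs
  have hU₀m : AEStronglyMeasurable U₀ μ :=
    (Lp.aestronglyMeasurable U₀).mono_measure (le_bulkBoundary Ω μ)
  -- the distance of the boundary values of the limit from its trace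
  have hest : ∀ n, ∫⁻ x, ‖U₀ x - w x‖ₑ ^ 2 ∂μ ≤ 2 * (‖(ω n).fst - U₀‖ₑ ^ 2 +
      C * (‖(ω n).fst - U₀‖ₑ ^ 2 + ‖(ω n).snd.fst - P₀‖ₑ ^ 2)) := by
    intro n
    set U := (ω n).fst
    set P := (ω n).snd.fst
    obtain ⟨⟨⟨hUHs, hUtr⟩, hUP⟩, -⟩ := hω' n
    have hUm : AEStronglyMeasurable U μ :=
      (Lp.aestronglyMeasurable U).mono_measure (le_bulkBoundary Ω μ)
    have h1 := (hbd (U + (-1 : ℂ) • ⇑U₀) (⇑U + (-1 : ℂ) • w) (hUHs.add (hHs.const_smul _))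
      (hUm.add (hw.const_smul _)) (by
        filter_upwards [hUtr, hwtr] with x hx hx'
        exact hUHs.1 |> fun h => HasTraceAt.add h (hHs.const_smul (-1)).1 hx (hx'.const_smul _))).1
    have e : ∀ f g : EuclideanSpace ℝ (Fin N) → ℂ, f + (-1 : ℂ) • g = f - g := by
      intro f g
      rw [neg_one_smul, sub_eq_add_neg]
    rw [e, e] at h1
    have h2 : ∫⁻ p, ‖diffQuot ((N : ℝ) + 2 * s) (⇑U - ⇑U₀) p‖ₑ ^ 2
        ∂((volume.restrict Ω).prod (volume.restrict Ω)) ≤ ‖P - P₀‖ₑ ^ 2 := by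
      refine le_trans (le_of_eq (lintegral_congr_ae ?_)) (lintegral_enorm_sub_sq_le le_rfl P P₀)
      filter_upwards [hUP, hP] with p hp hp'
      rw [diffQuot_sub, Pi.sub_apply, hp, hp']
    have h3 := lintegral_enorm_sub_sq_le (le_bulkBoundary Ω μ) U U₀
    have h4 := lintegral_enorm_sub_sq_le (restrict_le_bulkBoundary Ω μ) U U₀
    calc _ ≤ ∫⁻ x, (2 * ‖U x - U₀ x‖ₑ ^ 2 + 2 * ‖U x - w x‖ₑ ^ 2) ∂μ := by
          refine lintegral_mono fun x => ?_
          have := enorm_sub_sq_le_two (U x - w x) (U x - U₀ x)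
          rw [sub_sub_sub_cancel_left] at this
          refine this.trans (le_of_eq ?_)
          ring
      _ = 2 * (∫⁻ x, ‖U x - U₀ x‖ₑ ^ 2 ∂μ) + 2 * ∫⁻ x, ‖U x - w x‖ₑ ^ 2 ∂μ := by
          have hm : AEMeasurable (fun x => 2 * ‖U x - U₀ x‖ₑ ^ 2) μ :=
            ((hUm.sub hU₀m).enorm.pow_const 2).const_mul _
          rw [lintegral_add_left' hm,
            lintegral_const_mul' _ _ (by norm_num), lintegral_const_mul' _ _ (by norm_num)]
      _ ≤ 2 * ‖U - U₀‖ₑ ^ 2 + 2 * (C * (‖U - U₀‖ₑ ^ 2 + ‖P - P₀‖ₑ ^ 2)) := by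
          gcongr
          refine h1.trans ?_
          gcongr
          exact h4
      _ = _ := by ring
  have hzero : ∫⁻ x, ‖U₀ x - w x‖ₑ ^ 2 ∂μ = 0 := by
    have t1 : Tendsto (fun n => ‖(ω n).fst - U₀‖ₑ) atTop (𝓝 0) := by
      have : Continuous fun ω : FormAmbient Ω μ => ‖ω.fst - U₀‖ₑ :=
        continuous_enorm.comp ((WithLp.fstL 2 ℂ _ _).continuous.sub continuous_const)
      have h0 : Tendsto (fun n => ‖(ω n).fst - U₀‖ₑ) atTop (𝓝 ‖ω₀.fst - U₀‖ₑ) :=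
        (this.tendsto ω₀).comp hlim
      rwa [← hU₀, sub_self, enorm_zero] at h0
    have t2 : Tendsto (fun n => ‖(ω n).snd.fst - P₀‖ₑ) atTop (𝓝 0) := by
      have : Continuous fun ω : FormAmbient Ω μ => ‖ω.snd.fst - P₀‖ₑ :=
        continuous_enorm.comp (((WithLp.fstL 2 ℂ _ _).continuous.comp
          (WithLp.sndL 2 ℂ _ _).continuous).sub continuous_const)
      have h0 : Tendsto (fun n => ‖(ω n).snd.fst - P₀‖ₑ) atTop (𝓝 ‖ω₀.snd.fst - P₀‖ₑ) :=
        (this.tendsto ω₀).comp hlim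
      rwa [show ω₀.snd.fst - P₀ = 0 from sub_self _, enorm_zero] at h0
    have t3 : Tendsto (fun n => 2 * (‖(ω n).fst - U₀‖ₑ ^ 2 +
        C * (‖(ω n).fst - U₀‖ₑ ^ 2 + ‖(ω n).snd.fst - P₀‖ₑ ^ 2))) atTop
        (𝓝 (2 * (0 ^ 2 + C * (0 ^ 2 + 0 ^ 2)))) := by
      have t1' := (ENNReal.continuous_pow 2).tendsto 0 |>.comp t1
      have t2' := (ENNReal.continuous_pow 2).tendsto 0 |>.comp t2
      exact ENNReal.Tendsto.const_mul (t1'.add (ENNReal.Tendsto.const_mul (t1'.add t2')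
        (Or.inr hC))) (Or.inr (by norm_num))
    have := ge_of_tendsto' t3 hest
    simpa using this
  have hUw : ∀ᵐ x ∂μ, U₀ x = w x := by
    have hm : AEMeasurable (fun x => ‖U₀ x - w x‖ₑ ^ 2) μ := (hU₀m.sub hw).enorm.pow_const 2
    rw [lintegral_eq_zero_iff' hm] at hzero
    filter_upwards [hzero] with x hx
    simpa [sub_eq_zero] using hx
  refine mem_formDomain.2 ⟨⟨⟨hHs, ?_⟩, hP⟩, hQ⟩
  filter_upwards [hUw, hwtr] with x hx hx'
  rw [← hU₀, hx]
  exact hx'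

/-- The embedding of the form domain into `L²(Ω, m)`. -/
def formEmbedding (s d : ℝ) (Ω : Set (EuclideanSpace ℝ (Fin N)))
    (μ : Measure (EuclideanSpace ℝ (Fin N))) [SFinite μ] :
    formDomain s d Ω μ →L[ℂ] BulkBoundaryL2 Ω μ :=
  WithLp.fstL 2 ℂ _ _ ∘L (formDomain s d Ω μ).subtypeL

/-- The difference quotient on `Ω × Ω` as an operator on the form domain. -/
def bulkQuotient (s d : ℝ) (Ω : Set (EuclideanSpace ℝ (Fin N)))
    (μ : Measure (EuclideanSpace ℝ (Fin N))) [SFinite μ] :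
    formDomain s d Ω μ →L[ℂ] Lp ℂ 2 ((volume.restrict Ω).prod (volume.restrict Ω)) :=
  WithLp.fstL 2 ℂ _ _ ∘L WithLp.sndL 2 ℂ _ _ ∘L (formDomain s d Ω μ).subtypeL

/-- The difference quotient on `∂Ω × ∂Ω` as an operator on the form domain. -/
def boundaryQuotient (s d : ℝ) (Ω : Set (EuclideanSpace ℝ (Fin N)))
    (μ : Measure (EuclideanSpace ℝ (Fin N))) [SFinite μ] :
    formDomain s d Ω μ →L[ℂ] Lp ℂ 2 (μ.prod μ) :=
  WithLp.sndL 2 ℂ _ _ ∘L WithLp.sndL 2 ℂ _ _ ∘L (formDomain s d Ω μ).subtypeL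

section

variable [SFinite μ]

theorem formEmbedding_mem (ω : formDomain s d Ω μ) :
    formEmbedding s d Ω μ ω ∈ hsSubspace s Ω μ := (mem_formDomain.1 ω.2).1.1

theorem bulkQuotient_ae_eq (ω : formDomain s d Ω μ) :
    bulkQuotient s d Ω μ ω =ᵐ[(volume.restrict Ω).prod (volume.restrict Ω)]
      diffQuot ((N : ℝ) + 2 * s) (formEmbedding s d Ω μ ω) := (mem_formDomain.1 ω.2).1.2

theorem boundaryQuotient_ae_eq (ω : formDomain s d Ω μ) :
    boundaryQuotient s d Ω μ ω =ᵐ[μ.prod μ]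
      diffQuot (d + 2 * besovExponent N s d) (formEmbedding s d Ω μ ω) := (mem_formDomain.1 ω.2).2

theorem norm_sq_formDomain (ω : formDomain s d Ω μ) : ‖ω‖ ^ 2 =
    ‖formEmbedding s d Ω μ ω‖ ^ 2 +
      (‖bulkQuotient s d Ω μ ω‖ ^ 2 + ‖boundaryQuotient s d Ω μ ω‖ ^ 2) := by
  have h1 := WithLp.prod_norm_sq_eq_of_L2 (ω : FormAmbient Ω μ)
  have h2 := WithLp.prod_norm_sq_eq_of_L2 (ω : FormAmbient Ω μ).snd
  rw [h2] at h1
  exact h1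

/-- The difference quotients are determined by the function: on `∂Ω × ∂Ω` by its boundary values,
which are part of the element of `L²(Ω, m)`. -/
theorem formEmbedding_injective : Function.Injective (formEmbedding s d Ω μ) := by
  rw [injective_iff_map_eq_zero]
  intro ω hω
  have h0 : ⇑(formEmbedding s d Ω μ ω) =ᵐ[bulkBoundaryMeasure Ω μ] 0 := by
    rw [hω]
    exact Lp.coeFn_zero _ _ _
  have h1 : bulkQuotient s d Ω μ ω = 0 := by
    rw [Lp.eq_zero_iff_ae_eq_zero]
    refine (bulkQuotient_ae_eq ω).trans ?_
    refine (diffQuot_ae_congr (ae_mono (restrict_le_bulkBoundary Ω μ) h0)).trans ?_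
    rw [diffQuot_zero]
  have h2 : boundaryQuotient s d Ω μ ω = 0 := by
    rw [Lp.eq_zero_iff_ae_eq_zero]
    refine (boundaryQuotient_ae_eq ω).trans ?_
    refine (diffQuot_ae_congr (ae_mono (le_bulkBoundary Ω μ) h0)).trans ?_
    rw [diffQuot_zero]
  have h3 := norm_sq_formDomain ω
  rw [hω, h1, h2] at h3
  simpa using h3

/-- Every element of `H^s(Ω)` is in the form domain, since its trace belongs to the Besov space. -/
theorem TraceGeometry.exists_formEmbedding_eq (hG : TraceGeometry d Ω μ c v r₀ k)
    (hs : 0 < s) (hd : 0 < d) (hβ : 0 < 2 * s - (N : ℝ) + d) {U : BulkBoundaryL2 Ω μ}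
    (hU : U ∈ hsSubspace s Ω μ) : ∃ ω, formEmbedding s d Ω μ ω = U := by
  obtain ⟨C, hC, hbd⟩ := hG.exists_trace_bounds hs hd hβ
  have hUm : AEStronglyMeasurable U μ :=
    (Lp.aestronglyMeasurable U).mono_measure (le_bulkBoundary Ω μ)
  obtain ⟨-, -, h3⟩ := hbd U U hU.1 hUm hU.2
  have hP : MemLp (diffQuot ((N : ℝ) + 2 * s) U) 2
      ((volume.restrict Ω).prod (volume.restrict Ω)) := hU.1.2
  have hQ : MemLp (diffQuot (d + 2 * besovExponent N s d) U) 2 (μ.prod μ) := by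
    rw [memLp_two_iff_lintegral (aestronglyMeasurable_diffQuot hUm), besov_exponent_eq]
    refine (h3.trans_lt (ENNReal.mul_lt_top hC.lt_top (ENNReal.add_lt_top.2
      ⟨hU.1.lintegral_ne_top.lt_top, ?_⟩))).ne
    refine lt_of_le_of_lt (lintegral_mono' (le_bulkBoundary Ω μ) le_rfl) ?_
    rw [← Lp_enorm_sq_eq]
    exact ENNReal.pow_lt_top enorm_lt_top
  exact ⟨⟨WithLp.toLp 2 (U, WithLp.toLp 2 (hP.toLp _, hQ.toLp _)),
    mem_formDomain.2 ⟨⟨hU, hP.coeFn_toLp⟩, hQ.coeFn_toLp⟩⟩, rfl⟩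

theorem TraceGeometry.range_formEmbedding (hG : TraceGeometry d Ω μ c v r₀ k)
    (hs : 0 < s) (hd : 0 < d) (hβ : 0 < 2 * s - (N : ℝ) + d) :
    LinearMap.range (formEmbedding s d Ω μ : formDomain s d Ω μ →ₗ[ℂ] BulkBoundaryL2 Ω μ) =
      hsSubspace s Ω μ := by
  apply le_antisymm
  · rintro _ ⟨ω, rfl⟩
    exact formEmbedding_mem ω
  · intro U hU
    obtain ⟨ω, hω⟩ := hG.exists_formEmbedding_eq hs hd hβ hU
    exact ⟨ω, hω⟩

end

end FormHilbertSpace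

/-! ### Density of the form domain -/

section Density

variable {N : ℕ} {d s : ℝ} {Ω : Set (EuclideanSpace ℝ (Fin N))}
  {μ : Measure (EuclideanSpace ℝ (Fin N))} {c v r₀ k : ℝ}

/-- Integrability of the kernel `|z|^(2 - N - 2 s)` near the origin, for `s < 1`. -/
theorem setLIntegral_ball_norm_rpow_lt_top [Nontrivial (EuclideanSpace ℝ (Fin N))]
    (hs1 : s < 1) (R : ℝ) :
    ∫⁻ z in Metric.ball (0 : EuclideanSpace ℝ (Fin N)) R,
      ENNReal.ofReal (‖z‖ ^ (2 - ((N : ℝ) + 2 * s))) < ∞ := by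
  have hN : 1 ≤ N := by
    have := Module.finrank_pos (R := ℝ) (M := EuclideanSpace ℝ (Fin N))
    rwa [finrank_euclideanSpace_fin] at this
  have h1 : IntegrableOn (fun y : ℝ => y ^ (1 - 2 * s)) (Ioo 0 R) := by
    rcases le_or_gt R 0 with h | h
    · simp [Ioo_eq_empty_of_le h]
    · have := (intervalIntegral.intervalIntegrable_rpow' (a := 0) (b := R) (r := 1 - 2 * s)
        (by linarith)).1
      exact this.mono_set Ioo_subset_Ioc_self
  have h2 : IntegrableOn (fun z : EuclideanSpace ℝ (Fin N) => ‖z‖ ^ (2 - ((N : ℝ) + 2 * s)))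
      (Metric.ball 0 R) := by
    rw [integrableOn_fun_norm_addHaar (μ := volume)
      (f := fun y : ℝ => y ^ (2 - ((N : ℝ) + 2 * s)))]
    refine h1.congr_fun (fun y hy => ?_) measurableSet_Ioo
    rw [finrank_euclideanSpace_fin, smul_eq_mul, ← Real.rpow_natCast, ← Real.rpow_add hy.1,
      Nat.cast_sub hN]
    change y ^ (1 - 2 * s) = _
    congr 1
    push_cast
    ring
  exact h2.lintegral_lt_top

/-- On a bounded set, Lipschitz functions belong to `H^s` for `s < 1`: the Gagliardo density is
dominated by the integrable kernel `|y - z|^(2 - N - 2 s)`. -/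
theorem memHs_of_lipschitzWith [Nontrivial (EuclideanSpace ℝ (Fin N))] (hs1 : s < 1)
    (hΩ : MeasurableSet Ω) (hΩb : Bornology.IsBounded Ω)
    {u : EuclideanSpace ℝ (Fin N) → ℂ} {L : NNReal} (hL : LipschitzWith L u)
    (hu : MemLp u 2 (volume.restrict Ω)) : MemHs s Ω u := by
  refine ⟨hu, ?_⟩
  change MemLp (diffQuot ((N : ℝ) + 2 * s) u) 2 _
  have hum : Measurable u := hL.continuous.measurable
  rw [memLp_two_iff_lintegral (aestronglyMeasurable_diffQuot hu.aestronglyMeasurable)]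
  obtain ⟨D, hD⟩ := Metric.isBounded_iff.1 hΩb
  set κ := ∫⁻ z in Metric.ball (0 : EuclideanSpace ℝ (Fin N)) (D + 1),
      ENNReal.ofReal (‖z‖ ^ (2 - ((N : ℝ) + 2 * s))) with hκ
  have hκ' : κ < ∞ := setLIntegral_ball_norm_rpow_lt_top hs1 (D + 1)
  rw [← totalEnergy_eq hum]
  have hpt : ∀ y z, gagliardo s u (y, z) ≤
      (L : ℝ≥0∞) ^ 2 * ENNReal.ofReal (‖y - z‖ ^ (2 - ((N : ℝ) + 2 * s))) := by
    intro y z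
    rcases eq_or_ne y z with rfl | hne
    · simp [gagliardo]
    have h0 : 0 < ‖y - z‖ := norm_pos_iff.2 (sub_ne_zero.2 hne)
    have h1 : ‖(u y - u z) / ((dist y z ^ (((N : ℝ) + 2 * s) / 2) : ℝ) : ℂ)‖ ^ 2 ≤
        (L : ℝ) ^ 2 * ‖y - z‖ ^ (2 - ((N : ℝ) + 2 * s)) := by
      rw [dist_eq_norm, norm_div, Complex.norm_real, Real.norm_of_nonneg (by positivity),
        div_pow, ← Real.rpow_natCast (‖y - z‖ ^ _), ← Real.rpow_mul h0.le,
        Real.rpow_sub h0]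
      have e : ((N : ℝ) + 2 * s) / 2 * ((2 : ℕ) : ℝ) = (N : ℝ) + 2 * s := by push_cast; ring
      rw [e, Real.rpow_two, mul_div_assoc', ← mul_pow]
      gcongr
      have := hL.dist_le_mul y z
      rwa [dist_eq_norm, dist_eq_norm] at this
    unfold gagliardo
    rw [← ofReal_norm, ← ENNReal.ofReal_pow (norm_nonneg _)]
    refine (ENNReal.ofReal_le_ofReal h1).trans (le_of_eq ?_)
    rw [ENNReal.ofReal_mul (by positivity), ENNReal.ofReal_pow (by positivity),
      ENNReal.ofReal_coe_nnreal]
  have hinner : ∀ y ∈ Ω, ∫⁻ z in Ω, gagliardo s u (y, z) ≤ (L : ℝ≥0∞) ^ 2 * κ := by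
    intro y hy
    calc _ ≤ ∫⁻ z in Ω, (L : ℝ≥0∞) ^ 2 * ENNReal.ofReal (‖y - z‖ ^ (2 - ((N : ℝ) + 2 * s))) :=
          lintegral_mono fun z => hpt y z
      _ = (L : ℝ≥0∞) ^ 2 * ∫⁻ z in Ω, ENNReal.ofReal (‖y - z‖ ^ (2 - ((N : ℝ) + 2 * s))) :=
          lintegral_const_mul' _ _ (by finiteness)
      _ ≤ _ := by
          refine mul_le_mul_right ?_ _
          rw [hκ, ← lintegral_indicator hΩ, ← lintegral_indicator Metric.isOpen_ball.measurableSet,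
            ← lintegral_sub_left_eq_self _ y]
          refine lintegral_mono fun z => ?_
          refine indicator_apply_le' (fun hz => ?_) fun _ => zero_le
          have hzD := hD hy hz
          rw [dist_eq_norm, sub_sub_cancel] at hzD
          rw [sub_sub_cancel, indicator_of_mem]
          rw [mem_ball_zero_iff]
          linarith
  have : totalEnergy s Ω u ≤ (L : ℝ≥0∞) ^ 2 * κ * volume Ω := by
    unfold totalEnergy
    refine (setLIntegral_mono' hΩ hinner).trans (le_of_eq ?_)
    rw [setLIntegral_const]
  refine (this.trans_lt ?_).ne
  have := hΩb.measure_lt_top (μ := volume)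
  finiteness

theorem TraceGeometry.hasTraceAt_of_continuous (hG : TraceGeometry d Ω μ c v r₀ k)
    {u : EuclideanSpace ℝ (Fin N) → ℂ} (hu : Continuous u)
    (hu2 : MemLp u 2 (volume.restrict Ω)) {x : EuclideanSpace ℝ (Fin N)}
    (hx : x ∈ frontier Ω) : HasTraceAt Ω u x (u x) := by
  unfold HasTraceAt
  rw [Metric.tendsto_nhds]
  intro e he
  obtain ⟨r₁, hr₁, hcont⟩ := Metric.continuousAt_iff.1 hu.continuousAt (e / 2) (half_pos he)
  filter_upwards [Ioo_mem_nhdsGT hr₁] with r hr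
  set A := Metric.ball x r ∩ Ω
  have hpos : volume A ≠ 0 := by
    refine (IsOpen.measure_pos volume (Metric.isOpen_ball.inter hG.isOpen) ?_).ne'
    obtain ⟨y, hy, hxy⟩ := Metric.mem_closure_iff.1 (frontier_subset_closure hx) r hr.1
    exact ⟨y, Metric.mem_ball'.2 hxy, hy⟩
  have hfin : volume A < ∞ := (measure_mono inter_subset_right).trans_lt hG.volume_lt_top
  have hAm : MeasurableSet A := Metric.isOpen_ball.measurableSet.inter hG.isOpen.measurableSet
  have hmem : (⨍ y in A, u y) ∈ Metric.closedBall (u x) (e / 2) := by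
    refine Convex.set_average_mem (convex_closedBall _ _) Metric.isClosed_closedBall hpos hfin.ne ?_
      ((hG.integrableOn hu2).mono_set inter_subset_right)
    filter_upwards [ae_restrict_mem hAm] with y hy
    exact (hcont ((Metric.mem_ball.1 hy.1).trans hr.2)).le
  exact (Metric.mem_closedBall.1 hmem).trans_lt (half_lt_self he)

/-- Smooth compactly supported functions, with their boundary values, belong to `H^s(Ω)`; hence
`H^s(Ω)` is dense in `L²(Ω, m)`. -/
theorem TraceGeometry.denseRange_formEmbedding [Nontrivial (EuclideanSpace ℝ (Fin N))]
    [SFinite μ] (hG : TraceGeometry d Ω μ c v r₀ k)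
    (hs : 0 < s) (hs1 : s < 1) (hd : 0 < d) (hβ : 0 < 2 * s - (N : ℝ) + d) :
    DenseRange (formEmbedding s d Ω μ) := by
  have := hG.isFinite
  have : IsFiniteMeasure (volume.restrict Ω) := ⟨by simpa using hG.volume_lt_top⟩
  have : IsFiniteMeasure (bulkBoundaryMeasure Ω μ) := by
    unfold bulkBoundaryMeasure
    infer_instance
  suffices h : (hsSubspace s Ω μ).topologicalClosure = ⊤ by
    have h2 := congrArg (fun S : Submodule ℂ (BulkBoundaryL2 Ω μ) =>
      (S : Set (BulkBoundaryL2 Ω μ))) h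
    simp only [Submodule.topologicalClosure_coe, Submodule.top_coe] at h2
    rw [← hG.range_formEmbedding hs hd hβ] at h2
    rw [DenseRange, dense_iff_closure_eq]
    exact h2
  rw [Submodule.topologicalClosure_eq_top_iff, Submodule.eq_bot_iff]
  intro f hf
  rw [Submodule.mem_orthogonal] at hf
  rw [Lp.eq_zero_iff_ae_eq_zero]
  have hfi : Integrable f (bulkBoundaryMeasure Ω μ) := (Lp.memLp f).integrable (by norm_num)
  -- an element orthogonal to all test functions vanishes
  refine ae_eq_zero_of_integral_contDiff_smul_eq_zero hfi.locallyIntegrable fun g hg hgc => ?_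
  set u : EuclideanSpace ℝ (Fin N) → ℂ := fun x => (g x : ℂ) with hu
  have hucont : Continuous u := Complex.continuous_ofReal.comp hg.continuous
  have huc : HasCompactSupport u := hgc.comp_left Complex.ofReal_zero
  obtain ⟨L, hL⟩ := ContDiff.lipschitzWith_of_hasCompactSupport hgc hg (by simp)
  have huL : LipschitzWith L u := by
    refine LipschitzWith.of_dist_le_mul fun x y => ?_
    have := hL.dist_le_mul x y
    rwa [hu, Complex.dist_eq, ← Complex.ofReal_sub, Complex.norm_real, ← dist_eq_norm]
  have hum : MemLp u 2 (bulkBoundaryMeasure Ω μ) := hucont.memLp_of_hasCompactSupport huc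
  have huΩ : MemLp u 2 (volume.restrict Ω) := hum.mono_measure (restrict_le_bulkBoundary Ω μ)
  have hU := hum.coeFn_toLp
  have hUΩ : u =ᵐ[volume.restrict Ω] hum.toLp u :=
    EventuallyEq.symm (ae_mono (restrict_le_bulkBoundary Ω μ) hU)
  have hmem : hum.toLp u ∈ hsSubspace s Ω μ := by
    refine ⟨(memHs_of_lipschitzWith hs1 hG.isOpen.measurableSet hG.isBounded huL huΩ).congr hUΩ,
      ?_⟩
    filter_upwards [hG.mem_frontier, ae_mono (le_bulkBoundary Ω μ) hU] with x hx hx'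
    rw [hx']
    exact (hG.hasTraceAt_of_continuous hucont huΩ hx).congr hUΩ
  have h0 := hf _ hmem
  rw [L2.inner_def] at h0
  rw [← h0]
  refine integral_congr_ae ?_
  filter_upwards [hU] with x hx
  rw [hx, RCLike.inner_apply, hu]
  simp [mul_comm]

end Density

/-! ### Multiplication operators and time-dependent coefficients -/

section Coefficients

variable {X : Type*} [MeasurableSpace X] {ρ : Measure X} {κ κ' : X → ℝ}
  {M M' : Lp ℂ 2 ρ →L[ℂ] Lp ℂ 2 ρ}

/-- `M` is the operator of multiplication by the real function `κ` on `L²`. -/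
def IsMultiplier (κ : X → ℝ) (M : Lp ℂ 2 ρ →L[ℂ] Lp ℂ 2 ρ) : Prop :=
  ∀ f, M f =ᵐ[ρ] fun x => (κ x : ℂ) * f x

theorem exists_isMultiplier (hκ : AEMeasurable κ ρ) {k : ℝ} (hk : ∀ᵐ x ∂ρ, |κ x| ≤ k) :
    ∃ M : Lp ℂ 2 ρ →L[ℂ] Lp ℂ 2 ρ, IsMultiplier κ M := by
  have hm : ∀ f : Lp ℂ 2 ρ, MemLp (fun x => (κ x : ℂ) * f x) 2 ρ := by
    intro f
    refine (Lp.memLp f).of_le_mul (c := k)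
      ((Complex.measurable_ofReal.comp_aemeasurable hκ).aestronglyMeasurable.mul
        (Lp.aestronglyMeasurable f)) ?_
    filter_upwards [hk] with x hx
    rw [norm_mul, Complex.norm_real, Real.norm_eq_abs]
    gcongr
  let A : Lp ℂ 2 ρ →ₗ[ℂ] Lp ℂ 2 ρ :=
    { toFun := fun f => (hm f).toLp _
      map_add' := by
        intro f g
        apply Lp.ext
        filter_upwards [(hm (f + g)).coeFn_toLp, (hm f).coeFn_toLp, (hm g).coeFn_toLp,
          Lp.coeFn_add f g, Lp.coeFn_add ((hm f).toLp _) ((hm g).toLp _)] with x h1 h2 h3 h4 h5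
        rw [h5, h1, Pi.add_apply, h2, h3, h4, Pi.add_apply, mul_add]
      map_smul' := by
        intro z f
        apply Lp.ext
        filter_upwards [(hm (z • f)).coeFn_toLp, (hm f).coeFn_toLp,
          Lp.coeFn_smul z f, Lp.coeFn_smul z ((hm f).toLp _)] with x h1 h2 h3 h4
        rw [RingHom.id_apply, h4, h1, Pi.smul_apply, h2, h3, Pi.smul_apply, smul_eq_mul,
          smul_eq_mul, mul_left_comm] }
  refine ⟨A.mkContinuous k fun f => Lp.norm_le_mul_norm_of_ae_le_mul ?_,
    fun f => (hm f).coeFn_toLp⟩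
  filter_upwards [hk, (hm f).coeFn_toLp] with x hx h1
  change ‖(hm f).toLp _ x‖ ≤ _
  rw [h1, norm_mul, Complex.norm_real, Real.norm_eq_abs]
  gcongr

namespace IsMultiplier

theorem sub (h : IsMultiplier κ M) (h' : IsMultiplier κ' M') :
    IsMultiplier (fun x => κ x - κ' x) (M - M') := by
  intro f
  filter_upwards [h f, h' f, Lp.coeFn_sub (M f) (M' f)] with x h1 h2 h3
  rw [_root_.sub_apply, h3, Pi.sub_apply, h1, h2]
  push_cast
  ring

theorem opNorm_le (h : IsMultiplier κ M) {k : ℝ} (hk0 : 0 ≤ k) (hk : ∀ᵐ x ∂ρ, |κ x| ≤ k) :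
    ‖M‖ ≤ k := by
  refine ContinuousLinearMap.opNorm_le_bound _ hk0 fun f => Lp.norm_le_mul_norm_of_ae_le_mul ?_
  filter_upwards [hk, h f] with x hx h1
  rw [h1, norm_mul, Complex.norm_real, Real.norm_eq_abs]
  gcongr

theorem integrand_ae_eq (h : IsMultiplier κ M) (f g : Lp ℂ 2 ρ) :
    (fun x => inner ℂ (g x) (M f x)) =ᵐ[ρ] fun x => (κ x : ℂ) * (f x * conj (g x)) := by
  filter_upwards [h f] with x hx
  rw [RCLike.inner_apply, hx, mul_assoc]

theorem integrable (h : IsMultiplier κ M) (f g : Lp ℂ 2 ρ) :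
    Integrable (fun x => (κ x : ℂ) * (f x * conj (g x))) ρ :=
  (L2.integrable_inner g (M f)).congr (h.integrand_ae_eq f g)

theorem inner_eq (h : IsMultiplier κ M) (f g : Lp ℂ 2 ρ) :
    inner ℂ g (M f) = ∫ x, (κ x : ℂ) * (f x * conj (g x)) ∂ρ := by
  rw [L2.inner_def]
  exact integral_congr_ae (h.integrand_ae_eq f g)

theorem inner_left_eq (h : IsMultiplier κ M) (f g : Lp ℂ 2 ρ) :
    inner ℂ (M g) f = inner ℂ g (M f) := by
  rw [← inner_conj_symm, h.inner_eq, h.inner_eq, ← integral_conj]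
  refine integral_congr_ae (Eventually.of_forall fun x => ?_)
  simp only [map_mul, Complex.conj_ofReal, Complex.conj_conj]
  ring

theorem le_re_inner (h : IsMultiplier κ M) {k : ℝ} (hk : ∀ᵐ x ∂ρ, k ≤ κ x) (f : Lp ℂ 2 ρ) :
    k * ‖f‖ ^ 2 ≤ (inner ℂ f (M f)).re := by
  have e1 : ∀ x, ((κ x : ℂ) * (f x * conj (f x))).re = κ x * ‖f x‖ ^ 2 := by
    intro x
    rw [Complex.mul_conj, ← Complex.ofReal_mul, Complex.ofReal_re, Complex.normSq_eq_norm_sq]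
  have hi := h.integrable f f
  have hi' : Integrable (fun x => κ x * ‖f x‖ ^ 2) ρ :=
    hi.re.congr (Eventually.of_forall e1)
  have hn : Integrable (fun x => ‖f x‖ ^ 2) ρ := (Lp.memLp f).integrable_norm_pow (by norm_num)
  have e2 : ‖f‖ ^ 2 = ∫ x, ‖f x‖ ^ 2 ∂ρ := by
    have h1 : ((‖f‖ ^ 2 : ℝ) : ℂ) = inner ℂ f f := by
      rw [inner_self_eq_norm_sq_to_K]
      norm_cast
    have h2 : inner ℂ f f = ((∫ x, ‖f x‖ ^ 2 ∂ρ : ℝ) : ℂ) := by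
      rw [L2.inner_def, ← integral_complex_ofReal]
      refine integral_congr_ae (Eventually.of_forall fun x => ?_)
      simp only [inner_self_eq_norm_sq_to_K]
      norm_cast
    exact_mod_cast h1.trans h2
  have e3 : (inner ℂ f (M f)).re = ∫ x, κ x * ‖f x‖ ^ 2 ∂ρ := by
    rw [h.inner_eq]
    refine (integral_re hi).symm.trans ?_
    exact integral_congr_ae (Eventually.of_forall e1)
  rw [e2, e3, ← integral_const_mul]
  refine integral_mono_ae (hn.const_mul k) hi' ?_
  filter_upwards [hk] with x hx
  gcongr

end IsMultiplier

/-- Conditions on a coefficient that hold for almost every time hold at every time, by continuity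
in time. -/
theorem aemeasurable_and_bounds_of_holder [SFinite ρ] {T η k₁ k₂ C : ℝ} (hT : 0 < T) (hη : 0 < η)
    {κ : ℝ → X → ℝ}
    (hm : AEMeasurable (fun p : ℝ × X => κ p.1 p.2) ((volume.restrict (Icc 0 T)).prod ρ))
    (hb : ∀ᵐ p : ℝ × X ∂((volume.restrict (Icc 0 T)).prod ρ),
      k₁ ≤ κ p.1 p.2 ∧ κ p.1 p.2 ≤ k₂)
    (hC : ∀ t ∈ Icc 0 T, ∀ τ ∈ Icc 0 T, ∀ᵐ q ∂ρ, |κ t q - κ τ q| ≤ C * |t - τ| ^ η)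
    {t : ℝ} (ht : t ∈ Icc 0 T) :
    AEMeasurable (κ t) ρ ∧ ∀ᵐ q ∂ρ, k₁ ≤ κ t q ∧ κ t q ≤ k₂ := by
  have hgood : ∀ᵐ τ ∂(volume.restrict (Icc 0 T)),
      AEMeasurable (κ τ) ρ ∧ ∀ᵐ q ∂ρ, k₁ ≤ κ τ q ∧ κ τ q ≤ k₂ := by
    filter_upwards [hm.aestronglyMeasurable.prodMk_left, Measure.ae_ae_of_ae_prod hb]
      with τ h1 h2
    exact ⟨h1.aemeasurable, h2⟩
  have hex : ∀ n : ℕ, ∃ τ ∈ Icc 0 T, |t - τ| < 1 / ((n : ℝ) + 1) ∧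
      AEMeasurable (κ τ) ρ ∧ ∀ᵐ q ∂ρ, k₁ ≤ κ τ q ∧ κ τ q ≤ k₂ := by
    intro n
    by_contra hcon
    have hr : 0 < 1 / ((n : ℝ) + 1) := Nat.one_div_pos_of_nat
    set O := Ioo 0 T ∩ Metric.ball t (1 / ((n : ℝ) + 1)) with hO
    have hne : O.Nonempty := by
      have hcl : t ∈ closure (Ioo 0 T) := by rwa [closure_Ioo hT.ne]
      obtain ⟨y, hy, hty⟩ := Metric.mem_closure_iff.1 hcl _ hr
      exact ⟨y, hy, by rwa [Metric.mem_ball, dist_comm]⟩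
    have hpos : 0 < volume O := (isOpen_Ioo.inter Metric.isOpen_ball).measure_pos _ hne
    rw [ae_restrict_iff' measurableSet_Icc] at hgood
    refine hpos.ne' (measure_mono_null (fun τ hτ => ?_) (ae_iff.1 hgood))
    have h1 : τ ∈ Icc 0 T := Ioo_subset_Icc_self hτ.1
    have h2 : |t - τ| < 1 / ((n : ℝ) + 1) := by
      have := hτ.2
      rwa [Metric.mem_ball, dist_comm, Real.dist_eq] at this
    intro h
    exact hcon ⟨τ, h1, h2, h h1⟩
  -- `κ t` is an almost everywhere limit of `κ τₙ` at good times `τₙ` tending to `t`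
  choose τ hτ hτt hτm hτb using hex
  have hlim : Tendsto (fun n => C * |t - τ n| ^ η) atTop (𝓝 0) := by
    have h1 : Tendsto (fun n => |t - τ n|) atTop (𝓝 0) :=
      squeeze_zero (fun n => abs_nonneg _) (fun n => (hτt n).le)
        tendsto_one_div_add_atTop_nhds_zero_nat
    have h2 := ((Real.continuousAt_rpow_const 0 η (Or.inr hη.le)).tendsto.comp h1).const_mul C
    rwa [Real.zero_rpow hη.ne', mul_zero] at h2
  have hae : ∀ᵐ q ∂ρ, Tendsto (fun n => κ (τ n) q) atTop (𝓝 (κ t q)) := by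
    have : ∀ᵐ q ∂ρ, ∀ n, |κ t q - κ (τ n) q| ≤ C * |t - τ n| ^ η :=
      ae_all_iff.2 fun n => hC t ht (τ n) (hτ n)
    filter_upwards [this] with q hq
    rw [tendsto_iff_dist_tendsto_zero]
    refine squeeze_zero (fun n => dist_nonneg) (fun n => ?_) hlim
    rw [dist_comm, Real.dist_eq]
    exact hq n
  refine ⟨aemeasurable_of_tendsto_metrizable_ae atTop hτm hae, ?_⟩
  filter_upwards [hae, ae_all_iff.2 hτb] with q hq hqb
  exact ⟨ge_of_tendsto' hq fun n => (hqb n).1, le_of_tendsto' hq fun n => (hqb n).2⟩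

end Coefficients

/-! ### Riesz operators built from multiplication operators -/

section WeightedGram

open ContinuousLinearMap

variable {V F₁ F₂ F₃ : Type*} [NormedAddCommGroup V] [InnerProductSpace ℂ V] [CompleteSpace V]
  [NormedAddCommGroup F₁] [InnerProductSpace ℂ F₁] [CompleteSpace F₁]
  [NormedAddCommGroup F₂] [InnerProductSpace ℂ F₂] [CompleteSpace F₂]
  [NormedAddCommGroup F₃] [InnerProductSpace ℂ F₃] [CompleteSpace F₃]
  {P : V →L[ℂ] F₁} {R : V →L[ℂ] F₂} {Q : V →L[ℂ] F₃} {r : ℝ}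
  {M₁ M₁' : F₁ →L[ℂ] F₁} {M₂ M₂' : F₂ →L[ℂ] F₂} {M₃ M₃' : F₃ →L[ℂ] F₃}

/-- The Riesz operator of the form `(u, w) ↦ r ⟪P w, M₁ P u⟫ + ⟪R w, M₂ R u⟫ + ⟪Q w, M₃ Q u⟫`. -/
def weightedGram (r : ℝ) (P : V →L[ℂ] F₁) (R : V →L[ℂ] F₂) (Q : V →L[ℂ] F₃)
    (M₁ : F₁ →L[ℂ] F₁) (M₂ : F₂ →L[ℂ] F₂) (M₃ : F₃ →L[ℂ] F₃) : V →L[ℂ] V :=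
  (r : ℂ) • (adjoint P ∘L M₁ ∘L P) + adjoint R ∘L M₂ ∘L R + adjoint Q ∘L M₃ ∘L Q

theorem inner_weightedGram (u w : V) : inner ℂ w (weightedGram r P R Q M₁ M₂ M₃ u) =
    r * inner ℂ (P w) (M₁ (P u)) + inner ℂ (R w) (M₂ (R u)) + inner ℂ (Q w) (M₃ (Q u)) := by
  simp only [weightedGram, _root_.add_apply, _root_.smul_apply, comp_apply, inner_add_right,
    inner_smul_right, adjoint_inner_right]

theorem weightedGram_sub : weightedGram r P R Q M₁ M₂ M₃ - weightedGram r P R Q M₁' M₂' M₃' =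
    weightedGram r P R Q (M₁ - M₁') (M₂ - M₂') (M₃ - M₃') := by
  ext1 u
  simp only [weightedGram, _root_.add_apply, _root_.sub_apply, _root_.smul_apply, comp_apply,
    map_sub, smul_sub]
  abel

theorem norm_adjoint_comp_comp_le (P : V →L[ℂ] F₁) (M : F₁ →L[ℂ] F₁) :
    ‖adjoint P ∘L M ∘L P‖ ≤ ‖P‖ ^ 2 * ‖M‖ := by
  calc _ ≤ ‖adjoint P‖ * (‖M‖ * ‖P‖) := (opNorm_comp_le _ _).trans
        (mul_le_mul_of_nonneg_left (opNorm_comp_le _ _) (norm_nonneg _))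
    _ = _ := by
      rw [LinearIsometryEquiv.norm_map]
      ring

variable (r P R Q) in
theorem exists_norm_weightedGram_le : ∃ C : ℝ, 0 < C ∧ ∀ M₁ M₂ M₃,
    ‖weightedGram r P R Q M₁ M₂ M₃‖ ≤ C * (‖M₁‖ + ‖M₂‖ + ‖M₃‖) := by
  refine ⟨‖(r : ℂ)‖ * ‖P‖ ^ 2 + ‖R‖ ^ 2 + ‖Q‖ ^ 2 + 1, by positivity, fun M₁ M₂ M₃ => ?_⟩
  have h1 : ‖(r : ℂ) • (adjoint P ∘L M₁ ∘L P)‖ ≤ ‖(r : ℂ)‖ * (‖P‖ ^ 2 * ‖M₁‖) := by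
    rw [norm_smul]
    exact mul_le_mul_of_nonneg_left (norm_adjoint_comp_comp_le P M₁) (norm_nonneg _)
  have h2 := norm_adjoint_comp_comp_le R M₂
  have h3 := norm_adjoint_comp_comp_le Q M₃
  have h4 : ‖weightedGram r P R Q M₁ M₂ M₃‖ ≤ ‖(r : ℂ) • (adjoint P ∘L M₁ ∘L P)‖ +
      ‖adjoint R ∘L M₂ ∘L R‖ + ‖adjoint Q ∘L M₃ ∘L Q‖ := norm_add₃_le
  have a1 : 0 ≤ ‖(r : ℂ)‖ * ‖P‖ ^ 2 := by positivity
  have a2 : 0 ≤ ‖R‖ ^ 2 := by positivity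
  have a3 : 0 ≤ ‖Q‖ ^ 2 := by positivity
  have m1 := norm_nonneg M₁
  have m2 := norm_nonneg M₂
  have m3 := norm_nonneg M₃
  nlinarith [mul_nonneg a1 m2, mul_nonneg a1 m3, mul_nonneg a2 m1, mul_nonneg a2 m3,
    mul_nonneg a3 m1, mul_nonneg a3 m2]

theorem isSelfAdjoint_weightedGram (h₁ : ∀ f g, inner ℂ (M₁ g) f = inner ℂ g (M₁ f))
    (h₂ : ∀ f g, inner ℂ (M₂ g) f = inner ℂ g (M₂ f))
    (h₃ : ∀ f g, inner ℂ (M₃ g) f = inner ℂ g (M₃ f)) :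
    IsSelfAdjoint (weightedGram r P R Q M₁ M₂ M₃) := by
  rw [isSelfAdjoint_iff_isSymmetric]
  intro u w
  change inner ℂ (weightedGram r P R Q M₁ M₂ M₃ u) w = inner ℂ u (weightedGram r P R Q M₁ M₂ M₃ w)
  rw [← inner_conj_symm, inner_weightedGram, inner_weightedGram]
  simp only [map_add, map_mul, Complex.conj_ofReal, inner_conj_symm, h₁, h₂, h₃]

theorem isCoerciveRiesz_weightedGram {a₁ a₂ a₃ C : ℝ} (hr : 0 < r)
    (ha₁ : 0 < a₁) (ha₂ : 0 < a₂) (ha₃ : 0 < a₃)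
    (h₁ : ∀ f g, inner ℂ (M₁ g) f = inner ℂ g (M₁ f))
    (h₂ : ∀ f g, inner ℂ (M₂ g) f = inner ℂ g (M₂ f))
    (h₃ : ∀ f g, inner ℂ (M₃ g) f = inner ℂ g (M₃ f))
    (hl₁ : ∀ f, a₁ * ‖f‖ ^ 2 ≤ (inner ℂ f (M₁ f)).re)
    (hl₂ : ∀ f, a₂ * ‖f‖ ^ 2 ≤ (inner ℂ f (M₂ f)).re)
    (hl₃ : ∀ f, a₃ * ‖f‖ ^ 2 ≤ (inner ℂ f (M₃ f)).re) (hC : 0 < C)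
    (hcoer : ∀ u, ‖u‖ ^ 2 ≤ C * (‖P u‖ ^ 2 + ‖R u‖ ^ 2 + ‖Q u‖ ^ 2)) :
    IsCoerciveRiesz (min (r * a₁) (min a₂ a₃) / C) (weightedGram r P R Q M₁ M₂ M₃) := by
  have hm : 0 < min (r * a₁) (min a₂ a₃) := by positivity
  refine ⟨by positivity, isSelfAdjoint_weightedGram h₁ h₂ h₃, fun u => ?_⟩
  set m := min (r * a₁) (min a₂ a₃)
  have m1 : m ≤ r * a₁ := min_le_left _ _
  have m2 : m ≤ a₂ := (min_le_right _ _).trans (min_le_left _ _)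
  have m3 : m ≤ a₃ := (min_le_right _ _).trans (min_le_right _ _)
  rw [inner_weightedGram, Complex.add_re, Complex.add_re, Complex.re_ofReal_mul]
  calc m / C * ‖u‖ ^ 2 ≤ m / C * (C * (‖P u‖ ^ 2 + ‖R u‖ ^ 2 + ‖Q u‖ ^ 2)) :=
        mul_le_mul_of_nonneg_left (hcoer u) (by positivity)
    _ = m * ‖P u‖ ^ 2 + m * ‖R u‖ ^ 2 + m * ‖Q u‖ ^ 2 := by
        field_simp
    _ ≤ r * (a₁ * ‖P u‖ ^ 2) + a₂ * ‖R u‖ ^ 2 + a₃ * ‖Q u‖ ^ 2 := by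
        rw [← mul_assoc]
        gcongr
    _ ≤ _ := by
        gcongr
        · exact hl₁ _
        · exact hl₂ _
        · exact hl₃ _

end WeightedGram

/-! ### The energy form on the form domain -/

section RieszOperators

open ContinuousLinearMap

variable {N : ℕ} {a d s : ℝ} {Ω : Set (EuclideanSpace ℝ (Fin N))}
  {μ ν : Measure (EuclideanSpace ℝ (Fin N))} {c v r₀ k : ℝ}

/-- The identity as an operator from `L²(P)` to `L²(ν)`, where `ν ≤ P`. -/
def LpOfMeasureLE {X : Type*} [MeasurableSpace X] {ν P : Measure X} (h : ν ≤ P) :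
    Lp ℂ 2 P →L[ℂ] Lp ℂ 2 ν :=
  LinearMap.mkContinuous
    { toFun := fun f => ((Lp.memLp f).mono_measure h).toLp f
      map_add' := by
        intro f g
        rw [← MemLp.toLp_add]
        exact MemLp.toLp_congr _ _ (ae_mono h (Lp.coeFn_add f g))
      map_smul' := by
        intro z f
        rw [RingHom.id_apply, ← MemLp.toLp_const_smul]
        exact MemLp.toLp_congr _ _ (ae_mono h (Lp.coeFn_smul z f)) } 1 (by
    intro f
    rw [one_mul]
    change ‖((Lp.memLp f).mono_measure h).toLp f‖ ≤ ‖f‖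
    rw [Lp.norm_toLp, Lp.norm_def]
    exact ENNReal.toReal_mono (Lp.eLpNorm_ne_top f) (eLpNorm_mono_measure _ h))

theorem LpOfMeasureLE_ae_eq {X : Type*} [MeasurableSpace X] {ν P : Measure X} (h : ν ≤ P)
    (f : Lp ℂ 2 P) : LpOfMeasureLE h f =ᵐ[ν] f :=
  ((Lp.memLp f).mono_measure h).coeFn_toLp

theorem lintegral_enorm_sq_of_ae_eq {X : Type*} [MeasurableSpace X] {P : Measure X}
    {f : Lp ℂ 2 P} {g : X → ℂ} (h : f =ᵐ[P] g) : ∫⁻ x, ‖g x‖ₑ ^ 2 ∂P = ‖f‖ₑ ^ 2 := by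
  rw [Lp_enorm_sq_eq]
  refine lintegral_congr_ae ?_
  filter_upwards [h] with x hx
  rw [hx]

theorem norm_sq_le_of_enorm_sq_le {E₁ E₂ E₃ : Type*} [SeminormedAddCommGroup E₁]
    [SeminormedAddCommGroup E₂] [SeminormedAddCommGroup E₃] {x : E₁} {y : E₂} {z : E₃} {C : ℝ≥0∞}
    (hC : C ≠ ∞) (h : ‖x‖ₑ ^ 2 ≤ C * (‖y‖ₑ ^ 2 + ‖z‖ₑ ^ 2) + ‖z‖ₑ ^ 2) :
    ‖x‖ ^ 2 ≤ C.toReal * (‖y‖ ^ 2 + ‖z‖ ^ 2) + ‖z‖ ^ 2 := by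
  have hfin : C * (‖y‖ₑ ^ 2 + ‖z‖ₑ ^ 2) ≠ ∞ := by finiteness
  have := ENNReal.toReal_mono (by finiteness) h
  rw [ENNReal.toReal_add hfin (by finiteness), ENNReal.toReal_mul,
    ENNReal.toReal_add (by finiteness) (by finiteness)] at this
  simpa only [ENNReal.toReal_pow, toReal_enorm] using this

theorem IsMultiplier.integrable_and_inner_eq {X : Type*} [MeasurableSpace X] {P : Measure X}
    {κ : X → ℝ} {M : Lp ℂ 2 P →L[ℂ] Lp ℂ 2 P} (h : IsMultiplier κ M) {f g : Lp ℂ 2 P}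
    {u w F : X → ℂ} (hf : f =ᵐ[P] u) (hg : g =ᵐ[P] w)
    (hF : ∀ x, (κ x : ℂ) * (u x * conj (w x)) = F x) :
    Integrable F P ∧ inner ℂ g (M f) = ∫ x, F x ∂P := by
  have e : (fun x => (κ x : ℂ) * (f x * conj (g x))) =ᵐ[P] F := by
    filter_upwards [hf, hg] with x h1 h2
    rw [h1, h2, hF]
  exact ⟨(h.integrable f g).congr e, (h.inner_eq f g).trans (integral_congr_ae e)⟩

theorem diffQuot_mul_conj_diffQuot (κ : EuclideanSpace ℝ (Fin N) → EuclideanSpace ℝ (Fin N) → ℝ)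
    (u w : EuclideanSpace ℝ (Fin N) → ℂ)
    (p : EuclideanSpace ℝ (Fin N) × EuclideanSpace ℝ (Fin N)) :
    (κ p.1 p.2 : ℂ) * (diffQuot a u p * conj (diffQuot a w p)) = nonlocalIntegrand a κ u w p := by
  have e : dist p.1 p.2 ^ (a / 2) * dist p.1 p.2 ^ (a / 2) = dist p.1 p.2 ^ a := by
    rw [← sq, ← Real.rpow_mul_natCast dist_nonneg]
    congr 1
    push_cast
    ring
  unfold diffQuot nonlocalIntegrand
  rw [← e, map_div₀, Complex.conj_ofReal, div_mul_div_comm, mul_div_assoc', Complex.ofReal_mul]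

theorem fracLaplaceConst_pos (hN : 0 < N) (hs : 0 < s) (hs1 : s < 1) :
    0 < fracLaplaceConst N s := by
  have h1 : 0 < Real.Gamma (((N : ℝ) + 2 * s) / 2) := Real.Gamma_pos_of_pos (by positivity)
  have h2 : 0 < Real.Gamma (1 - s) := Real.Gamma_pos_of_pos (by linarith)
  unfold fracLaplaceConst
  positivity

/-- The trace theorem for elements of `H^s(Ω)`, in terms of elements of `L²` representing the
difference quotient and the boundary values. -/
theorem TraceGeometry.exists_norm_sq_le (hG : TraceGeometry d Ω μ c v r₀ k)
    (hs : 0 < s) (hd : 0 < d) (hβ : 0 < 2 * s - (N : ℝ) + d) : ∃ C : ℝ, 0 ≤ C ∧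
      ∀ (U : BulkBoundaryL2 Ω μ) (P : Lp ℂ 2 ((volume.restrict Ω).prod (volume.restrict Ω)))
        (R : Lp ℂ 2 μ), U ∈ hsSubspace s Ω μ →
      P =ᵐ[(volume.restrict Ω).prod (volume.restrict Ω)] diffQuot ((N : ℝ) + 2 * s) U →
      R =ᵐ[μ] U → ‖U‖ ^ 2 ≤ C * (‖P‖ ^ 2 + ‖R‖ ^ 2) + ‖R‖ ^ 2 := by
  obtain ⟨C, hC, hbd⟩ := hG.exists_trace_bounds hs hd hβ
  refine ⟨C.toReal, ENNReal.toReal_nonneg, fun U P R hU hP hR => norm_sq_le_of_enorm_sq_le hC ?_⟩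
  obtain ⟨-, h2, -⟩ := hbd U U hU.1
    ((Lp.aestronglyMeasurable U).mono_measure (le_bulkBoundary Ω μ)) hU.2
  rw [lintegral_enorm_sq_of_ae_eq hP, lintegral_enorm_sq_of_ae_eq hR] at h2
  refine (Lp_enorm_sq_eq U).le.trans ((lintegral_add_measure _ _ _).le.trans ?_)
  exact add_le_add h2 (lintegral_enorm_sq_of_ae_eq hR).le

theorem energyConverges_and_energyForm_eq [SFinite μ]
    {MK : Lp ℂ 2 ((volume.restrict Ω).prod (volume.restrict Ω)) →L[ℂ]
      Lp ℂ 2 ((volume.restrict Ω).prod (volume.restrict Ω))}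
    {Mb : Lp ℂ 2 μ →L[ℂ] Lp ℂ 2 μ} {Mζ : Lp ℂ 2 (μ.prod μ) →L[ℂ] Lp ℂ 2 (μ.prod μ)}
    {K ζ : EuclideanSpace ℝ (Fin N) → EuclideanSpace ℝ (Fin N) → ℝ}
    {b : EuclideanSpace ℝ (Fin N) → ℝ} (hMK : IsMultiplier (fun p => K p.1 p.2) MK)
    (hMb : IsMultiplier b Mb) (hMζ : IsMultiplier (fun p => ζ p.1 p.2) Mζ)
    {u w : EuclideanSpace ℝ (Fin N) → ℂ}
    {P P' : Lp ℂ 2 ((volume.restrict Ω).prod (volume.restrict Ω))} {R R' : Lp ℂ 2 μ}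
    {Q Q' : Lp ℂ 2 (μ.prod μ)}
    (hP : P =ᵐ[(volume.restrict Ω).prod (volume.restrict Ω)] diffQuot ((N : ℝ) + 2 * s) u)
    (hP' : P' =ᵐ[(volume.restrict Ω).prod (volume.restrict Ω)] diffQuot ((N : ℝ) + 2 * s) w)
    (hR : R =ᵐ[μ] u) (hR' : R' =ᵐ[μ] w)
    (hQ : Q =ᵐ[μ.prod μ] diffQuot (d + 2 * besovExponent N s d) u)
    (hQ' : Q' =ᵐ[μ.prod μ] diffQuot (d + 2 * besovExponent N s d) w) :
    EnergyConverges s d Ω μ K ζ b u w ∧ energyForm s d Ω μ K ζ b u w =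
      ((fracLaplaceConst N s / 2 : ℝ) : ℂ) * inner ℂ P' (MK P) + inner ℂ R' (Mb R) +
        inner ℂ Q' (Mζ Q) := by
  obtain ⟨i1, e1⟩ := hMK.integrable_and_inner_eq hP hP' (diffQuot_mul_conj_diffQuot K _ _)
  obtain ⟨i2, e2⟩ := hMb.integrable_and_inner_eq hR hR' (F := potentialIntegrand b _ _)
    fun _ => rfl
  obtain ⟨i3, e3⟩ := hMζ.integrable_and_inner_eq hQ hQ' (diffQuot_mul_conj_diffQuot ζ _ _)
  refine ⟨⟨i1, i2, i3⟩, ?_⟩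
  rw [e1, e2, e3, energyForm]

variable [SFinite μ]

/-- The boundary values as an operator from the form domain to `L²(∂Ω, μ)`. -/
def boundaryValue (s d : ℝ) (Ω : Set (EuclideanSpace ℝ (Fin N)))
    (μ : Measure (EuclideanSpace ℝ (Fin N))) [SFinite μ] : formDomain s d Ω μ →L[ℂ] Lp ℂ 2 μ :=
  LpOfMeasureLE (le_bulkBoundary Ω μ) ∘L formEmbedding s d Ω μ

theorem boundaryValue_ae_eq (ω : formDomain s d Ω μ) :
    boundaryValue s d Ω μ ω =ᵐ[μ] formEmbedding s d Ω μ ω :=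
  LpOfMeasureLE_ae_eq (le_bulkBoundary Ω μ) _

/-- The difference quotients and the boundary values control the norm of the form domain. -/
theorem TraceGeometry.exists_norm_sq_formDomain_le (hG : TraceGeometry d Ω μ c v r₀ k)
    (hs : 0 < s) (hd : 0 < d) (hβ : 0 < 2 * s - (N : ℝ) + d) : ∃ C : ℝ, 0 < C ∧
      ∀ ω : formDomain s d Ω μ, ‖ω‖ ^ 2 ≤ C * (‖bulkQuotient s d Ω μ ω‖ ^ 2 +
        ‖boundaryValue s d Ω μ ω‖ ^ 2 + ‖boundaryQuotient s d Ω μ ω‖ ^ 2) := by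
  obtain ⟨C, hC, hbd⟩ := hG.exists_norm_sq_le hs hd hβ
  refine ⟨C + 1, by positivity, fun ω => ?_⟩
  have h1 := hbd _ _ _ (formEmbedding_mem ω) (bulkQuotient_ae_eq ω) (boundaryValue_ae_eq ω)
  have h2 := norm_sq_formDomain ω
  have h3 := mul_nonneg hC (sq_nonneg ‖boundaryQuotient s d Ω μ ω‖)
  linarith

theorem TraceGeometry.isCompleteSpace_formDomain (hG : TraceGeometry d Ω μ c v r₀ k)
    (hs : 0 < s) (hd : 0 < d) (hβ : 0 < 2 * s - (N : ℝ) + d) :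
    CompleteSpace (formDomain s d Ω μ) :=
  (hG.isClosed_formDomain hs hd hβ).completeSpace_coe

end RieszOperators

/-! ### Sectoriality, fractional powers and dependence on the form -/

section FormOperator

open ContinuousLinearMap

variable {H V : Type*} [NormedAddCommGroup H] [InnerProductSpace ℂ H] {A : H →ₗ.[ℂ] H}

theorem neg_mem_graph_iff {R : H →L[ℂ] H} (hA : ∀ u f, (u, f) ∈ A.graph ↔ u = -R f) (u f : H) :
    (u, f) ∈ (-A).graph ↔ u = R f := by
  have : (u, f) ∈ (-A).graph ↔ (u, -f) ∈ A.graph := by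
    simp only [LinearPMap.mem_graph_iff]
    constructor
    · rintro ⟨y, hy, hf⟩
      exact ⟨y, hy, by rw [← hf]; simp⟩
    · rintro ⟨y, hy, hf⟩
      exact ⟨y, hy, by rw [LinearPMap.neg_apply, hf, neg_neg]⟩
  rw [this, hA, map_neg, neg_neg]

theorem isBoundedInverse_shiftSub_zero_neg {R : H →L[ℂ] H} (h : IsBoundedInverse A R) :
    IsBoundedInverse (shiftSub 0 (-A)) R := by
  have e : ∀ u : A.domain, shiftSub 0 (-A) u = A u := by
    intro u
    change (0 : ℂ) • (u : H) - (-A) u = A u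
    rw [zero_smul, LinearPMap.neg_apply, zero_sub, neg_neg]
  refine ⟨fun f => ?_, fun u => ?_⟩
  · obtain ⟨u, hu, hf⟩ := h.1 f
    exact ⟨u, hu, (e u).trans hf⟩
  · exact (congrArg R (e u)).trans (h.2 u)

variable [NormedAddCommGroup V] [InnerProductSpace ℂ V] [CompleteSpace H] [CompleteSpace V]
  {c k : ℝ} {T T' : V →L[ℂ] V} {J : V →L[ℂ] H}

/-- The weak formulation of `A u = f` for the operator `A` associated with a coercive form. -/
theorem IsCoerciveRiesz.forall_inner_eq_iff (h : IsCoerciveRiesz c T) (hJ : Function.Injective J)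
    {u : V} {f : H} : (∀ w, inner ℂ w (T u) = inner ℂ (J w) (-f)) ↔ J u = -formInverse J T f := by
  have e : -formInverse J T f = J (Ring.inverse T (adjoint J (-f))) := by
    simp [formInverse]
  rw [e, hJ.eq_iff]
  constructor
  · intro hu
    have : T u = adjoint J (-f) :=
      ext_inner_left ℂ fun w => (hu w).trans (adjoint_inner_right J w (-f)).symm
    rw [← this, h.inverse_apply]
  · rintro rfl w
    rw [h.apply_inverse, adjoint_inner_right]

/-- The operator `A` is given by the form with Riesz operator `T`: its inverse is `-J T⁻¹ J*`. -/
def IsFormOperator (J : V →L[ℂ] H) (T : V →L[ℂ] V) (A : H →ₗ.[ℂ] H) : Prop :=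
  ∀ u f, (u, f) ∈ A.graph ↔ u = -formInverse J T f

namespace IsFormOperator

theorem isBoundedInverse (hA : IsFormOperator J T A) : IsBoundedInverse A (-formInverse J T) :=
  IsBoundedInverse.of_mem_graph_iff hA

theorem isBoundedInverse_neg (hA : IsFormOperator J T A) :
    IsBoundedInverse (-A) (formInverse J T) :=
  IsBoundedInverse.of_mem_graph_iff (neg_mem_graph_iff hA)

theorem sectorial (hA : IsFormOperator J T A) (h : IsCoerciveRiesz c T) :
    opSpectrum (-A) ⊆ openSector (Real.pi / 4) ∧
      (∀ z : ℂ, z ∉ openSector (Real.pi / 4) → z ≠ 0 →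
        HasBoundedInverse (shiftSub z (-A)) ∧
          ‖boundedInverse (shiftSub z (-A))‖ ≤ 3 / ‖z‖) ∧
      HasBoundedInverse A ∧ ‖boundedInverse A‖ ≤ ‖J‖ * (c⁻¹ * ‖J‖) := by
  have hres : ∀ z : ℂ, z ∉ openSector (Real.pi / 4) → z ≠ 0 →
      HasBoundedInverse (shiftSub z (-A)) ∧
        ‖boundedInverse (shiftSub z (-A))‖ ≤ 3 / ‖z‖ := by
    intro z hz hz0
    obtain ⟨S, hS, hb⟩ := exists_resolvent (neg_mem_graph_iff hA) h.formInverse_isPositive hz hz0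
    exact ⟨⟨S, hS⟩, by rwa [hS.boundedInverse_eq]⟩
  refine ⟨fun z hz => ?_, hres, ⟨_, hA.isBoundedInverse⟩, ?_⟩
  · by_contra hzs
    rcases eq_or_ne z 0 with rfl | hz0
    · exact hz ⟨_, isBoundedInverse_shiftSub_zero_neg hA.isBoundedInverse⟩
    · exact hz (hres z hzs hz0).1
  · rw [hA.isBoundedInverse.boundedInverse_eq, norm_neg]
    refine (opNorm_comp_le _ _).trans (mul_le_mul_of_nonneg_left ?_ (norm_nonneg _))
    refine (opNorm_comp_le _ _).trans ?_
    rw [LinearIsometryEquiv.norm_map]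
    exact mul_le_mul_of_nonneg_right h.norm_inverse_le (norm_nonneg _)

theorem domain_le_range (hA : IsFormOperator J T A) :
    A.domain ≤ LinearMap.range (J : V →ₗ[ℂ] H) := by
  intro u hu
  obtain ⟨f, hf⟩ := LinearPMap.mem_domain_iff.1 hu
  rw [hA] at hf
  rw [hf]
  exact Submodule.neg_mem _ ⟨_, rfl⟩

theorem domain_fracPower_half (hA : IsFormOperator J T A) (h : IsCoerciveRiesz c T)
    (hJ : Function.Injective J) (hJ' : DenseRange J) :
    (fracPower (-A) (1 / 2)).domain = LinearMap.range (J : V →ₗ[ℂ] H) := by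
  rw [fracPower_domain hA.isBoundedInverse_neg, h.range_sqrt_formInverse hJ hJ']

theorem domain_fracPower_half_le (hA : IsFormOperator J T A) {ν : ℝ} (h0 : 0 < ν)
    (h1 : ν ≤ 1 / 2) : (fracPower (-A) (1 / 2)).domain ≤ (fracPower (-A) ν).domain := by
  rw [fracPower_domain hA.isBoundedInverse_neg, fracPower_domain hA.isBoundedInverse_neg]
  exact range_rpow_half_le h0 h1

/-- With `R = J T⁻¹ J*` and `J = R^(1/2) Z`, the operator `Z (T'⁻¹ - T⁻¹) J*` extends
`(-A)^(1/2) (A⁻¹ - A'⁻¹)`. -/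
theorem exists_sqrt_inverse_sub_inverse {A' : H →ₗ.[ℂ] H} (hA : IsFormOperator J T A)
    (hA' : IsFormOperator J T' A') (h : IsCoerciveRiesz c T) (h' : IsCoerciveRiesz c T')
    (hJ : Function.Injective J) (hJ' : DenseRange J) (hk : ‖T‖ ≤ k) :
    ∃ B : H →L[ℂ] H, (∀ f, ∃ g : (fracPower (-A) (1 / 2)).domain,
      (g : H) = (boundedInverse A - boundedInverse A') f ∧ fracPower (-A) (1 / 2) g = B f) ∧
      ‖B‖ ≤ k / Real.sqrt c * (c⁻¹ * ‖T - T'‖ * c⁻¹ * ‖J‖) := by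
  obtain ⟨Z, hZ, hZk⟩ := h.exists_sqrt_comp_eq hJ hJ' hk
  have hk0 : 0 ≤ k := (norm_nonneg _).trans hk
  refine ⟨Z ∘L (Ring.inverse T' - Ring.inverse T) ∘L adjoint J, fun f => ?_, ?_⟩
  · set x := Z ((Ring.inverse T' - Ring.inverse T) (adjoint J f))
    have hx : (formInverse J T ^ (1 / 2 : ℝ)) x =
        (boundedInverse A - boundedInverse A') f := by
      rw [hA.isBoundedInverse.boundedInverse_eq, hA'.isBoundedInverse.boundedInverse_eq]
      have e := congrArg (fun F : V →L[ℂ] H => F ((Ring.inverse T' - Ring.inverse T)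
        (adjoint J f))) hZ
      refine e.trans ?_
      simp only [formInverse, _root_.sub_apply, _root_.neg_apply, comp_apply, map_sub]
      abel
    have hmem : (boundedInverse A - boundedInverse A') f ∈ (fracPower (-A) (1 / 2)).domain := by
      rw [fracPower_domain hA.isBoundedInverse_neg]
      exact ⟨x, hx⟩
    exact ⟨⟨_, hmem⟩, rfl, fracPower_apply hA.isBoundedInverse_neg
      (injective_rpow_half h.formInverse_nonneg (h.formInverse_injective hJ hJ')) _ x hx⟩
  · refine (opNorm_comp_le _ _).trans (mul_le_mul hZk ?_ (norm_nonneg _) (by positivity))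
    refine (opNorm_comp_le _ _).trans ?_
    rw [LinearIsometryEquiv.norm_map]
    exact mul_le_mul_of_nonneg_right (h.norm_inverse_sub_inverse_le h') (norm_nonneg _)

end IsFormOperator

end FormOperator

/-! ### Multiplication by admissible coefficients -/

section EnergyOperator

variable {N : ℕ} {d s T η : ℝ} {Ω : Set (EuclideanSpace ℝ (Fin N))}
  {μ : Measure (EuclideanSpace ℝ (Fin N))} {c v r₀ k : ℝ}

/-- An admissible kernel acts by multiplication, with bounds uniform in time and Hölder continuous
dependence on time. -/
theorem IsAdmissibleKernel.exists_multiplier {S : Set (EuclideanSpace ℝ (Fin N))}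
    {ν : Measure (EuclideanSpace ℝ (Fin N))} [SFinite ν] (hT : 0 < T) (hη : 0 < η)
    {κ : ℝ → EuclideanSpace ℝ (Fin N) → EuclideanSpace ℝ (Fin N) → ℝ}
    (hκ : IsAdmissibleKernel T η S ν κ) : ∃ k₁ k₂ C : ℝ, 0 < k₁ ∧ 0 ≤ C ∧
      ∃ M : ℝ → Lp ℂ 2 (ν.prod ν) →L[ℂ] Lp ℂ 2 (ν.prod ν), ∀ t ∈ Icc 0 T,
        IsMultiplier (fun p => κ t p.1 p.2) (M t) ∧ (∀ᵐ p ∂(ν.prod ν), k₁ ≤ κ t p.1 p.2) ∧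
        ‖M t‖ ≤ k₂ ∧ ∀ τ ∈ Icc 0 T, ‖M t - M τ‖ ≤ C * |t - τ| ^ η := by
  obtain ⟨k₁, k₂, hk₁, hk₁₂, hb⟩ := hκ.bounds
  obtain ⟨C, hC⟩ := hκ.holder
  have hall := fun t (ht : t ∈ Icc 0 T) => aemeasurable_and_bounds_of_holder
    (κ := fun t (q : EuclideanSpace ℝ (Fin N) × EuclideanSpace ℝ (Fin N)) => κ t q.1 q.2)
    hT hη hκ.aemeasurable hb hC ht
  have habs : ∀ t ∈ Icc 0 T, ∀ᵐ q ∂(ν.prod ν), |κ t q.1 q.2| ≤ k₂ := by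
    intro t ht
    filter_upwards [(hall t ht).2] with q hq
    rw [abs_of_nonneg (hk₁.le.trans hq.1)]
    exact hq.2
  have hex : ∀ t, ∃ M : Lp ℂ 2 (ν.prod ν) →L[ℂ] Lp ℂ 2 (ν.prod ν),
      t ∈ Icc 0 T → IsMultiplier (fun p => κ t p.1 p.2) M := by
    intro t
    by_cases ht : t ∈ Icc 0 T
    · obtain ⟨M, hM⟩ := exists_isMultiplier (hall t ht).1 (habs t ht)
      exact ⟨M, fun _ => hM⟩
    · exact ⟨0, fun h => absurd h ht⟩
  choose M hM using hex
  refine ⟨k₁, k₂, |C|, hk₁, abs_nonneg C, M, fun t ht => ⟨hM t ht, ?_, ?_, fun τ hτ => ?_⟩⟩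
  · filter_upwards [(hall t ht).2] with q hq using hq.1
  · exact (hM t ht).opNorm_le (hk₁.le.trans hk₁₂.le) (habs t ht)
  · refine ((hM t ht).sub (hM τ hτ)).opNorm_le (by positivity) ?_
    filter_upwards [hC t ht τ hτ] with q hq
    refine hq.trans ?_
    gcongr
    exact le_abs_self C

/-- An admissible potential acts by multiplication, with bounds uniform in time and Hölder
continuous dependence on time. The upper bound at every time comes from the essential bound in time
and space together with the Hölder continuity. -/
theorem IsAdmissiblePotential.exists_multiplier {S : Set (EuclideanSpace ℝ (Fin N))}
    {ν : Measure (EuclideanSpace ℝ (Fin N))} [SFinite ν] (hT : 0 < T) (hη : 0 < η)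
    (hS : ∀ᵐ x ∂ν, x ∈ S) {b : ℝ → EuclideanSpace ℝ (Fin N) → ℝ}
    (hb : IsAdmissiblePotential T η S ν b) : ∃ b₀ b₁ C : ℝ, 0 < b₀ ∧ 0 ≤ C ∧
      ∃ M : ℝ → Lp ℂ 2 ν →L[ℂ] Lp ℂ 2 ν, ∀ t ∈ Icc 0 T,
        IsMultiplier (b t) (M t) ∧ (∀ᵐ x ∂ν, b₀ ≤ b t x) ∧
        ‖M t‖ ≤ b₁ ∧ ∀ τ ∈ Icc 0 T, ‖M t - M τ‖ ≤ C * |t - τ| ^ η := by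
  obtain ⟨b₀, hb₀, hlow⟩ := hb.lower
  obtain ⟨C, hC⟩ := hb.holder
  set b₁ := (eLpNormEssSup (fun p : ℝ × EuclideanSpace ℝ (Fin N) => b p.1 p.2)
    ((volume.restrict (Icc 0 T)).prod ν)).toReal
  have hbd : ∀ᵐ p : ℝ × EuclideanSpace ℝ (Fin N) ∂((volume.restrict (Icc 0 T)).prod ν),
      -b₁ ≤ b p.1 p.2 ∧ b p.1 p.2 ≤ b₁ := by
    have hfin := hb.memLp_top.2
    rw [eLpNorm_exponent_top] at hfin
    filter_upwards [ae_le_eLpNormEssSup (f := fun p : ℝ × EuclideanSpace ℝ (Fin N) => b p.1 p.2)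
      (μ := (volume.restrict (Icc 0 T)).prod ν)] with p hp
    have := ENNReal.toReal_mono hfin.ne hp
    rw [toReal_enorm, Real.norm_eq_abs] at this
    exact abs_le.1 this
  have hC' : ∀ t ∈ Icc 0 T, ∀ τ ∈ Icc 0 T, ∀ᵐ x ∂ν, |b t x - b τ x| ≤ C * |t - τ| ^ η :=
    fun t ht τ hτ => hS.mono fun x hx => hC t ht τ hτ x hx
  have hall := fun t (ht : t ∈ Icc 0 T) => aemeasurable_and_bounds_of_holder hT hη
    hb.memLp_top.aestronglyMeasurable.aemeasurable hbd hC' ht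
  have habs : ∀ t ∈ Icc 0 T, ∀ᵐ x ∂ν, |b t x| ≤ b₁ := fun t ht =>
    (hall t ht).2.mono fun x hx => abs_le.2 hx
  have hex : ∀ t, ∃ M : Lp ℂ 2 ν →L[ℂ] Lp ℂ 2 ν, t ∈ Icc 0 T → IsMultiplier (b t) M := by
    intro t
    by_cases ht : t ∈ Icc 0 T
    · obtain ⟨M, hM⟩ := exists_isMultiplier (hall t ht).1 (habs t ht)
      exact ⟨M, fun _ => hM⟩
    · exact ⟨0, fun h => absurd h ht⟩
  choose M hM using hex
  refine ⟨b₀, b₁, |C|, hb₀, abs_nonneg C, M, fun t ht => ⟨hM t ht, ?_, ?_, fun τ hτ => ?_⟩⟩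
  · exact hS.mono fun x hx => (hlow t ht x hx).le
  · exact (hM t ht).opNorm_le ENNReal.toReal_nonneg (habs t ht)
  · refine ((hM t ht).sub (hM τ hτ)).opNorm_le (by positivity) ?_
    filter_upwards [hC' t ht τ hτ] with q hq
    refine hq.trans ?_
    gcongr
    exact le_abs_self C

end EnergyOperator

/-! ### The family of energy operators -/

section EnergyOperatorFamily

variable {N : ℕ} {d s T η : ℝ} {Ω : Set (EuclideanSpace ℝ (Fin N))}
  {μ : Measure (EuclideanSpace ℝ (Fin N))} {c v r₀ k : ℝ}
  {V : Type*} [NormedAddCommGroup V] [InnerProductSpace ℂ V]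

/-- `V` is a model of the form domain `H^s(Ω)`, embedded into `L²(Ω, m)` by `J`, with the
difference quotients `P` on `Ω × Ω` and `Q` on `∂Ω × ∂Ω` and the boundary values `R`. -/
structure IsFormSpace (s d : ℝ) (Ω : Set (EuclideanSpace ℝ (Fin N)))
    (μ : Measure (EuclideanSpace ℝ (Fin N))) [SFinite μ] (J : V →L[ℂ] BulkBoundaryL2 Ω μ)
    (P : V →L[ℂ] Lp ℂ 2 ((volume.restrict Ω).prod (volume.restrict Ω))) (R : V →L[ℂ] Lp ℂ 2 μ)
    (Q : V →L[ℂ] Lp ℂ 2 (μ.prod μ)) : Prop where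
  injective : Function.Injective J
  denseRange : DenseRange J
  range_eq : LinearMap.range (J : V →ₗ[ℂ] BulkBoundaryL2 Ω μ) = hsSubspace s Ω μ
  bulk : ∀ u, P u =ᵐ[(volume.restrict Ω).prod (volume.restrict Ω)]
    diffQuot ((N : ℝ) + 2 * s) (J u)
  value : ∀ u, R u =ᵐ[μ] J u
  boundary : ∀ u, Q u =ᵐ[μ.prod μ] diffQuot (d + 2 * besovExponent N s d) (J u)
  coercive : ∃ C : ℝ, 0 < C ∧ ∀ u, ‖u‖ ^ 2 ≤ C * (‖P u‖ ^ 2 + ‖R u‖ ^ 2 + ‖Q u‖ ^ 2)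

theorem TraceGeometry.isFormSpace_formDomain [Nontrivial (EuclideanSpace ℝ (Fin N))]
    [SFinite μ] (hG : TraceGeometry d Ω μ c v r₀ k) (hs : 0 < s) (hs1 : s < 1) (hd : 0 < d)
    (hβ : 0 < 2 * s - (N : ℝ) + d) :
    IsFormSpace (V := formDomain s d Ω μ) s d Ω μ (formEmbedding s d Ω μ) (bulkQuotient s d Ω μ)
      (boundaryValue s d Ω μ) (boundaryQuotient s d Ω μ) where
  injective := formEmbedding_injective
  denseRange := hG.denseRange_formEmbedding hs hs1 hd hβ
  range_eq := hG.range_formEmbedding hs hd hβ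
  bulk := bulkQuotient_ae_eq
  value := boundaryValue_ae_eq
  boundary := boundaryQuotient_ae_eq
  coercive := hG.exists_norm_sq_formDomain_le hs hd hβ

namespace IsFormSpace

variable [SFinite μ] [CompleteSpace V] {J : V →L[ℂ] BulkBoundaryL2 Ω μ}
  {P : V →L[ℂ] Lp ℂ 2 ((volume.restrict Ω).prod (volume.restrict Ω))} {R : V →L[ℂ] Lp ℂ 2 μ}
  {Q : V →L[ℂ] Lp ℂ 2 (μ.prod μ)}

/-- The forms at the different times have Riesz operators which are bounded and coercive uniformly
in time, and Hölder continuous in time. -/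
theorem exists_riesz_family (hV : IsFormSpace s d Ω μ J P R Q) (hN : 0 < N) (hs : 0 < s)
    (hs1 : s < 1) (hT : 0 < T) (hη : 0 < η) (hμ : ∀ᵐ x ∂μ, x ∈ frontier Ω)
    {K ζ : ℝ → EuclideanSpace ℝ (Fin N) → EuclideanSpace ℝ (Fin N) → ℝ}
    {b : ℝ → EuclideanSpace ℝ (Fin N) → ℝ}
    (hK : IsAdmissibleKernel T η Ω (volume.restrict Ω) K)
    (hζ : IsAdmissibleKernel T η (frontier Ω) μ ζ)
    (hb : IsAdmissiblePotential T η (frontier Ω) μ b) :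
    ∃ (γ κ L : ℝ) (F : ℝ → V →L[ℂ] V), 0 < γ ∧ 0 ≤ κ ∧ 0 ≤ L ∧
      ∀ t ∈ Icc 0 T, IsCoerciveRiesz γ (F t) ∧ ‖F t‖ ≤ κ ∧
        (∀ u w, EnergyConverges s d Ω μ (K t) (ζ t) (b t) (J u) (J w) ∧
          energyForm s d Ω μ (K t) (ζ t) (b t) (J u) (J w) = inner ℂ w (F t u)) ∧
        ∀ τ ∈ Icc 0 T, ‖F t - F τ‖ ≤ L * |t - τ| ^ η := by
  obtain ⟨k₁, k₂, CK, hk₁, hCK, MK, hMK⟩ := hK.exists_multiplier hT hη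
  obtain ⟨ζ₁, ζ₂, Cζ, hζ₁, hCζ, Mζ, hMζ⟩ := hζ.exists_multiplier hT hη
  obtain ⟨b₀, b₁, Cb, hb₀, hCb, Mb, hMb⟩ := hb.exists_multiplier hT hη hμ
  obtain ⟨C, hC, hcoer⟩ := hV.coercive
  obtain ⟨D, hD, hnorm⟩ := exists_norm_weightedGram_le P R Q (fracLaplaceConst N s / 2)
  have h0 : (0 : ℝ) ∈ Icc 0 T := ⟨le_rfl, hT.le⟩
  have hk₂ : 0 ≤ k₂ := (norm_nonneg _).trans (hMK 0 h0).2.2.1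
  have hb₁ : 0 ≤ b₁ := (norm_nonneg _).trans (hMb 0 h0).2.2.1
  have hζ₂ : 0 ≤ ζ₂ := (norm_nonneg _).trans (hMζ 0 h0).2.2.1
  have hc := fracLaplaceConst_pos hN hs hs1
  refine ⟨min (fracLaplaceConst N s / 2 * k₁) (min b₀ ζ₁) / C, D * (k₂ + b₁ + ζ₂),
    D * (CK + Cb + Cζ), fun t => weightedGram (fracLaplaceConst N s / 2) P R Q (MK t) (Mb t) (Mζ t),
    by positivity, by positivity, by positivity, fun t ht => ?_⟩
  obtain ⟨mK, lK, nK, holK⟩ := hMK t ht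
  obtain ⟨mb, lb, nb, holb⟩ := hMb t ht
  obtain ⟨mζ, lζ, nζ, holζ⟩ := hMζ t ht
  refine ⟨?_, ?_, fun u w => ?_, fun τ hτ => ?_⟩
  · exact isCoerciveRiesz_weightedGram (half_pos hc) hk₁ hb₀ hζ₁ mK.inner_left_eq mb.inner_left_eq
      mζ.inner_left_eq (mK.le_re_inner lK) (mb.le_re_inner lb) (mζ.le_re_inner lζ) hC hcoer
  · refine (hnorm _ _ _).trans ?_
    gcongr
  · rw [inner_weightedGram]
    exact energyConverges_and_energyForm_eq mK mb mζ (hV.bulk u) (hV.bulk w) (hV.value u)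
      (hV.value w) (hV.boundary u) (hV.boundary w)
  · rw [weightedGram_sub]
    refine (hnorm _ _ _).trans ?_
    rw [mul_assoc, add_mul, add_mul]
    gcongr
    · exact holK τ hτ
    · exact holb τ hτ
    · exact holζ τ hτ

/-- The operator associated with the energy form is the operator associated with its Riesz operator
on the form domain; in particular its graph is that of a single-valued operator. -/
theorem isFormOperator_energyOperator (hV : IsFormSpace s d Ω μ J P R Q)
    {K ζ : EuclideanSpace ℝ (Fin N) → EuclideanSpace ℝ (Fin N) → ℝ}
    {b : EuclideanSpace ℝ (Fin N) → ℝ} {γ : ℝ} {F : V →L[ℂ] V} (hF : IsCoerciveRiesz γ F)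
    (hE : ∀ u w, EnergyConverges s d Ω μ K ζ b (J u) (J w) ∧
      energyForm s d Ω μ K ζ b (J u) (J w) = inner ℂ w (F u)) :
    IsFormOperator J F (energyOperator s d Ω μ K ζ b) := by
  have hmem : ∀ u, J u ∈ hsSubspace s Ω μ := fun u => hV.range_eq ▸ ⟨u, rfl⟩
  have hex : ∀ U ∈ hsSubspace s Ω μ, ∃ u, J u = U := fun U hU => by
    rw [← hV.range_eq] at hU
    exact hU
  have hgraph : ∀ U f, (U, f) ∈ energyOperatorGraph s d Ω μ K ζ b ↔ U = -formInverse J F f := by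
    intro U f
    constructor
    · rintro ⟨hU, hUf⟩
      obtain ⟨u, hu⟩ := hex U hU
      change ∀ W ∈ hsSubspace s Ω μ, EnergyConverges s d Ω μ K ζ b U W ∧
        energyForm s d Ω μ K ζ b U W = inner ℂ W (-f) at hUf
      rw [← hu] at hUf ⊢
      refine (hF.forall_inner_eq_iff hV.injective).1 fun w => ?_
      exact (hE u w).2.symm.trans (hUf _ (hmem w)).2
    · intro hU
      obtain ⟨u, hu⟩ : ∃ u, J u = U := by
        refine ⟨-(Ring.inverse F (ContinuousLinearMap.adjoint J f)), ?_⟩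
        rw [hU, map_neg]
        rfl
      have hw := (hF.forall_inner_eq_iff hV.injective).2 (hu.trans hU)
      refine ⟨hu ▸ hmem u, fun W hW => ?_⟩
      obtain ⟨w, rfl⟩ := hex W hW
      have := hE u w
      rw [hw w, hu] at this
      exact this
  intro U f
  rw [energyOperator, Submodule.toLinearPMap_graph_eq]
  · exact hgraph U f
  · rintro ⟨U, f⟩ hq hU
    have h1 := (hgraph U f).1 hq
    have h2 : formInverse J F f = formInverse J F 0 := by
      rw [map_zero, ← neg_eq_zero, ← h1]
      exact hU
    exact hF.formInverse_injective hV.injective hV.denseRange h2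

end IsFormSpace

end EnergyOperatorFamily

/-! ### Sectoriality, domains of fractional powers and the Hölder estimate -/

theorem mainTheorem8 (N : ℕ) (s d ε δ T η : ℝ)
    (hs : 0 < s) (hs1 : s < 1) (hd : 0 < d) (hdN : d ≤ N)
    (hNd : (N : ℝ) - d < 2 * s) (hsN : 2 * s < N)
    (hε : 0 < ε) (hδ : 0 < δ) (hT : 0 < T) (hη : η ∈ Set.Ioc (1 / 2 : ℝ) 1)
    (Ω : Set (EuclideanSpace ℝ (Fin N)))
    (hΩ : IsEpsDeltaDomain ε δ Ω) (hΩb : Bornology.IsBounded Ω)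
    (μ : MeasureTheory.Measure (EuclideanSpace ℝ (Fin N)))
    (hμ : IsDMeasure d (frontier Ω) μ)
    (K ζ : ℝ → EuclideanSpace ℝ (Fin N) → EuclideanSpace ℝ (Fin N) → ℝ)
    (b : ℝ → EuclideanSpace ℝ (Fin N) → ℝ)
    (hK : IsAdmissibleKernel T η Ω (MeasureTheory.volume.restrict Ω) K)
    (hζ : IsAdmissibleKernel T η (frontier Ω) μ ζ)
    (hb : IsAdmissiblePotential T η (frontier Ω) μ b)
    (A : ℝ → BulkBoundaryL2 Ω μ →ₗ.[ℂ] BulkBoundaryL2 Ω μ)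
    (hA : ∀ t, A t = energyOperator s d Ω μ (K t) (ζ t) (b t)) :
    -- sectoriality, uniform resolvent bounds, uniform invertibility
    (∃ ω M M₁ : ℝ, 0 < ω ∧ ω < Real.pi / 2 ∧ 1 ≤ M ∧ ∀ t ∈ Set.Icc 0 T,
      opSpectrum (-A t) ⊆ openSector ω ∧
      (∀ z : ℂ, z ∉ openSector ω → z ≠ 0 →
        HasBoundedInverse (shiftSub z (-A t)) ∧
          ‖boundedInverse (shiftSub z (-A t))‖ ≤ M / ‖z‖) ∧
      HasBoundedInverse (A t) ∧ ‖boundedInverse (A t)‖ ≤ M₁) ∧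
    -- domains
    (∀ t ∈ Set.Icc 0 T, ∀ τ ∈ Set.Icc 0 T,
      (A t).domain ≤ (fracPower (-A τ) (1 / 2)).domain ∧
      (fracPower (-A τ) (1 / 2)).domain = hsSubspace s Ω μ ∧
      ∀ ν : ℝ, 0 < ν → ν ≤ 1 / 2 → (A t).domain ≤ (fracPower (-A τ) ν).domain) ∧
    (∀ u : EuclideanSpace ℝ (Fin N) → ℂ, MemHs s Ω u →
      ∃ U ∈ hsSubspace s Ω μ, U =ᵐ[MeasureTheory.volume.restrict Ω] u) ∧
    -- Hölder continuity of the inverses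
    (∃ C : ℝ, 0 < C ∧ ∀ t ∈ Set.Icc 0 T, ∀ τ ∈ Set.Icc 0 T,
      ∃ B : BulkBoundaryL2 Ω μ →L[ℂ] BulkBoundaryL2 Ω μ,
        (∀ f, ∃ g : (fracPower (-A t) (1 / 2)).domain,
          (g : BulkBoundaryL2 Ω μ) = (boundedInverse (A t) - boundedInverse (A τ)) f ∧
            fracPower (-A t) (1 / 2) g = B f) ∧
        ‖B‖ ≤ C * |t - τ| ^ η) := by
  have hN : 0 < N := by
    have : (0 : ℝ) < N := by linarith
    exact_mod_cast this
  have : Nonempty (Fin N) := ⟨⟨0, hN⟩⟩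
  have hβ : 0 < 2 * s - (N : ℝ) + d := by linarith
  have hη0 : 0 < η := by linarith [hη.1]
  obtain ⟨c, v, r₀, k, hG⟩ := exists_traceGeometry hε hδ hΩ hΩb hμ
  have := hG.isFinite
  -- only the properties collected in `IsFormSpace` are used of the form domain from here on; the
  -- new space `V` keeps unification from unfolding its construction
  obtain ⟨V, _, _, _, J, P, R, Q, hV⟩ : ∃ (V : Type) (_ : NormedAddCommGroup V)
      (_ : InnerProductSpace ℂ V) (_ : CompleteSpace V) (J : V →L[ℂ] BulkBoundaryL2 Ω μ)
      (P : V →L[ℂ] Lp ℂ 2 ((volume.restrict Ω).prod (volume.restrict Ω))) (R : V →L[ℂ] Lp ℂ 2 μ)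
      (Q : V →L[ℂ] Lp ℂ 2 (μ.prod μ)), IsFormSpace s d Ω μ J P R Q :=
    ⟨formDomain s d Ω μ, inferInstance, inferInstance,
      hG.isCompleteSpace_formDomain hs hd hβ, _, _, _, _,
      hG.isFormSpace_formDomain hs hs1 hd hβ⟩
  obtain ⟨γ, κ, L, F, hγ, hκ, hL, hF⟩ :=
    hV.exists_riesz_family hN hs hs1 hT hη0 hG.mem_frontier hK hζ hb
  have hop : ∀ t ∈ Icc 0 T, IsFormOperator J (F t) (A t) := fun t ht => by
    rw [hA t]
    exact hV.isFormOperator_energyOperator (hF t ht).1 (hF t ht).2.2.1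
  have hdom : ∀ t ∈ Icc 0 T, ∀ τ ∈ Icc 0 T,
      (A t).domain ≤ (fracPower (-A τ) (1 / 2)).domain := fun t ht τ hτ => by
    rw [(hop τ hτ).domain_fracPower_half (hF τ hτ).1 hV.injective hV.denseRange]
    exact (hop t ht).domain_le_range
  refine ⟨⟨Real.pi / 4, 3, ‖J‖ * (γ⁻¹ * ‖J‖), by positivity, by linarith [Real.pi_pos],
    by norm_num, fun t ht => (hop t ht).sectorial (hF t ht).1⟩,
    fun t ht τ hτ => ⟨hdom t ht τ hτ, ?_, fun ν h0 h1 =>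
      (hdom t ht τ hτ).trans ((hop τ hτ).domain_fracPower_half_le h0 h1)⟩,
    fun u hu => hG.exists_mem_hsSubspace hs hd hβ hu, ?_⟩
  · rw [(hop τ hτ).domain_fracPower_half (hF τ hτ).1 hV.injective hV.denseRange, hV.range_eq]
  · refine ⟨κ / Real.sqrt γ * (γ⁻¹ * L * γ⁻¹ * ‖J‖) + 1, by positivity, fun t ht τ hτ => ?_⟩
    obtain ⟨B, hB, hBn⟩ := (hop t ht).exists_sqrt_inverse_sub_inverse (hop τ hτ) (hF t ht).1
      (hF τ hτ).1 hV.injective hV.denseRange (hF t ht).2.1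
    refine ⟨B, hB, hBn.trans ?_⟩
    have h1 := (hF t ht).2.2.2 τ hτ
    have h2 : 0 ≤ |t - τ| ^ η := by positivity
    calc _ ≤ κ / Real.sqrt γ * (γ⁻¹ * (L * |t - τ| ^ η) * γ⁻¹ * ‖J‖) := by gcongr
      _ = κ / Real.sqrt γ * (γ⁻¹ * L * γ⁻¹ * ‖J‖) * |t - τ| ^ η := by ring
      _ ≤ _ := by
        gcongr
        linarith

end
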